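/- A \emph{dependent type theory} $\mathbb{T}$ is given by expressions built from variables, the identity-type constructors $\mathrm{Id}_A(a,b)$, $\mathrm{r}(a)$, $\mathrm{J}(a,b,p,[x]d)$ and an arbitrary signature of further symbols with binding, together with a set of deduction rules for the judgements $A\in\mathrm{Type}$, $a\in A$, $A=B\in\mathrm{Type}$, $a=b\in A$ relative to contexts. These rules contain: presuppositions, variables, weakening, substitution, the rules making definitional equality an equivalence relation compatible with substitution and with all identity-type constructors, type conversion, and the formation, introduction, elimination and computation rules for identity types, where elimination is $$\frac{p\in\mathrm{Id}_A(a,b)\qquad (x\in A,\ \Theta(x,x,\mathrm{r}(x)))\ \ d\in C(x,x,\mathrm{r}(x))}{(\Theta(a,b,p))\ \ \mathrm{J}(a,b,p,[x]d)\in C(a,b,p)}$$ with computation $\mathrm{J}(a,a,\mathrm{r}(a),[x]d)=d[a/x]$, for any dependent context $\Theta$ relative to $(x\in A,\,y\in A,\,u\in\mathrm{Id}_A(x,y))$; all rules are relative to an arbitrary ambient context. The \emph{classifying category} $\mathcal{C}(\mathbb{T})$ has as objects the well-formed contexts, up to renaming of variables and componentwise definitional equality, and as maps the context morphisms, up to pointwise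 definitional equality; composition is substitution. A \emph{global element} of $\Phi$ is a map from the empty context to $\Phi$. For a context $\Phi$ with elements $a,b$, the \emph{identity context} $\mathrm{Id}_\Phi(a,b)$ is defined by recursion on the length of $\Phi$: it is empty if $\Phi$ is, and for $\Phi'=(\Phi,\,x\in A)$, $a'=(a,\alpha)$, $b'=(b,\beta)$ it is $$\mathrm{Id}_{\Phi'}(a',b')=\big(u\in \mathrm{Id}_\Phi(a,b),\ v\in\mathrm{Id}_{A(b)}(u_!(\alpha),\beta)\big).$$ Here $u_!(e)=\mathrm{J}(a,b,u,[\_]e)$ is transport along $u$, and $\mathrm{J}(a,b,p,[x]d)$ for elements $a=(a_0,\dots,a_{n-1})$, $b$ of $\Phi$, $p\in\mathrm{Id}_\Phi(a,b)$ and $x=(x_0,\dots,x_{n-1})$ is the iterated term $\mathrm{J}(a_0,b_0,p_0,[x_0]\mathrm{J}(a_1,b_1,p_1,[x_1]\cdots d))$, taken componentwise if $d$ is a sequence. For a sequence $a$ write $\mathrm{r}(a)=(\mathrm{r}(a_0),\dots,\mathrm{r}(a_{n-1}))$. For global elements $a,b$ of $\Phi$, a \emph{path} from $a$ to $b$ is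 a global element of $\mathrm{Id}_\Phi(a,b)$; two paths $p,q$ are \emph{homotopic} if $\mathrm{Id}_{\mathrm{Id}_\Phi(a,b)}(p,q)$ has a global element. \textbf{Proposition.} Let $\mathbb{T}$ be a dependent type theory with identity types. For every object $\Phi$ of $\mathcal{C}(\mathbb{T})$, homotopy is an equivalence relation on paths, and there is a groupoid $\mathcal{F}(\Phi)$ whose objects are the global elements of $\Phi$, whose maps $a\to b$ are the homotopy classes $[p]$ of paths from $a$ to $b$, and in which $$[q]\circ[p]=[q_!(p)],\qquad 1_a=[\mathrm{r}(a)],\qquad [p]^{-1}=[\mathrm{J}(a,b,p,[x]\mathrm{r}(x))].$$ The function $\Phi\mapsto\mathcal{F}(\Phi)$ extends to a functor $\mathcal{F}:\mathcal{C}(\mathbb{T})\to\mathbf{Gpd}$ into the category of small groupoids and functors, where for a context morphism $f:\Phi\to\Psi$ the functor $\mathcal{F}(f)$ sends $a$ to $f(a)$ and $[p]:a\to b$ to $[f(p)]$, with $f(p)=\mathrm{J}(a,b,p,[x]\mathrm{r}(f(x)))$. -/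

import Mathlib

open CategoryTheory

universe u

namespace DTT

/-- The expression-forming symbols of a type theory other than those for identity types: each symbol
has finitely many arguments, and binds `binds o i` variables in its `i`-th argument. -/
structure Signature where
  Op : Type u
  arity : Op → ℕ
  binds : (o : Op) → Fin (arity o) → ℕ

/-- Raw expressions, up to renaming of bound variables, whose free variables are among
`x_0, ..., x_(n-1)`.  An expression in one more variable (a bound one) uses `Fin.last` for it. -/
inductive Expr (S : Signature.{u}) : ℕ → Type u
  | var {n : ℕ} (i : Fin n) : Expr S n
  | id {n : ℕ} (A a b : Expr S n) : Expr S n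
  | refl {n : ℕ} (a : Expr S n) : Expr S n
  | J {n : ℕ} (a b p : Expr S n) (d : Expr S (n + 1)) : Expr S n
  | op {n : ℕ} (o : S.Op) (args : (i : Fin (S.arity o)) → Expr S (n + S.binds o i)) : Expr S n

/-- Sequences of `m` expressions in `n` variables. -/
abbrev Sub (S : Signature.{u}) (m n : ℕ) : Type u := Fin m → Expr S n

/-- Extend a renaming by `k` further (bound) variables. -/
def liftRen {m n : ℕ} (ρ : Fin m → Fin n) : (k : ℕ) → Fin (m + k) → Fin (n + k)
  | 0 => ρ
  | k + 1 => Fin.snoc (α := fun _ => Fin (n + k + 1))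
      (fun i => (liftRen ρ k i).castSucc) (Fin.last (n + k))

namespace Expr

variable {S : Signature.{u}}

/-- Renaming of free variables. -/
def rename : {m : ℕ} → Expr S m → {n : ℕ} → (Fin m → Fin n) → Expr S n
  | _, var i, _, ρ => var (ρ i)
  | _, id A a b, _, ρ => id (A.rename ρ) (a.rename ρ) (b.rename ρ)
  | _, refl a, _, ρ => refl (a.rename ρ)
  | _, J a b p d, _, ρ => J (a.rename ρ) (b.rename ρ) (p.rename ρ) (d.rename (liftRen ρ 1))
  | _, op o args, _, ρ => op o (fun i => (args i).rename (liftRen ρ (S.binds o i)))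

/-- Weakening by `k` variables at the end. -/
def wk {n : ℕ} (k : ℕ) (A : Expr S n) : Expr S (n + k) := A.rename (Fin.castAdd k)

end Expr

/-- Extend a substitution by `k` further (bound) variables. -/
def liftSub {S : Signature.{u}} {m n : ℕ} (σ : Sub S m n) : (k : ℕ) → Sub S (m + k) (n + k)
  | 0 => σ
  | k + 1 => Fin.snoc (α := fun _ => Expr S (n + k + 1))
      (fun i => (liftSub σ k i).wk 1) (Expr.var (Fin.last (n + k)))

/-- Capture-avoiding simultaneous substitution of `σ i` for `x_i`. -/
def Expr.subst {S : Signature.{u}} : {m : ℕ} → Expr S m → {n : ℕ} → Sub S m n → Expr S n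
  | _, .var i, _, σ => σ i
  | _, .id A a b, _, σ => .id (A.subst σ) (a.subst σ) (b.subst σ)
  | _, .refl a, _, σ => .refl (a.subst σ)
  | _, .J a b p d, _, σ => .J (a.subst σ) (b.subst σ) (p.subst σ) (d.subst (liftSub σ 1))
  | _, .op o args, _, σ => .op o (fun i => (args i).subst (liftSub σ (S.binds o i)))

section SubstLemmas

variable {S : Signature.{u}}

theorem liftRen_succ {m n : ℕ} (ρ : Fin m → Fin n) (k : ℕ) :
    liftRen ρ (k + 1) = liftRen (liftRen ρ k) 1 := rfl

theorem liftSub_succ {m n : ℕ} (σ : Sub S m n) (k : ℕ) :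
    liftSub σ (k + 1) = liftSub (liftSub σ k) 1 := rfl

@[simp] theorem liftRen_one_castSucc {m n : ℕ} (ρ : Fin m → Fin n) (i : Fin m) :
    liftRen ρ 1 i.castSucc = (ρ i).castSucc := by simp [liftRen]

@[simp] theorem liftRen_one_last {m n : ℕ} (ρ : Fin m → Fin n) :
    liftRen ρ 1 (Fin.last m) = Fin.last n := by simp [liftRen]

@[simp] theorem liftSub_one_castSucc {m n : ℕ} (σ : Sub S m n) (i : Fin m) :
    liftSub σ 1 i.castSucc = (σ i).wk 1 := by simp [liftSub]

@[simp] theorem liftSub_one_last {m n : ℕ} (σ : Sub S m n) :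
    liftSub σ 1 (Fin.last m) = .var (Fin.last n) := by simp [liftSub]

theorem liftRen_comp {l m n : ℕ} (ρ : Fin l → Fin m) (τ : Fin m → Fin n) (k : ℕ) :
    liftRen (τ ∘ ρ) k = liftRen τ k ∘ liftRen ρ k := by
  induction k with
  | zero => rfl
  | succ k ih =>
    rw [liftRen_succ (τ ∘ ρ), ih, liftRen_succ τ k, liftRen_succ ρ k]
    funext i
    refine Fin.lastCases ?_ (fun i => ?_) i <;> simp

theorem rename_rename {l : ℕ} (e : Expr S l) : ∀ {m n : ℕ} (ρ : Fin l → Fin m) (τ : Fin m → Fin n),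
    (e.rename ρ).rename τ = e.rename (τ ∘ ρ) := by
  induction e <;> intros <;> simp_all [Expr.rename, liftRen_comp]

theorem liftSub_var (n k : ℕ) : liftSub (S := S) (m := n) Expr.var k = Expr.var := by
  induction k with
  | zero => rfl
  | succ k ih =>
    rw [liftSub_succ Expr.var k, ih]
    funext i
    refine Fin.lastCases ?_ (fun i => ?_) i <;> simp [Expr.wk, Expr.rename]
    rfl

@[simp] theorem subst_var {n : ℕ} (e : Expr S n) : e.subst Expr.var = e := by
  induction e <;> simp_all [Expr.subst, liftSub_var]

theorem liftSub_comp_liftRen {l m n : ℕ} (ρ : Fin l → Fin m) (σ : Sub S m n) (k : ℕ) :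
    liftSub σ k ∘ liftRen ρ k = liftSub (σ ∘ ρ) k := by
  induction k with
  | zero => rfl
  | succ k ih =>
    rw [liftRen_succ ρ k, liftSub_succ σ k, liftSub_succ (σ ∘ ρ) k, ← ih]
    funext i
    refine Fin.lastCases ?_ (fun i => ?_) i <;> simp

theorem rename_subst {l : ℕ} (e : Expr S l) : ∀ {m n : ℕ} (ρ : Fin l → Fin m) (σ : Sub S m n),
    (e.rename ρ).subst σ = e.subst (σ ∘ ρ) := by
  induction e <;> intros <;> simp_all [Expr.rename, Expr.subst, liftSub_comp_liftRen]

theorem rename_eq_subst {m n : ℕ} (e : Expr S m) (ρ : Fin m → Fin n) :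
    e.rename ρ = e.subst (Expr.var ∘ ρ) := by
  rw [← rename_subst, subst_var]

theorem liftRen_comp_liftSub {l m n : ℕ} (σ : Sub S l m) (τ : Fin m → Fin n) (k : ℕ) :
    (fun i => (liftSub σ k i).rename (liftRen τ k)) = liftSub (fun i => (σ i).rename τ) k := by
  induction k with
  | zero => rfl
  | succ k ih =>
    rw [liftRen_succ τ k, liftSub_succ σ k, liftSub_succ (fun i => (σ i).rename τ) k, ← ih]
    funext i
    refine Fin.lastCases ?_ (fun i => ?_) i
    · simp [Expr.rename]
    · simp only [liftSub_one_castSucc, Expr.wk, rename_rename]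
      congr 1
      funext j
      exact liftRen_one_castSucc _ _

theorem subst_rename {l : ℕ} (e : Expr S l) : ∀ {m n : ℕ} (σ : Sub S l m) (τ : Fin m → Fin n),
    (e.subst σ).rename τ = e.subst (fun i => (σ i).rename τ) := by
  induction e <;> intros <;> simp_all [Expr.rename, Expr.subst, liftRen_comp_liftSub]

theorem liftSub_comp {l m n : ℕ} (σ : Sub S l m) (τ : Sub S m n) (k : ℕ) :
    (fun i => (liftSub σ k i).subst (liftSub τ k)) = liftSub (fun i => (σ i).subst τ) k := by
  induction k with
  | zero => rfl
  | succ k ih =>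
    rw [liftSub_succ σ k, liftSub_succ τ k, liftSub_succ (fun i => (σ i).subst τ) k, ← ih]
    funext i
    refine Fin.lastCases ?_ (fun i => ?_) i
    · simp [Expr.subst]
    · simp only [liftSub_one_castSucc, Expr.wk, rename_subst, subst_rename]
      congr 1
      funext j
      exact liftSub_one_castSucc _ _

theorem subst_subst {l : ℕ} (e : Expr S l) : ∀ {m n : ℕ} (σ : Sub S l m) (τ : Sub S m n),
    (e.subst σ).subst τ = e.subst (fun i => (σ i).subst τ) := by
  induction e <;> intros <;> simp_all [Expr.subst, liftSub_comp]

end SubstLemmas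

/-- Raw contexts `(x_0 ∈ A_0, ..., x_(n-1) ∈ A_(n-1)(x_0, ..., x_(n-2)))` of length `n`. -/
inductive Ctx (S : Signature.{u}) : ℕ → Type u
  | nil : Ctx S 0
  | snoc {n : ℕ} (Γ : Ctx S n) (A : Expr S n) : Ctx S (n + 1)

/-- Raw dependent contexts of length `k` relative to a context of length `n`. -/
inductive Tele (S : Signature.{u}) (n : ℕ) : ℕ → Type u
  | nil : Tele S n 0
  | snoc {k : ℕ} (Θ : Tele S n k) (A : Expr S (n + k)) : Tele S n (k + 1)

namespace Tele

variable {S : Signature.{u}} {m n : ℕ}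

def rename (ρ : Fin m → Fin n) : {k : ℕ} → Tele S m k → Tele S n k
  | _, nil => nil
  | _, snoc (k := k) Θ A => snoc (Θ.rename ρ) (A.rename (liftRen ρ k))

def subst (σ : Sub S m n) : {k : ℕ} → Tele S m k → Tele S n k
  | _, nil => nil
  | _, snoc (k := k) Θ A => snoc (Θ.subst σ) (A.subst (liftSub σ k))

end Tele

namespace Ctx

variable {S : Signature.{u}}

/-- The concatenation `(Γ, Θ)`. -/
def append {n : ℕ} (Γ : Ctx S n) : {k : ℕ} → Tele S n k → Ctx S (n + k)
  | _, .nil => Γ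
  | _, .snoc Θ A => (Γ.append Θ).snoc A

/-- A context, regarded as a dependent context relative to any context of length `m`. -/
def toTele (m : ℕ) : {n : ℕ} → Ctx S n → Tele S m n
  | _, .nil => .nil
  | _, .snoc Γ A => (Γ.toTele m).snoc (A.rename (Fin.natAdd m))

end Ctx

/-- The four forms of judgement, `A ∈ Type`, `a ∈ A`, `A = B ∈ Type`, `a = b ∈ A`. -/
inductive Judgement (S : Signature.{u}) (n : ℕ) : Type u
  | isType (A : Expr S n)
  | hasType (a A : Expr S n)
  | eqType (A B : Expr S n)
  | eqTerm (a b A : Expr S n)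

namespace Judgement

variable {S : Signature.{u}} {m n : ℕ}

def rename (ρ : Fin m → Fin n) : Judgement S m → Judgement S n
  | isType A => isType (A.rename ρ)
  | hasType a A => hasType (a.rename ρ) (A.rename ρ)
  | eqType A B => eqType (A.rename ρ) (B.rename ρ)
  | eqTerm a b A => eqTerm (a.rename ρ) (b.rename ρ) (A.rename ρ)

def subst (σ : Sub S m n) : Judgement S m → Judgement S n
  | isType A => isType (A.subst σ)
  | hasType a A => hasType (a.subst σ) (A.subst σ)
  | eqType A B => eqType (A.subst σ) (B.subst σ)
  | eqTerm a b A => eqTerm (a.subst σ) (b.subst σ) (A.subst σ)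

end Judgement

/-- A judgement relative to a context, `(Γ) 𝒥`. -/
structure Sequent (S : Signature.{u}) where
  length : ℕ
  ctx : Ctx S length
  jdg : Judgement S length

/-- A dependent type theory with identity types: a signature, and a set of (instances of) deduction
rules, each with finitely many premisses and a conclusion.  These are the rules of the theory
*beyond* the structural rules and the rules for identity types, which are part of every theory (see
`Derivable`). -/
structure TypeTheory where
  sig : Signature.{u}
  rules : Set (List (Sequent sig) × Sequent sig)

section Substitutions

variable {S : Signature.{u}} {n : ℕ}

/-- The substitution `[a/x]` of `a` for the last variable. -/
def inst (a : Expr S n) : Sub S (n + 1) n :=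
  Fin.snoc (α := fun _ => Expr S n) Expr.var a

/-- The substitution `[a/x, b/y, p/u]` for the last three variables. -/
def inst3 (a b p : Expr S n) : Sub S (n + 3) n :=
  Fin.snoc (α := fun _ => Expr S n) (Fin.snoc (α := fun _ => Expr S n) (inst a) b) p

/-- The substitution `[x/x, x/y, r(x)/u]` for the last three variables. -/
def diag : Sub S (n + 3) (n + 1) :=
  Fin.snoc (α := fun _ => Expr S (n + 1)) (Fin.snoc (α := fun _ => Expr S (n + 1)) Expr.var
    (.var (Fin.last n))) (.refl (.var (Fin.last n)))

/-- The context `(Γ, x ∈ A, y ∈ A, u ∈ Id_A(x, y))`. -/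
def Ctx.pathSpace (Γ : Ctx S n) (A : Expr S n) : Ctx S (n + 3) :=
  ((Γ.snoc A).snoc (A.wk 1)).snoc
    (.id (A.wk 2) (.var (Fin.last n).castSucc) (.var (Fin.last (n + 1))))

/-- The renaming that moves the variable `x` of `(Γ, x ∈ A, Θ)` to the end, so that it can be
bound in an expression whose other variables are those of `(Γ, Θ)`. -/
def toEnd (n k : ℕ) : Fin (n + 1 + k) → Fin (n + k + 1) :=
  Fin.append
    (Fin.snoc (α := fun _ => Fin (n + k + 1))
      (fun i : Fin n => (Fin.castAdd k i).castSucc) (Fin.last (n + k)))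
    (fun j : Fin k => (Fin.natAdd n j).castSucc)

/-- The expression `J(a, b, p, [x] d)` in the variables of `(Γ, Θ)`, where `a`, `b`, `p` are
expressions in the variables of `Γ`, and `d` is one in the variables of `(Γ, x, Θ)`. -/
def elimTerm (k : ℕ) (a b p : Expr S n) (d : Expr S (n + 1 + k)) : Expr S (n + k) :=
  .J (a.wk k) (b.wk k) (p.wk k) (d.rename (toEnd n k))

end Substitutions

open Judgement in
/-- Derivability in a type theory `T`. -/
inductive Derivable (T : TypeTheory.{u}) : {n : ℕ} → Ctx T.sig n → Judgement T.sig n → Prop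
  /- The rules that are particular to `T`. -/
  | rule (prems : List (Sequent T.sig)) (concl : Sequent T.sig) :
      (prems, concl) ∈ T.rules → (∀ s ∈ prems, Derivable T s.ctx s.jdg) →
      Derivable T concl.ctx concl.jdg
  /- Presuppositions of judgements. -/
  | presup_ctx {n : ℕ} {Γ : Ctx T.sig n} {A : Expr T.sig n} {j : Judgement T.sig (n + 1)} :
      Derivable T (Γ.snoc A) j → Derivable T Γ (isType A)
  | presup_hasType {n : ℕ} {Γ : Ctx T.sig n} {a A : Expr T.sig n} :
      Derivable T Γ (hasType a A) → Derivable T Γ (isType A)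
  | presup_eqType_left {n : ℕ} {Γ : Ctx T.sig n} {A B : Expr T.sig n} :
      Derivable T Γ (eqType A B) → Derivable T Γ (isType A)
  | presup_eqType_right {n : ℕ} {Γ : Ctx T.sig n} {A B : Expr T.sig n} :
      Derivable T Γ (eqType A B) → Derivable T Γ (isType B)
  | presup_eqTerm_left {n : ℕ} {Γ : Ctx T.sig n} {a b A : Expr T.sig n} :
      Derivable T Γ (eqTerm a b A) → Derivable T Γ (hasType a A)
  | presup_eqTerm_right {n : ℕ} {Γ : Ctx T.sig n} {a b A : Expr T.sig n} :
      Derivable T Γ (eqTerm a b A) → Derivable T Γ (hasType b A)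
  /- Axiom, weakening and substitution. -/
  | var {n : ℕ} {Γ : Ctx T.sig n} {A : Expr T.sig n} :
      Derivable T Γ (isType A) →
      Derivable T (Γ.snoc A) (hasType (.var (Fin.last n)) (A.wk 1))
  | weaken {n k : ℕ} {Γ : Ctx T.sig n} {Δ : Tele T.sig n k} {A : Expr T.sig n}
      {j : Judgement T.sig (n + k)} :
      Derivable T (Γ.append Δ) j → Derivable T Γ (isType A) →
      Derivable T ((Γ.snoc A).append (Δ.rename Fin.castSucc)) (j.rename (liftRen Fin.castSucc k))
  | subst {n k : ℕ} {Γ : Ctx T.sig n} {A : Expr T.sig n} {Δ : Tele T.sig (n + 1) k}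
      {j : Judgement T.sig (n + 1 + k)} {a : Expr T.sig n} :
      Derivable T ((Γ.snoc A).append Δ) j → Derivable T Γ (hasType a A) →
      Derivable T (Γ.append (Δ.subst (inst a))) (j.subst (liftSub (inst a) k))
  /- Substitution of definitionally equal elements. -/
  | subst_eqType {n k : ℕ} {Γ : Ctx T.sig n} {A : Expr T.sig n} {Δ : Tele T.sig (n + 1) k}
      {C : Expr T.sig (n + 1 + k)} {a b : Expr T.sig n} :
      Derivable T ((Γ.snoc A).append Δ) (isType C) → Derivable T Γ (eqTerm a b A) →
      Derivable T (Γ.append (Δ.subst (inst a)))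
        (eqType (C.subst (liftSub (inst a) k)) (C.subst (liftSub (inst b) k)))
  | subst_eqTerm {n k : ℕ} {Γ : Ctx T.sig n} {A : Expr T.sig n} {Δ : Tele T.sig (n + 1) k}
      {c C : Expr T.sig (n + 1 + k)} {a b : Expr T.sig n} :
      Derivable T ((Γ.snoc A).append Δ) (hasType c C) → Derivable T Γ (eqTerm a b A) →
      Derivable T (Γ.append (Δ.subst (inst a)))
        (eqTerm (c.subst (liftSub (inst a) k)) (c.subst (liftSub (inst b) k))
          (C.subst (liftSub (inst a) k)))
  /- Reflexivity, symmetry and transitivity of definitional equality of types. -/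
  | eqType_refl {n : ℕ} {Γ : Ctx T.sig n} {A : Expr T.sig n} :
      Derivable T Γ (isType A) → Derivable T Γ (eqType A A)
  | eqType_symm {n : ℕ} {Γ : Ctx T.sig n} {A B : Expr T.sig n} :
      Derivable T Γ (eqType A B) → Derivable T Γ (eqType B A)
  | eqType_trans {n : ℕ} {Γ : Ctx T.sig n} {A B C : Expr T.sig n} :
      Derivable T Γ (eqType A B) → Derivable T Γ (eqType B C) → Derivable T Γ (eqType A C)
  /- Reflexivity, symmetry and transitivity of definitional equality of elements. -/
  | eqTerm_refl {n : ℕ} {Γ : Ctx T.sig n} {a A : Expr T.sig n} :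
      Derivable T Γ (hasType a A) → Derivable T Γ (eqTerm a a A)
  | eqTerm_symm {n : ℕ} {Γ : Ctx T.sig n} {a b A : Expr T.sig n} :
      Derivable T Γ (eqTerm a b A) → Derivable T Γ (eqTerm b a A)
  | eqTerm_trans {n : ℕ} {Γ : Ctx T.sig n} {a b c A : Expr T.sig n} :
      Derivable T Γ (eqTerm a b A) → Derivable T Γ (eqTerm b c A) → Derivable T Γ (eqTerm a c A)
  /- Compatibility rules for definitional equality. -/
  | conv {n : ℕ} {Γ : Ctx T.sig n} {a A B : Expr T.sig n} :
      Derivable T Γ (hasType a A) → Derivable T Γ (eqType A B) → Derivable T Γ (hasType a B)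
  | conv_eq {n : ℕ} {Γ : Ctx T.sig n} {a b A B : Expr T.sig n} :
      Derivable T Γ (eqTerm a b A) → Derivable T Γ (eqType A B) → Derivable T Γ (eqTerm a b B)
  /- Identity types: formation, introduction, elimination and computation. -/
  | id_form {n : ℕ} {Γ : Ctx T.sig n} {A a b : Expr T.sig n} :
      Derivable T Γ (isType A) → Derivable T Γ (hasType a A) → Derivable T Γ (hasType b A) →
      Derivable T Γ (isType (.id A a b))
  | id_intro {n : ℕ} {Γ : Ctx T.sig n} {A a : Expr T.sig n} :
      Derivable T Γ (hasType a A) → Derivable T Γ (hasType (.refl a) (.id A a a))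
  | id_elim {n k : ℕ} {Γ : Ctx T.sig n} {A a b p : Expr T.sig n} {Θ : Tele T.sig (n + 3) k}
      {C : Expr T.sig (n + 3 + k)} {d : Expr T.sig (n + 1 + k)} :
      Derivable T Γ (hasType a A) → Derivable T Γ (hasType b A) →
      Derivable T Γ (hasType p (.id A a b)) →
      Derivable T ((Γ.pathSpace A).append Θ) (isType C) →
      Derivable T ((Γ.snoc A).append (Θ.subst diag)) (hasType d (C.subst (liftSub diag k))) →
      Derivable T (Γ.append (Θ.subst (inst3 a b p)))
        (hasType (elimTerm k a b p d) (C.subst (liftSub (inst3 a b p) k)))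
  | id_comp {n k : ℕ} {Γ : Ctx T.sig n} {A a : Expr T.sig n} {Θ : Tele T.sig (n + 3) k}
      {C : Expr T.sig (n + 3 + k)} {d : Expr T.sig (n + 1 + k)} :
      Derivable T Γ (hasType a A) →
      Derivable T ((Γ.pathSpace A).append Θ) (isType C) →
      Derivable T ((Γ.snoc A).append (Θ.subst diag)) (hasType d (C.subst (liftSub diag k))) →
      Derivable T (Γ.append (Θ.subst (inst3 a a (.refl a))))
        (eqTerm (elimTerm k a a (.refl a) d) (d.subst (liftSub (inst a) k))
          (C.subst (liftSub (inst3 a a (.refl a)) k)))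
  /- Definitional equality is a congruence for the type `A` in `Id_A(a, b)` and for the bound
  argument of `J`; for the other arguments this is substitution of equals. -/
  | id_congr {n : ℕ} {Γ : Ctx T.sig n} {A B a b : Expr T.sig n} :
      Derivable T Γ (eqType A B) → Derivable T Γ (hasType a A) → Derivable T Γ (hasType b A) →
      Derivable T Γ (eqType (.id A a b) (.id B a b))
  | id_elim_congr {n k : ℕ} {Γ : Ctx T.sig n} {A a b p : Expr T.sig n} {Θ : Tele T.sig (n + 3) k}
      {C : Expr T.sig (n + 3 + k)} {d e : Expr T.sig (n + 1 + k)} :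
      Derivable T Γ (hasType a A) → Derivable T Γ (hasType b A) →
      Derivable T Γ (hasType p (.id A a b)) →
      Derivable T ((Γ.pathSpace A).append Θ) (isType C) →
      Derivable T ((Γ.snoc A).append (Θ.subst diag)) (eqTerm d e (C.subst (liftSub diag k))) →
      Derivable T (Γ.append (Θ.subst (inst3 a b p)))
        (eqTerm (elimTerm k a b p d) (elimTerm k a b p e) (C.subst (liftSub (inst3 a b p) k)))

/-- Well-formed contexts. -/
def IsCtx (T : TypeTheory.{u}) : {n : ℕ} → Ctx T.sig n → Prop
  | _, .nil => True
  | _, .snoc Γ A => IsCtx T Γ ∧ Derivable T Γ (.isType A)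

/-- Componentwise definitional equality of contexts. -/
def CtxEq (T : TypeTheory.{u}) : {n : ℕ} → Ctx T.sig n → Ctx T.sig n → Prop
  | _, .nil, .nil => True
  | _, .snoc Γ A, .snoc Δ B => CtxEq T Γ Δ ∧ Derivable T Γ (.eqType A B)

/-- `f` is a context morphism `Φ → Ψ`. -/
def IsMor (T : TypeTheory.{u}) {n : ℕ} (Φ : Ctx T.sig n) :
    {m : ℕ} → Ctx T.sig m → Sub T.sig m n → Prop
  | _, .nil, _ => True
  | _, .snoc (n := m) Ψ B, f => IsMor T Φ Ψ (fun i => f i.castSucc) ∧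
      Derivable T Φ (.hasType (f (Fin.last m)) (B.subst fun i => f i.castSucc))

/-- Pointwise definitional equality of context morphisms `Φ → Ψ`. -/
def MorEq (T : TypeTheory.{u}) {n : ℕ} (Φ : Ctx T.sig n) :
    {m : ℕ} → Ctx T.sig m → Sub T.sig m n → Sub T.sig m n → Prop
  | _, .nil, _, _ => True
  | _, .snoc (n := m) Ψ B, f, g => MorEq T Φ Ψ (fun i => f i.castSucc) (fun i => g i.castSucc) ∧
      Derivable T Φ (.eqTerm (f (Fin.last m)) (g (Fin.last m)) (B.subst fun i => f i.castSucc))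

/-- `a` is a dependent element of the dependent context `Θ` relative to `Γ`, `(Γ) a ∈ Θ`. -/
def IsElem (T : TypeTheory.{u}) {m : ℕ} (Γ : Ctx T.sig m) :
    {k : ℕ} → Tele T.sig m k → Sub T.sig k m → Prop
  | _, .nil, _ => True
  | _, .snoc (k := k) Θ A, a => IsElem T Γ Θ (fun i => a i.castSucc) ∧
      Derivable T Γ (.hasType (a (Fin.last k))
        (A.subst (Fin.append Expr.var fun i => a i.castSucc)))

section Metatheory

variable {S : Signature.{u}}

/-- `f'`, `g'` are the extensions of `f`, `g` by the same variables, which range over types in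
`Γ'` extending `Γ`, and over their substitution instances along `f` in `Δ'` extending `Δ`. -/
inductive Ext {m n : ℕ} (Γ : Ctx S m) (Δ : Ctx S n) (f g : Sub S m n) :
    {m' n' : ℕ} → Ctx S m' → Ctx S n' → Sub S m' n' → Sub S m' n' → Prop
  | base : Ext Γ Δ f g Γ Δ f g
  | snoc {m' n' : ℕ} {Γ' : Ctx S m'} {Δ' : Ctx S n'} {f' g' : Sub S m' n'} (A : Expr S m') :
      Ext Γ Δ f g Γ' Δ' f' g' →
      Ext Γ Δ f g (Γ'.snoc A) (Δ'.snoc (A.subst f')) (liftSub f' 1) (liftSub g' 1)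

theorem Ext.eq_append {m n : ℕ} {Γ : Ctx S m} {Δ : Ctx S n} {f g : Sub S m n}
    {m' n' : ℕ} {Γ' : Ctx S m'} {Δ' : Ctx S n'} {f' g' : Sub S m' n'}
    (h : Ext Γ Δ f g Γ' Δ' f' g') :
    ∀ Q : ({m' n' : ℕ} → Ctx S m' → Ctx S n' → Sub S m' n' → Sub S m' n' → Prop),
      (∀ (k : ℕ) (Θ : Tele S m k), Q (Γ.append Θ) (Δ.append (Θ.subst f)) (liftSub f k)
        (liftSub g k)) → Q Γ' Δ' f' g' := by
  induction h with
  | base => intro Q h; exact h 0 .nil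
  | snoc A _ ih =>
    intro Q h
    exact ih (fun Γ' Δ' f' g' => ∀ A, Q (Γ'.snoc A) (Δ'.snoc (A.subst f')) (liftSub f' 1)
      (liftSub g' 1)) (fun k Θ A => h (k + 1) (Θ.snoc A)) A

theorem Ext.of_snoc {m n : ℕ} {Γ : Ctx S m} {Δ : Ctx S n} {f g : Sub S m n} {A : Expr S m}
    {m' n' : ℕ} {Γ' : Ctx S m'} {Δ' : Ctx S n'} {f' g' : Sub S m' n'}
    (h : Ext (Γ.snoc A) (Δ.snoc (A.subst f)) (liftSub f 1) (liftSub g 1) Γ' Δ' f' g') :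
    Ext Γ Δ f g Γ' Δ' f' g' := by
  induction h with
  | base => exact .snoc _ .base
  | snoc A _ ih => exact .snoc _ ih

theorem Ext.left {m n : ℕ} {Γ : Ctx S m} {Δ : Ctx S n} {f g : Sub S m n}
    {m' n' : ℕ} {Γ' : Ctx S m'} {Δ' : Ctx S n'} {f' g' : Sub S m' n'}
    (h : Ext Γ Δ f g Γ' Δ' f' g') : Ext Γ Δ f f Γ' Δ' f' f' := by
  induction h with
  | base => exact .base
  | snoc A _ ih => exact .snoc _ ih

theorem Ext.eq {m n : ℕ} {Γ : Ctx S m} {Δ : Ctx S n} {f g : Sub S m n}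
    {m' n' : ℕ} {Γ' : Ctx S m'} {Δ' : Ctx S n'} {f' g' : Sub S m' n'}
    (h : Ext Γ Δ f g Γ' Δ' f' g') (hfg : f = g) : f' = g' := by
  induction h with
  | base => exact hfg
  | snoc A _ ih => rw [ih]

theorem Ext.decomp {l m n : ℕ} {Γ : Ctx S l} (Δ : Ctx S m) {Ξ : Ctx S n} (f g : Sub S l m)
    (p q : Sub S m n) {f₁ g₁ : Sub S l n} (hf : f₁ = fun i => (f i).subst p)
    (hg : g₁ = fun i => (g i).subst q)
    {l' n' : ℕ} {Γ' : Ctx S l'} {Ξ' : Ctx S n'} {f' g' : Sub S l' n'}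
    (h : Ext Γ Ξ f₁ g₁ Γ' Ξ' f' g') :
    ∃ (m' : ℕ) (Δ' : Ctx S m') (F G : Sub S l' m') (P Q : Sub S m' n'),
      Ext Γ Δ f g Γ' Δ' F G ∧ Ext Δ Ξ p q Δ' Ξ' P Q ∧ f' = (fun i => (F i).subst P) ∧
        g' = fun i => (G i).subst Q := by
  induction h with
  | base => exact ⟨m, Δ, f, g, p, q, .base, .base, hf, hg⟩
  | snoc A _ ih =>
    obtain ⟨m', Δ', F, G, P, Q, h₁, h₂, rfl, rfl⟩ := ih
    refine ⟨m' + 1, Δ'.snoc (A.subst F), liftSub F 1, liftSub G 1, liftSub P 1, liftSub Q 1,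
      .snoc _ h₁, ?_, (liftSub_comp _ _ _).symm, (liftSub_comp _ _ _).symm⟩
    rw [← subst_subst]
    exact .snoc _ h₂

theorem liftSub_inst {m n : ℕ} (f : Sub S (m + 1) n) :
    f = fun i => (liftSub (fun i => f i.castSucc) 1 i).subst (inst (f (Fin.last m))) := by
  funext i
  refine Fin.lastCases ?_ (fun i => ?_) i
  · simp [Expr.subst, inst]
  · simp only [liftSub_one_castSucc, Expr.wk, rename_subst]
    conv_lhs => rw [← subst_var (f i.castSucc)]
    congr 1
    funext j
    exact (Fin.snoc_castSucc (α := fun _ => Expr S n) _ _ j).symm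

theorem wk_subst_castSucc {m n : ℕ} (A : Expr S m) (f : Sub S (m + 1) n) :
    (A.wk 1).subst f = A.subst fun i => f i.castSucc :=
  rename_subst A _ f

theorem subst_wk {m n : ℕ} (A : Expr S m) (f : Sub S m n) :
    (A.subst f).wk 1 = A.subst fun i => (f i).wk 1 :=
  subst_rename A f _

theorem Tele.rename_eq_subst {m n k : ℕ} (Θ : Tele S m k) (ρ : Fin m → Fin n) :
    Θ.rename ρ = Θ.subst (Expr.var ∘ ρ) := by
  induction Θ with
  | nil => rfl
  | snoc Θ A ih =>
    simp only [Tele.rename, Tele.subst, ih, DTT.rename_eq_subst, ← liftSub_comp_liftRen,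
      liftSub_var]

theorem Judgement.rename_eq_subst {m n : ℕ} (j : Judgement S m) (ρ : Fin m → Fin n) :
    j.rename ρ = j.subst (Expr.var ∘ ρ) := by
  cases j <;> simp only [Judgement.rename, Judgement.subst, DTT.rename_eq_subst]

theorem Judgement.subst_subst {l m n : ℕ} (j : Judgement S l) (f : Sub S l m) (g : Sub S m n) :
    (j.subst f).subst g = j.subst fun i => (f i).subst g := by
  cases j <;> simp only [Judgement.subst, DTT.subst_subst]

@[simp] theorem Judgement.subst_var {n : ℕ} (j : Judgement S n) : j.subst Expr.var = j := by
  cases j <;> simp only [Judgement.subst, DTT.subst_var]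

variable {T : TypeTheory.{u}}

/-- Derivability is preserved by substitution along all extensions of `f`. -/
def Adm (T : TypeTheory.{u}) {m n : ℕ} (Γ : Ctx T.sig m) (Δ : Ctx T.sig n) (f : Sub T.sig m n) :
    Prop :=
  ∀ ⦃m' n' : ℕ⦄ ⦃Γ' : Ctx T.sig m'⦄ ⦃Δ' : Ctx T.sig n'⦄ ⦃f' g' : Sub T.sig m' n'⦄,
    Ext Γ Δ f f Γ' Δ' f' g' → ∀ j, Derivable T Γ' j → Derivable T Δ' (j.subst f')

theorem Adm.lift {m n : ℕ} {Γ : Ctx T.sig m} {Δ : Ctx T.sig n} {f : Sub T.sig m n}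
    (h : Adm T Γ Δ f) (A : Expr T.sig m) :
    Adm T (Γ.snoc A) (Δ.snoc (A.subst f)) (liftSub f 1) :=
  fun _ _ _ _ _ _ he j hj => h he.of_snoc j hj

theorem Adm.comp {l m n : ℕ} {Γ : Ctx T.sig l} {Δ : Ctx T.sig m} {Ξ : Ctx T.sig n}
    {f : Sub T.sig l m} {g : Sub T.sig m n} (hf : Adm T Γ Δ f) (hg : Adm T Δ Ξ g) :
    Adm T Γ Ξ (fun i => (f i).subst g) := by
  intro _ _ _ _ _ _ he j hj
  obtain ⟨m', Δ', F, G, P, Q, h₁, h₂, rfl, rfl⟩ := Ext.decomp Δ f f g g rfl rfl he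
  rw [← Judgement.subst_subst]
  exact hg h₂ _ (hf h₁ _ hj)

theorem adm_wk {n : ℕ} {Γ : Ctx T.sig n} {A : Expr T.sig n} (h : Derivable T Γ (.isType A)) :
    Adm T Γ (Γ.snoc A) (Expr.var ∘ Fin.castSucc) := by
  intro _ _ _ _ _ _ he
  refine he.eq_append (fun Γ' Δ' f' _ => ∀ j, Derivable T Γ' j → Derivable T Δ' (j.subst f'))
    fun k Θ j hj => ?_
  have := Derivable.weaken hj h
  rwa [Tele.rename_eq_subst, Judgement.rename_eq_subst, ← liftSub_var (n + 1) k,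
    liftSub_comp_liftRen] at this

theorem adm_inst {n : ℕ} {Γ : Ctx T.sig n} {a A : Expr T.sig n}
    (h : Derivable T Γ (.hasType a A)) : Adm T (Γ.snoc A) Γ (inst a) := by
  intro _ _ _ _ _ _ he
  exact he.eq_append (fun Γ' Δ' f' _ => ∀ j, Derivable T Γ' j → Derivable T Δ' (j.subst f'))
    fun k Θ j hj => hj.subst h

theorem adm_of_eq {m n : ℕ} {Γ : Ctx T.sig m} {Δ : Ctx T.sig n} {f g : Sub T.sig m n}
    (h : Adm T Γ Δ f) (hfg : g = f) : Adm T Γ Δ g := hfg ▸ h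

theorem Ext.of_nil {n' m' : ℕ} {Γ' : Ctx S m'} {Δ' : Ctx S n'} {f' g' : Sub S m' n'}
    {f g : Sub S 0 0} (h : Ext .nil .nil f g Γ' Δ' f' g') :
    ∀ Q : ({m' n' : ℕ} → Ctx S m' → Ctx S n' → Sub S m' n' → Prop),
      (∀ (n : ℕ) (Γ : Ctx S n), Q Γ Γ Expr.var) → Q Γ' Δ' f' := by
  induction h with
  | base =>
    intro Q h
    have e : f = Expr.var := funext fun i => i.elim0
    exact e ▸ h 0 .nil
  | snoc A _ ih =>
    intro Q h
    refine ih (fun Γ' Δ' f' => ∀ A, Q (Γ'.snoc A) (Δ'.snoc (A.subst f')) (liftSub f' 1))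
      (fun n Γ A => ?_) A
    rw [subst_var, liftSub_var]
    exact h _ _

theorem adm_nil : {n : ℕ} → {Δ : Ctx T.sig n} → IsCtx T Δ → (f : Sub T.sig 0 n) →
    Adm T .nil Δ f
  | _, .nil, _, f => by
    intro _ _ _ _ _ _ he
    refine he.of_nil (fun Γ' Δ' f' => ∀ j, Derivable T Γ' j → Derivable T Δ' (j.subst f'))
      fun n Γ j hj => ?_
    rwa [Judgement.subst_var]
  | _, .snoc Δ A, h, f =>
    adm_of_eq ((adm_nil h.1 (fun i => i.elim0)).comp (adm_wk h.2)) (funext fun i => i.elim0)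

theorem IsMor.adm {n : ℕ} {Δ : Ctx T.sig n} (hΔ : IsCtx T Δ) : {m : ℕ} → {Γ : Ctx T.sig m} →
    {f : Sub T.sig m n} → IsMor T Δ Γ f → Adm T Γ Δ f
  | _, .nil, f, _ => adm_nil hΔ f
  | _, .snoc Γ A, f, h =>
    adm_of_eq (((IsMor.adm hΔ h.1).lift A).comp (adm_inst h.2)) (liftSub_inst f)

/-- Simultaneous substitution. -/
theorem Derivable.msubst {m n : ℕ} {Δ : Ctx T.sig n} {Γ : Ctx T.sig m} {f : Sub T.sig m n}
    {j : Judgement T.sig m} (h : Derivable T Γ j) (hΔ : IsCtx T Δ) (hf : IsMor T Δ Γ f) :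
    Derivable T Δ (j.subst f) :=
  hf.adm hΔ .base j h

theorem Derivable.wk {n : ℕ} {Γ : Ctx T.sig n} {A : Expr T.sig n} {j : Judgement T.sig n}
    (h : Derivable T Γ j) (hA : Derivable T Γ (.isType A)) :
    Derivable T (Γ.snoc A) (j.rename Fin.castSucc) := by
  rw [Judgement.rename_eq_subst]
  exact adm_wk hA .base j h

theorem IsMor.wk {n : ℕ} {Γ : Ctx T.sig n} {A : Expr T.sig n} (hA : Derivable T Γ (.isType A)) :
    {m : ℕ} → {Ψ : Ctx T.sig m} → {f : Sub T.sig m n} → IsMor T Γ Ψ f →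
    IsMor T (Γ.snoc A) Ψ (fun i => (f i).wk 1)
  | _, .nil, _, _ => trivial
  | _, .snoc Ψ B, f, h => by
    refine ⟨IsMor.wk hA h.1, ?_⟩
    have := h.2.wk hA
    rw [← subst_wk]
    exact this

theorem isMor_var_of_ctxEq : {n : ℕ} → {Γ Δ : Ctx T.sig n} → IsCtx T Δ → CtxEq T Γ Δ →
    IsMor T Δ Γ Expr.var
  | _, .nil, .nil, _, _ => trivial
  | _, .snoc Γ A, .snoc Δ B, hΔ, h => by
    have ih := isMor_var_of_ctxEq hΔ.1 h.1
    have h₂ := h.2.msubst hΔ.1 ih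
    rw [Judgement.subst_var] at h₂
    refine ⟨ih.wk hΔ.2, ?_⟩
    have h₃ := (Derivable.var hΔ.2).conv (h₂.wk hΔ.2).eqType_symm
    have e : A.rename Fin.castSucc = A.subst (fun i => Expr.var i.castSucc) := rename_eq_subst _ _
    rwa [e] at h₃

/-- Conversion of contexts. -/
theorem Derivable.ctxConv {n : ℕ} {Γ Δ : Ctx T.sig n} {j : Judgement T.sig n}
    (h : Derivable T Γ j) (hΔ : IsCtx T Δ) (e : CtxEq T Γ Δ) : Derivable T Δ j := by
  have := h.msubst hΔ (isMor_var_of_ctxEq hΔ e)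
  rwa [Judgement.subst_var] at this

theorem CtxEq.refl : {n : ℕ} → {Γ : Ctx T.sig n} → IsCtx T Γ → CtxEq T Γ Γ
  | _, .nil, _ => trivial
  | _, .snoc _ _, h => ⟨CtxEq.refl h.1, h.2.eqType_refl⟩

theorem CtxEq.symm : {n : ℕ} → {Γ Δ : Ctx T.sig n} → IsCtx T Δ → CtxEq T Γ Δ → CtxEq T Δ Γ
  | _, .nil, .nil, _, _ => trivial
  | _, .snoc _ _, .snoc _ _, hΔ, h =>
    ⟨CtxEq.symm hΔ.1 h.1, h.2.eqType_symm.ctxConv hΔ.1 h.1⟩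

theorem CtxEq.trans : {n : ℕ} → {Γ Δ Ξ : Ctx T.sig n} → IsCtx T Γ → IsCtx T Δ → CtxEq T Γ Δ →
    CtxEq T Δ Ξ → CtxEq T Γ Ξ
  | _, .nil, .nil, .nil, _, _, _, _ => trivial
  | _, .snoc _ _, .snoc _ _, .snoc _ _, hΓ, hΔ, h, k =>
    ⟨CtxEq.trans hΓ.1 hΔ.1 h.1 k.1,
      h.2.eqType_trans (k.2.ctxConv hΓ.1 (CtxEq.symm hΔ.1 h.1))⟩

theorem isMor_var {n : ℕ} {Γ : Ctx T.sig n} (h : IsCtx T Γ) : IsMor T Γ Γ Expr.var :=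
  isMor_var_of_ctxEq h (CtxEq.refl h)

theorem MorEq.isMor_left {n : ℕ} {Φ : Ctx T.sig n} : {m : ℕ} → {Ψ : Ctx T.sig m} →
    {f g : Sub T.sig m n} → MorEq T Φ Ψ f g → IsMor T Φ Ψ f
  | _, .nil, _, _, _ => trivial
  | _, .snoc _ _, _, _, h => ⟨h.1.isMor_left, h.2.presup_eqTerm_left⟩

/-- Substitution along definitionally equal context morphisms, and along all their extensions. -/
theorem MorEq.adm {n : ℕ} {Δ : Ctx T.sig n} (hΔ : IsCtx T Δ) : {m : ℕ} → {Γ : Ctx T.sig m} →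
    {f g : Sub T.sig m n} → MorEq T Δ Γ f g → ∀ {m' n' : ℕ} {Γ' : Ctx T.sig m'}
    {Δ' : Ctx T.sig n'} {f' g' : Sub T.sig m' n'}, Ext Γ Δ f g Γ' Δ' f' g' →
    (∀ C, Derivable T Γ' (.isType C) → Derivable T Δ' (.eqType (C.subst f') (C.subst g'))) ∧
    (∀ c C, Derivable T Γ' (.hasType c C) →
      Derivable T Δ' (.eqTerm (c.subst f') (c.subst g') (C.subst f')))
  | _, .nil, f, g, _, _, _, _, _, _, _, he => by
    have hfg : f = g := funext fun i => i.elim0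
    subst hfg
    have e := he.eq rfl
    subst e
    exact ⟨fun C hC => (adm_nil hΔ f he _ hC).eqType_refl,
      fun c C hc => (adm_nil hΔ f he _ hc).eqTerm_refl⟩
  | _, .snoc Γ A, f, g, h, _, _, _, _, _, _, he => by
    obtain ⟨m', Δ', F, G, P, Q, h₁, h₂, rfl, rfl⟩ :=
      Ext.decomp (Δ.snoc (A.subst fun i => f i.castSucc)) _ _ _ _
        (liftSub_inst f) (liftSub_inst g) he
    have ih := MorEq.adm hΔ h.1 h₁.of_snoc
    have ha := adm_inst h.2.presup_eqTerm_left
    have key := h₂.eq_append (fun Γ' Δ' f' g' =>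
      (∀ C, Derivable T Γ' (.isType C) → Derivable T Δ' (.eqType (C.subst f') (C.subst g'))) ∧
      (∀ c C, Derivable T Γ' (.hasType c C) →
        Derivable T Δ' (.eqTerm (c.subst f') (c.subst g') (C.subst f'))))
      (fun k Θ => ⟨fun C hC => hC.subst_eqType h.2, fun c C hc => hc.subst_eqTerm h.2⟩)
    simp only [← subst_subst]
    refine ⟨fun C hC => ?_, fun c C hc => ?_⟩
    · have h₃ := ih.1 C hC
      exact (ha h₂.left _ h₃).eqType_trans (key.1 _ h₃.presup_eqType_right)
    · have h₃ := ih.2 c C hc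
      exact (ha h₂.left _ h₃).eqTerm_trans (key.2 _ _ h₃.presup_eqTerm_right)

theorem MorEq.eqType {m n : ℕ} {Δ : Ctx T.sig n} {Γ : Ctx T.sig m} {f g : Sub T.sig m n}
    {C : Expr T.sig m} (h : MorEq T Δ Γ f g) (hΔ : IsCtx T Δ) (hC : Derivable T Γ (.isType C)) :
    Derivable T Δ (.eqType (C.subst f) (C.subst g)) :=
  (h.adm hΔ .base).1 C hC

theorem MorEq.eqTerm {m n : ℕ} {Δ : Ctx T.sig n} {Γ : Ctx T.sig m} {f g : Sub T.sig m n}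
    {c C : Expr T.sig m} (h : MorEq T Δ Γ f g) (hΔ : IsCtx T Δ)
    (hc : Derivable T Γ (.hasType c C)) :
    Derivable T Δ (.eqTerm (c.subst f) (c.subst g) (C.subst f)) :=
  (h.adm hΔ .base).2 c C hc

theorem MorEq.refl {n : ℕ} {Φ : Ctx T.sig n} : {m : ℕ} → {Ψ : Ctx T.sig m} →
    {f : Sub T.sig m n} → IsMor T Φ Ψ f → MorEq T Φ Ψ f f
  | _, .nil, _, _ => trivial
  | _, .snoc _ _, _, h => ⟨MorEq.refl h.1, h.2.eqTerm_refl⟩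

theorem MorEq.symm {n : ℕ} {Φ : Ctx T.sig n} (hΦ : IsCtx T Φ) : {m : ℕ} → {Ψ : Ctx T.sig m} →
    {f g : Sub T.sig m n} → IsCtx T Ψ → MorEq T Φ Ψ f g → MorEq T Φ Ψ g f
  | _, .nil, _, _, _, _ => trivial
  | _, .snoc _ _, _, _, hΨ, h =>
    ⟨MorEq.symm hΦ hΨ.1 h.1, h.2.eqTerm_symm.conv_eq (h.1.eqType hΦ hΨ.2)⟩

theorem MorEq.trans {n : ℕ} {Φ : Ctx T.sig n} (hΦ : IsCtx T Φ) : {m : ℕ} → {Ψ : Ctx T.sig m} →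
    {f g h : Sub T.sig m n} → IsCtx T Ψ → MorEq T Φ Ψ f g → MorEq T Φ Ψ g h → MorEq T Φ Ψ f h
  | _, .nil, _, _, _, _, _, _ => trivial
  | _, .snoc _ _, _, _, _, hΨ, h, k =>
    ⟨MorEq.trans hΦ hΨ.1 h.1 k.1,
      h.2.eqTerm_trans (k.2.conv_eq (h.1.eqType hΦ hΨ.2).eqType_symm)⟩

theorem IsMor.congr_dom {n : ℕ} {Φ Φ' : Ctx T.sig n} (hΦ' : IsCtx T Φ') (e : CtxEq T Φ Φ') :
    {m : ℕ} → {Ψ : Ctx T.sig m} → {f : Sub T.sig m n} → IsMor T Φ Ψ f → IsMor T Φ' Ψ f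
  | _, .nil, _, _ => trivial
  | _, .snoc _ _, _, h => ⟨IsMor.congr_dom hΦ' e h.1, h.2.ctxConv hΦ' e⟩

theorem IsMor.congr_cod {n : ℕ} {Φ : Ctx T.sig n} (hΦ : IsCtx T Φ) :
    {m : ℕ} → {Ψ Ψ' : Ctx T.sig m} → {f : Sub T.sig m n} → CtxEq T Ψ Ψ' → IsMor T Φ Ψ f →
    IsMor T Φ Ψ' f
  | _, .nil, .nil, _, _, _ => trivial
  | _, .snoc _ _, .snoc _ _, _, e, h =>
    ⟨IsMor.congr_cod hΦ e.1 h.1, h.2.conv (e.2.msubst hΦ h.1)⟩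

theorem MorEq.congr_dom {n : ℕ} {Φ Φ' : Ctx T.sig n} (hΦ' : IsCtx T Φ') (e : CtxEq T Φ Φ') :
    {m : ℕ} → {Ψ : Ctx T.sig m} → {f g : Sub T.sig m n} → MorEq T Φ Ψ f g → MorEq T Φ' Ψ f g
  | _, .nil, _, _, _ => trivial
  | _, .snoc _ _, _, _, h => ⟨MorEq.congr_dom hΦ' e h.1, h.2.ctxConv hΦ' e⟩

theorem MorEq.congr_cod {n : ℕ} {Φ : Ctx T.sig n} (hΦ : IsCtx T Φ) :
    {m : ℕ} → {Ψ Ψ' : Ctx T.sig m} → {f g : Sub T.sig m n} → CtxEq T Ψ Ψ' → MorEq T Φ Ψ f g →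
    MorEq T Φ Ψ' f g
  | _, .nil, .nil, _, _, _, _ => trivial
  | _, .snoc _ _, .snoc _ _, _, _, e, h =>
    ⟨MorEq.congr_cod hΦ e.1 h.1, h.2.conv_eq (e.2.msubst hΦ h.1.isMor_left)⟩

/-- Composites of context morphisms. -/
theorem IsMor.comp {n m : ℕ} {Φ : Ctx T.sig n} {Ψ : Ctx T.sig m} {f : Sub T.sig m n}
    (hΦ : IsCtx T Φ) (hf : IsMor T Φ Ψ f) : {l : ℕ} → {Ξ : Ctx T.sig l} → {g : Sub T.sig l m} →
    IsMor T Ψ Ξ g → IsMor T Φ Ξ (fun i => (g i).subst f)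
  | _, .nil, _, _ => trivial
  | _, .snoc _ C, _, h => by
    refine ⟨IsMor.comp hΦ hf h.1, ?_⟩
    have := h.2.msubst hΦ hf
    rwa [Judgement.subst, subst_subst] at this

theorem MorEq.comp {n m : ℕ} {Φ : Ctx T.sig n} {Ψ : Ctx T.sig m} {f f' : Sub T.sig m n}
    (hΦ : IsCtx T Φ) (hf : MorEq T Φ Ψ f f') : {l : ℕ} → {Ξ : Ctx T.sig l} →
    {g g' : Sub T.sig l m} → MorEq T Ψ Ξ g g' →
    MorEq T Φ Ξ (fun i => (g i).subst f) (fun i => (g' i).subst f')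
  | _, .nil, _, _, _ => trivial
  | _, .snoc _ C, _, _, h => by
    refine ⟨MorEq.comp hΦ hf h.1, ?_⟩
    have h₁ := h.2.msubst hΦ hf.isMor_left
    have h₂ := hf.eqTerm hΦ h.2.presup_eqTerm_right
    have h₃ := h₁.eqTerm_trans h₂
    rwa [subst_subst] at h₃

end Metatheory

/-- Well-formed contexts of length `n`. -/
abbrev WfCtx (T : TypeTheory.{u}) (n : ℕ) : Type u := {Γ : Ctx T.sig n // IsCtx T Γ}

instance ctxSetoid (T : TypeTheory.{u}) (n : ℕ) : Setoid (WfCtx T n) where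
  r Γ Δ := CtxEq T Γ.1 Δ.1
  iseqv :=
    { refl := fun Γ => CtxEq.refl Γ.2
      symm := fun {_ Δ} h => CtxEq.symm Δ.2 h
      trans := fun {Γ Δ _} h k => CtxEq.trans Γ.2 Δ.2 h k }

/-- Objects of the classifying category: well-formed contexts up to renaming of variables and
componentwise definitional equality. -/
structure Cl (T : TypeTheory.{u}) : Type u where
  length : ℕ
  ctx : Quotient (ctxSetoid T length)

namespace Cl

variable {T : TypeTheory.{u}}

/-- `f` is a context morphism from `X` to `Y`; this does not depend on the contexts that represent
`X` and `Y`. -/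
def IsHom (X Y : Cl T) (f : Sub T.sig Y.length X.length) : Prop :=
  Quotient.liftOn₂ X.ctx Y.ctx (fun Φ Ψ => IsMor T Φ.1 Ψ.1 f) fun Φ Ψ Φ' Ψ' h k =>
    propext ⟨fun hf => (hf.congr_dom Φ'.2 h).congr_cod Φ'.2 k,
      fun hf => (hf.congr_cod Φ'.2 (CtxEq.symm Ψ'.2 k)).congr_dom Φ.2 (CtxEq.symm Φ'.2 h)⟩

/-- `f` and `g` are definitionally equal context morphisms from `X` to `Y`. -/
def HomEq (X Y : Cl T) (f g : Sub T.sig Y.length X.length) : Prop :=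
  Quotient.liftOn₂ X.ctx Y.ctx (fun Φ Ψ => MorEq T Φ.1 Ψ.1 f g) fun Φ Ψ Φ' Ψ' h k =>
    propext ⟨fun hf => (hf.congr_dom Φ'.2 h).congr_cod Φ'.2 k,
      fun hf => (hf.congr_cod Φ'.2 (CtxEq.symm Ψ'.2 k)).congr_dom Φ.2 (CtxEq.symm Φ'.2 h)⟩

instance homSetoid (X Y : Cl T) : Setoid {f // IsHom X Y f} where
  r f g := HomEq X Y f.1 g.1
  iseqv := by
    obtain ⟨n, X⟩ := X
    obtain ⟨m, Y⟩ := Y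
    induction X using Quotient.ind
    induction Y using Quotient.ind
    rename_i Φ Ψ
    exact
      { refl := fun f => MorEq.refl f.2
        symm := fun {f g} h => MorEq.symm Φ.2 Ψ.2 h
        trans := fun {f g k} h h' => MorEq.trans Φ.2 Ψ.2 h h' }

theorem isHom_id (X : Cl T) : IsHom X X Expr.var := by
  obtain ⟨n, X⟩ := X
  induction X using Quotient.ind
  rename_i Φ
  exact isMor_var Φ.2

theorem IsHom.comp {X Y Z : Cl T} {f : Sub T.sig Y.length X.length}
    {g : Sub T.sig Z.length Y.length} (hf : IsHom X Y f) (hg : IsHom Y Z g) :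
    IsHom X Z (fun i => (g i).subst f) := by
  obtain ⟨n, X⟩ := X
  obtain ⟨m, Y⟩ := Y
  obtain ⟨l, Z⟩ := Z
  induction X using Quotient.ind
  induction Y using Quotient.ind
  induction Z using Quotient.ind
  rename_i Φ Ψ Ξ
  exact IsMor.comp Φ.2 hf hg

theorem HomEq.comp {X Y Z : Cl T} {f f' : Sub T.sig Y.length X.length}
    {g g' : Sub T.sig Z.length Y.length} (hf : HomEq X Y f f') (hg : HomEq Y Z g g') :
    HomEq X Z (fun i => (g i).subst f) (fun i => (g' i).subst f') := by
  obtain ⟨n, X⟩ := X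
  obtain ⟨m, Y⟩ := Y
  obtain ⟨l, Z⟩ := Z
  induction X using Quotient.ind
  induction Y using Quotient.ind
  induction Z using Quotient.ind
  rename_i Φ Ψ Ξ
  exact MorEq.comp Φ.2 hf hg

/-- The classifying category of `T`: maps are context morphisms up to pointwise definitional
equality, and composition is substitution. -/
instance : Category.{u} (Cl T) where
  Hom X Y := Quotient (homSetoid X Y)
  id X := Quotient.mk _ ⟨Expr.var, isHom_id X⟩
  comp {X Y Z} := Quotient.map₂ (fun f g => ⟨fun i => (g.1 i).subst f.1, f.2.comp g.2⟩)
    fun _ _ hf _ _ hg => HomEq.comp hf hg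
  id_comp f := by
    induction f using Quotient.ind
    exact congrArg (Quotient.mk _) (Subtype.ext (funext fun i => subst_var _))
  comp_id f := by
    induction f using Quotient.ind
    rfl
  assoc f g h := by
    induction f using Quotient.ind
    induction g using Quotient.ind
    induction h using Quotient.ind
    exact congrArg (Quotient.mk _) (Subtype.ext (funext fun i => (subst_subst _ _ _).symm))

/-- The map of the classifying category given by a context morphism. -/
def homMk {X Y : Cl T} (f : Sub T.sig Y.length X.length) (hf : IsHom X Y f) : X ⟶ Y :=
  Quotient.mk (homSetoid X Y) ⟨f, hf⟩

end Cl

section IdentityContexts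

variable {S : Signature.{u}} {m : ℕ}

/-- The expression `J(a, b, p, [x] d)` for identity contexts of length `n`, where `[x]` binds `n`
variables. -/
def ctxJ : (n : ℕ) → (a b p : Sub S n m) → Expr S (m + n) → Expr S m
  | 0, _, _, _, d => d
  | n + 1, a, b, p, d =>
    ctxJ n (fun i => a i.castSucc) (fun i => b i.castSucc) (fun i => p i.castSucc)
      (.J ((a (Fin.last n)).wk n) ((b (Fin.last n)).wk n) ((p (Fin.last n)).wk n) d)

/-- The expression `p_!(e) = J(a, b, p, [_] e)` for transport along `p ∈ Id_Φ(a, b)`. -/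
def transport {n : ℕ} (a b p : Sub S n m) (e : Expr S m) : Expr S m :=
  ctxJ n a b p (e.wk n)

/-- The identity context `Id_Φ(a, b)` of a dependent context `Φ` relative to a context of
length `m`: for `Φ' = (Φ, x ∈ A(x))`, `a' = (a, α)` and `b' = (b, β)`, the identity context is
`Id_Φ'(a', b') = (u ∈ Id_Φ(a, b), v ∈ Id_{A(b)}(u_!(α), β))`. -/
def idTele : {n : ℕ} → Tele S m n → Sub S n m → Sub S n m → Tele S m n
  | _, .nil, _, _ => .nil
  | _, .snoc (k := n) Φ A, a, b =>
    (idTele Φ (fun i => a i.castSucc) (fun i => b i.castSucc)).snoc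
      (.id ((A.subst (Fin.append Expr.var fun i => b i.castSucc)).wk n)
        (transport (fun i => (a i.castSucc).wk n) (fun i => (b i.castSucc).wk n)
          (fun i => .var (Fin.natAdd m i)) ((a (Fin.last n)).wk n))
        ((b (Fin.last n)).wk n))

/-- The trivial path `1_a = r(a)`. -/
def pathRefl {n : ℕ} (a : Sub S n m) : Sub S n m := fun i => .refl (a i)

/-- The composite `q ∘ p = q_!(p)` of `p ∈ Id(a, b)` and `q ∈ Id(b, c)`. -/
def pathComp {n : ℕ} (b c p q : Sub S n m) : Sub S n m := fun i => transport b c q (p i)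

/-- The inverse `p⁻¹ = J(a, b, p, [x] r(x))` of `p ∈ Id(a, b)`. -/
def pathInv {n : ℕ} (a b p : Sub S n m) : Sub S n m :=
  fun i => ctxJ n a b p (.refl (.var (Fin.natAdd m i)))

/-- The image `f(p) = J(a, b, p, [x] 1_(f(x)))` of `p ∈ Id(a, b)` under a context morphism `f`. -/
def pathMap {n k : ℕ} (f : Sub S k n) (a b p : Sub S n m) : Sub S k m :=
  fun i => ctxJ n a b p (.refl ((f i).rename (Fin.natAdd m)))

end IdentityContexts

section Paths

variable (T : TypeTheory.{u}) {n : ℕ}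

/-- `p` is a path from `a` to `b` in the context `Φ`: a global element `p ∈ Id_Φ(a, b)`. -/
def IsPath (Φ : Ctx T.sig n) (a b p : Sub T.sig n 0) : Prop :=
  IsElem T .nil (idTele (Φ.toTele 0) a b) p

/-- `h` is a homotopy from `p` to `q`, for `p, q ∈ Id_Φ(a, b)`: a global element
`h ∈ Id_{Id_Φ(a, b)}(p, q)`. -/
def IsHomotopy (Φ : Ctx T.sig n) (a b p q h : Sub T.sig n 0) : Prop :=
  IsElem T .nil (idTele (idTele (Φ.toTele 0) a b) p q) h

end Paths

variable {T : TypeTheory.{u}}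

namespace Cl

/-- The empty context. -/
def empty (T : TypeTheory.{u}) : Cl T := ⟨0, Quotient.mk _ ⟨.nil, trivial⟩⟩

/-- Global elements, that is, context morphisms from the empty context, up to definitional
equality. -/
abbrev Pt (X : Cl T) : Type u := empty T ⟶ X

/-- The well-formed context `Φ` represents the object `X`. -/
def IsRepr (X : Cl T) (Φ : WfCtx T X.length) : Prop := Quotient.mk _ Φ = X.ctx

/-- The context morphism `f'` represents the map `f`. -/
def HomRepr {X Y : Cl T} (f : X ⟶ Y) (f' : Sub T.sig Y.length X.length) : Prop :=
  ∃ h : IsHom X Y f', homMk f' h = f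

theorem HomRepr.comp {X Y Z : Cl T} {f : X ⟶ Y} {g : Y ⟶ Z} {f' : Sub T.sig Y.length X.length}
    {g' : Sub T.sig Z.length Y.length} (hf : HomRepr f f') (hg : HomRepr g g') :
    HomRepr (f ≫ g) fun i => (g' i).subst f' := by
  obtain ⟨hf, rfl⟩ := hf
  obtain ⟨hg, rfl⟩ := hg
  exact ⟨hf.comp hg, rfl⟩

/-- Paths from `a` to `b`. -/
def Path (X : Cl T) (a b : Pt X) : Type u :=
  {p : Sub T.sig X.length 0 // ∃ (Φ : WfCtx T X.length) (a' b' : Sub T.sig X.length 0),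
    X.IsRepr Φ ∧ HomRepr a a' ∧ HomRepr b b' ∧ IsPath T Φ.1 a' b' p}

/-- Paths `p` and `q` from `a` to `b` are homotopic. -/
def Homotopic {X : Cl T} {a b : Pt X} (p q : Path X a b) : Prop :=
  ∃ (Φ : WfCtx T X.length) (a' b' h : Sub T.sig X.length 0),
    X.IsRepr Φ ∧ HomRepr a a' ∧ HomRepr b b' ∧ IsPath T Φ.1 a' b' p.1 ∧ IsPath T Φ.1 a' b' q.1 ∧
      IsHomotopy T Φ.1 a' b' p.1 q.1 h

/-- The set `[a, b]` of homotopy classes of paths. -/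
def PathClass (X : Cl T) (a b : Pt X) : Type u := Quot (Homotopic (X := X) (a := a) (b := b))

/-- The homotopy class `[p]` of a path. -/
def PathClass.mk {X : Cl T} {a b : Pt X} (p : Path X a b) : PathClass X a b := Quot.mk _ p

/-- The path from `a` to `b` that is given by an element of `Id_Φ(a', b')`. -/
def Path.of {X : Cl T} {a b : Pt X} {Φ : WfCtx T X.length} {a' b' p : Sub T.sig X.length 0}
    (hΦ : X.IsRepr Φ) (ha : HomRepr a a') (hb : HomRepr b b') (hp : IsPath T Φ.1 a' b' p) :
    Path X a b :=
  ⟨p, Φ, a', b', hΦ, ha, hb, hp⟩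

/-- The fundamental groupoid of `X`: homotopy is an equivalence relation on paths, and
`[q] ∘ [p] = [q ∘ p]`, `1_a = [r(a)]`, `[p]⁻¹ = [p⁻¹]` (where `q ∘ p`, `r(a)` and `p⁻¹` are formed
from elements of the identity contexts of any `Φ` that represents `X`) make the homotopy classes of
paths between global elements of `X` into a groupoid. -/
structure FundamentalGroupoid (X : Cl T) where
  equivalence (a b : Pt X) : Equivalence (Homotopic (X := X) (a := a) (b := b))
  id (a : Pt X) : PathClass X a a
  comp {a b c : Pt X} : PathClass X a b → PathClass X b c → PathClass X a c
  inv {a b : Pt X} : PathClass X a b → PathClass X b a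
  id_eq {a : Pt X} {Φ : WfCtx T X.length} {a' : Sub T.sig X.length 0}
    (hΦ : X.IsRepr Φ) (ha : HomRepr a a') :
    ∃ h : IsPath T Φ.1 a' a' (pathRefl a'), id a = .mk (.of hΦ ha ha h)
  comp_eq {a b c : Pt X} {Φ : WfCtx T X.length} {a' b' c' p q : Sub T.sig X.length 0}
    (hΦ : X.IsRepr Φ) (ha : HomRepr a a') (hb : HomRepr b b') (hc : HomRepr c c')
    (hp : IsPath T Φ.1 a' b' p) (hq : IsPath T Φ.1 b' c' q) :
    ∃ h : IsPath T Φ.1 a' c' (pathComp b' c' p q),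
      comp (.mk (.of hΦ ha hb hp)) (.mk (.of hΦ hb hc hq)) = .mk (.of hΦ ha hc h)
  inv_eq {a b : Pt X} {Φ : WfCtx T X.length} {a' b' p : Sub T.sig X.length 0}
    (hΦ : X.IsRepr Φ) (ha : HomRepr a a') (hb : HomRepr b b') (hp : IsPath T Φ.1 a' b' p) :
    ∃ h : IsPath T Φ.1 b' a' (pathInv a' b' p),
      inv (.mk (.of hΦ ha hb hp)) = .mk (.of hΦ hb ha h)
  id_comp {a b : Pt X} (p : PathClass X a b) : comp (id a) p = p
  comp_id {a b : Pt X} (p : PathClass X a b) : comp p (id b) = p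
  assoc {a b c d : Pt X} (p : PathClass X a b) (q : PathClass X b c) (r : PathClass X c d) :
    comp (comp p q) r = comp p (comp q r)
  inv_comp {a b : Pt X} (p : PathClass X a b) : comp (inv p) p = id b
  comp_inv {a b : Pt X} (p : PathClass X a b) : comp p (inv p) = id a

namespace FundamentalGroupoid

variable {X Y : Cl T}

/-- The fundamental groupoid as an object of the category of groupoids. -/
def toGrpd (G : FundamentalGroupoid X) : Grpd.{u, u} :=
  letI : Groupoid (Pt X) :=
    { Hom := PathClass X
      id := G.id
      comp := G.comp
      inv := G.inv
      id_comp := G.id_comp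
      comp_id := G.comp_id
      assoc := G.assoc
      inv_comp := G.inv_comp
      comp_inv := G.comp_inv }
  Grpd.of (Pt X)

/-- The functor between fundamental groupoids that is induced by `f`: it sends a global element
`a` to `f(a)`, and `[p]` to `[f(p)]`. -/
structure Map (G : FundamentalGroupoid X) (H : FundamentalGroupoid Y) (f : X ⟶ Y) where
  map {a b : Pt X} : PathClass X a b → PathClass Y (a ≫ f) (b ≫ f)
  map_eq {a b : Pt X} {Φ : WfCtx T X.length} {Ψ : WfCtx T Y.length}
    {f' : Sub T.sig Y.length X.length} {a' b' p : Sub T.sig X.length 0}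
    (hΦ : X.IsRepr Φ) (hΨ : Y.IsRepr Ψ) (hf : HomRepr f f') (ha : HomRepr a a') (hb : HomRepr b b')
    (hp : IsPath T Φ.1 a' b' p) :
    ∃ h : IsPath T Ψ.1 (fun i => (f' i).subst a') (fun i => (f' i).subst b')
        (pathMap f' a' b' p),
      map (.mk (.of hΦ ha hb hp)) = .mk (.of hΨ (ha.comp hf) (hb.comp hf) h)
  map_id (a : Pt X) : map (G.id a) = H.id (a ≫ f)
  map_comp {a b c : Pt X} (p : PathClass X a b) (q : PathClass X b c) :
    map (G.comp p q) = H.comp (map p) (map q)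

/-- The induced functor as a map in the category of groupoids. -/
def Map.toHom {G : FundamentalGroupoid X} {H : FundamentalGroupoid Y} {f : X ⟶ Y}
    (M : G.Map H f) : G.toGrpd ⟶ H.toGrpd :=
  { obj := fun a => (a ≫ f : Pt Y)
    map := fun p => M.map p
    map_id := M.map_id
    map_comp := M.map_comp : G.toGrpd ⥤ H.toGrpd }

end FundamentalGroupoid

end Cl

end DTT

/-! The heart of the matter is an elimination principle for identity contexts (`pathData_wf_elim`).
Over the generic pair of elements of `Φ` joined by a generic path, an element of any family can be
defined by giving it on trivial paths; the iterated `J` is well-typed there, and it computes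
definitionally on trivial paths.

The generic path lives in the context `(Γ, x_0, y_0, u_0, x_1, y_1, u_1, ...)`, interleaved so that
lengthening `Φ` by `x ∈ A` appends three variables `x`, `y` and `v ∈ Id(u_!(x), y)`. The principle
is proved by induction on the length of `Φ`. Eliminating the path in `Φ` first, with `x, y, v`
carried along as parameters, replaces the type of `v` by `Id_A(r_!(x), y)`. Transport is itself an
instance of elimination for `Φ`, so its computation rule gives `r_!(x) = x`. The type of `v` is thus
definitionally `Id_A(x, y)`, and the ordinary `J` finishes. The parameters are the reason why
elimination is stated relative to an arbitrary further dependent context. `ElimData` records an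
elimination principle of this kind, and `ElimData.IsComp` the composition of one with a single `J`.

Consequently two families of elements over the generic path that agree definitionally on trivial
paths are homotopic everywhere: `r` is a homotopy on trivial paths, and `J` extends it
(`homotopy_of_diag`, `path_induction`). Composition `q_!(p)` is transport in the family `y ↦ Id_Φ(a,
y)`, so `r(b)_!(p) = p` holds definitionally. The other groupoid laws, and the preservation of
identities, composites and definitional equality by context morphisms, follow from computation on
trivial paths together, where needed, with path induction. Where two composable paths are involved,
the induction is on the later one, and the earlier one is a parameter (`path_induction_append`).

A homotopy is a path in the context `Id_Φ(a, b)`, so the same operations, applied to that context,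
show that homotopy is an equivalence relation. The operations respect homotopy because with a path
as variable they are context morphisms between identity contexts, and context morphisms carry paths
to paths (`Htpy.app`).

Typing and equalities are proved for generic elements in an ambient context `Γ`. All constructions
commute strictly with substitution of raw expressions (`ctxJ_subst`, `idTele_subst`), so they
specialize to arbitrary elements, and to definitionally equal ones, which gives independence of
representatives. Only at the end is `Γ` taken to be empty. -/

namespace DTT

/-! ### Raw syntax: substitution in iterated `J`, transport and identity contexts -/

section Raw

variable {S : Signature.{u}}

theorem append_castSucc {α : Type*} {m k : ℕ} (σ : Fin m → α) (a : Fin (k + 1) → α)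
    (i : Fin (m + k)) :
    Fin.append σ a (Fin.castSucc (n := m + k) i) = Fin.append σ (fun j => a j.castSucc) i := by
  refine Fin.addCases (fun i => ?_) (fun j => ?_) i
  · rw [Fin.append_left]
    exact Fin.append_left σ a i
  · rw [Fin.append_right]
    exact Fin.append_right σ a j.castSucc

theorem append_last {α : Type*} {m k : ℕ} (σ : Fin m → α) (a : Fin (k + 1) → α) :
    Fin.append σ a (Fin.last (m + k)) = a (Fin.last k) :=
  Fin.append_right σ a (Fin.last k)

theorem append_comp_castSucc {α : Type*} {m k : ℕ} (σ : Fin m → α) (a : Fin (k + 1) → α) :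
    (fun i : Fin (m + k) => Fin.append σ a (Fin.castSucc (n := m + k) i)) =
      Fin.append σ (fun j => a j.castSucc) :=
  funext (append_castSucc σ a)

theorem append_zero {α : Type*} {m : ℕ} (σ : Fin m → α) (a : Fin 0 → α) :
    Fin.append σ a = σ :=
  funext fun i => Fin.append_left σ a i

theorem append_eta {α : Type*} {m k : ℕ} (f : Fin (m + k) → α) :
    Fin.append (fun i => f (Fin.castAdd k i)) (fun j => f (Fin.natAdd m j)) = f := by
  funext i
  refine Fin.addCases (fun i => ?_) (fun j => ?_) i <;> simp

theorem map_append {α β : Type*} {m k : ℕ} (f : α → β) (σ : Fin m → α) (a : Fin k → α) :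
    (fun i => f (Fin.append σ a i)) = Fin.append (fun i => f (σ i)) (fun j => f (a j)) := by
  funext i
  refine Fin.addCases (fun i => ?_) (fun j => ?_) i <;> simp

theorem snoc_eta {α : Type*} {m : ℕ} (f : Fin (m + 1) → α) :
    Fin.snoc (α := fun _ => α) (fun i => f i.castSucc) (f (Fin.last m)) = f := by
  funext i
  refine Fin.lastCases ?_ (fun i => ?_) i <;> simp

@[simp] theorem liftRen_castAdd {m n : ℕ} (ρ : Fin m → Fin n) (k : ℕ) (i : Fin m) :
    liftRen ρ k (Fin.castAdd k i) = Fin.castAdd k (ρ i) := by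
  induction k with
  | zero => rfl
  | succ k ih =>
    rw [liftRen_succ]
    have := liftRen_one_castSucc (liftRen ρ k) (Fin.castAdd k i)
    rw [ih] at this
    exact this

@[simp] theorem liftRen_natAdd {m n : ℕ} (ρ : Fin m → Fin n) (k : ℕ) (j : Fin k) :
    liftRen ρ k (Fin.natAdd m j) = Fin.natAdd n j := by
  induction k with
  | zero => exact j.elim0
  | succ k ih =>
    rw [liftRen_succ]
    refine Fin.lastCases ?_ (fun j => ?_) j
    · exact liftRen_one_last (liftRen ρ k)
    · have := liftRen_one_castSucc (liftRen ρ k) (Fin.natAdd m j)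
      rw [ih] at this
      exact this

@[simp] theorem liftSub_castAdd {m n : ℕ} (σ : Sub S m n) (k : ℕ) (i : Fin m) :
    liftSub σ k (Fin.castAdd k i) = (σ i).wk k := by
  induction k with
  | zero =>
    show σ i = (σ i).rename (Fin.castAdd 0)
    rw [rename_eq_subst]
    exact (subst_var _).symm
  | succ k ih =>
    rw [liftSub_succ]
    have := liftSub_one_castSucc (liftSub σ k) (Fin.castAdd k i)
    rw [ih] at this
    refine Eq.trans this ?_
    simp only [Expr.wk, rename_rename]
    rfl

@[simp] theorem liftSub_natAdd {m n : ℕ} (σ : Sub S m n) (k : ℕ) (j : Fin k) :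
    liftSub σ k (Fin.natAdd m j) = .var (Fin.natAdd n j) := by
  induction k with
  | zero => exact j.elim0
  | succ k ih =>
    rw [liftSub_succ]
    refine Fin.lastCases ?_ (fun j => ?_) j
    · exact liftSub_one_last (liftSub σ k)
    · have := liftSub_one_castSucc (liftSub σ k) (Fin.natAdd m j)
      rw [ih] at this
      refine Eq.trans this ?_
      simp only [Expr.wk, Expr.rename]
      rfl

theorem liftSub_eq_append {m n : ℕ} (σ : Sub S m n) (k : ℕ) :
    liftSub σ k = Fin.append (fun i => (σ i).wk k) (fun j => .var (Fin.natAdd n j)) := by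
  rw [← append_eta (liftSub σ k)]
  simp

theorem wk_subst {m k n : ℕ} (A : Expr S m) (τ : Sub S (m + k) n) :
    (A.wk k).subst τ = A.subst fun i => τ (Fin.castAdd k i) :=
  rename_subst A _ τ

@[simp] theorem wk_subst_append {m k n : ℕ} (A : Expr S m) (σ : Sub S m n) (a : Sub S k n) :
    (A.wk k).subst (Fin.append σ a) = A.subst σ := by
  rw [wk_subst]; simp

theorem wk_eq_subst {m : ℕ} (A : Expr S m) (k : ℕ) :
    A.wk k = A.subst fun i => .var (Fin.castAdd k i) :=
  rename_eq_subst A _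

theorem subst_wk' {m n : ℕ} (A : Expr S m) (f : Sub S m n) (k : ℕ) :
    (A.subst f).wk k = A.subst fun i => (f i).wk k :=
  subst_rename A f _

@[simp] theorem wk_subst_liftSub {m n : ℕ} (A : Expr S m) (σ : Sub S m n) (k : ℕ) :
    (A.wk k).subst (liftSub σ k) = (A.subst σ).wk k := by
  rw [liftSub_eq_append, wk_subst_append, subst_wk']

@[simp] theorem wk_zero {m : ℕ} (A : Expr S m) : A.wk 0 = A := by
  rw [Expr.wk, rename_eq_subst]
  exact subst_var A

theorem wk_succ {m : ℕ} (A : Expr S m) (k : ℕ) : (A.wk k).wk 1 = A.wk (k + 1) :=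
  rename_rename A _ _

theorem liftSub_append {m k n l : ℕ} (σ : Sub S m n) (τ : Sub S n l) (a : Sub S k l) :
    (fun i => (liftSub σ k i).subst (Fin.append τ a)) =
      Fin.append (fun i => (σ i).subst τ) a := by
  rw [liftSub_eq_append, map_append (fun e => Expr.subst e (Fin.append τ a))]
  simp [Expr.subst]

theorem subst_liftSub_append {m k n l : ℕ} (A : Expr S (m + k)) (σ : Sub S m n) (τ : Sub S n l)
    (a : Sub S k l) :
    (A.subst (liftSub σ k)).subst (Fin.append τ a) =
      A.subst (Fin.append (fun i => (σ i).subst τ) a) := by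
  rw [subst_subst, liftSub_append]

theorem subst_append_subst {m k n l : ℕ} (A : Expr S (m + k)) (σ : Sub S m n) (a : Sub S k n)
    (τ : Sub S n l) :
    (A.subst (Fin.append σ a)).subst τ =
      A.subst (Fin.append (fun i => (σ i).subst τ) fun j => (a j).subst τ) := by
  rw [subst_subst, map_append (fun e => Expr.subst e τ)]

@[simp] theorem var_subst {m n : ℕ} (i : Fin m) (σ : Sub S m n) :
    (Expr.var i).subst σ = σ i := rfl

@[simp] theorem refl_subst {m n : ℕ} (a : Expr S m) (σ : Sub S m n) :
    (Expr.refl a).subst σ = .refl (a.subst σ) := rfl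

@[simp] theorem id_subst {m n : ℕ} (A a b : Expr S m) (σ : Sub S m n) :
    (Expr.id A a b).subst σ = .id (A.subst σ) (a.subst σ) (b.subst σ) := rfl

theorem Tele.subst_subst {l m n k : ℕ} (Θ : Tele S l k) (f : Sub S l m) (g : Sub S m n) :
    (Θ.subst f).subst g = Θ.subst fun i => (f i).subst g := by
  induction Θ with
  | nil => rfl
  | snoc Θ A ih => simp only [Tele.subst, ih, DTT.subst_subst, liftSub_comp]

@[simp] theorem Tele.subst_var {n k : ℕ} (Θ : Tele S n k) : Θ.subst Expr.var = Θ := by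
  induction Θ with
  | nil => rfl
  | snoc Θ A ih => simp only [Tele.subst, ih, liftSub_var, DTT.subst_var]

/-- Weakening of a dependent context. -/
def Tele.wk {n k : ℕ} (l : ℕ) (Θ : Tele S n k) : Tele S (n + l) k :=
  Θ.subst fun i => .var (Fin.castAdd l i)

theorem Tele.wk_subst {m k l n : ℕ} (Θ : Tele S m l) (τ : Sub S (m + k) n) :
    (Θ.wk k).subst τ = Θ.subst fun i => τ (Fin.castAdd k i) :=
  Tele.subst_subst Θ _ τ

@[simp] theorem Tele.wk_subst_append {m k l n : ℕ} (Θ : Tele S m l) (σ : Sub S m n)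
    (a : Sub S k n) : (Θ.wk k).subst (Fin.append σ a) = Θ.subst σ := by
  rw [Tele.wk_subst]; simp

theorem Tele.subst_wk {m n l : ℕ} (Θ : Tele S m l) (f : Sub S m n) (k : ℕ) :
    (Θ.subst f).wk k = Θ.subst fun i => (f i).wk k := by
  rw [Tele.wk, Tele.subst_subst]
  congr 1
  funext i
  exact (wk_eq_subst _ _).symm

theorem Tele.wk_subst_liftSub {m n l : ℕ} (Θ : Tele S m l) (σ : Sub S m n) (k : ℕ) :
    (Θ.wk k).subst (liftSub σ k) = (Θ.subst σ).wk k := by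
  rw [liftSub_eq_append, Tele.wk_subst_append, Tele.subst_wk]

/-- The endpoints and the path of each inner `J` are weakened past the outer binders, so a
substitution lifted under these binders acts on them as the original one. -/
theorem ctxJ_subst {m l : ℕ} (σ : Sub S m l) : (n : ℕ) → (a b p : Sub S n m) →
    (d : Expr S (m + n)) → (ctxJ n a b p d).subst σ =
      ctxJ n (fun i => (a i).subst σ) (fun i => (b i).subst σ) (fun i => (p i).subst σ)
        (d.subst (liftSub σ n))
  | 0, _, _, _, _ => rfl
  | n + 1, a, b, p, d => by
    rw [ctxJ, ctxJ_subst σ n, ctxJ]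
    simp only [Expr.subst, wk_subst_liftSub]
    rfl

theorem transport_subst {m l n : ℕ} (σ : Sub S m l) (a b p : Sub S n m) (e : Expr S m) :
    (transport a b p e).subst σ = transport (fun i => (a i).subst σ) (fun i => (b i).subst σ)
      (fun i => (p i).subst σ) (e.subst σ) := by
  rw [transport, ctxJ_subst, wk_subst_liftSub, transport]

theorem transport_wk {m n k : ℕ} (a b p : Sub S n m) (e : Expr S m) :
    (transport a b p e).wk k = transport (fun i => (a i).wk k) (fun i => (b i).wk k)
      (fun i => (p i).wk k) (e.wk k) := by
  simp only [Expr.wk, rename_eq_subst, transport_subst]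

/-- This equality of raw expressions is what allows every statement about a generic path to be
specialized by substitution, without coherence conditions. -/
theorem idTele_subst {m l : ℕ} (σ : Sub S m l) : {n : ℕ} → (Φ : Tele S m n) → (a b : Sub S n m) →
    (idTele Φ a b).subst σ =
      idTele (Φ.subst σ) (fun i => (a i).subst σ) (fun i => (b i).subst σ)
  | _, .nil, _, _ => rfl
  | n + 1, .snoc Φ A, a, b => by
    simp only [idTele, Tele.subst, idTele_subst σ Φ, id_subst, wk_subst_liftSub, transport_subst,
      var_subst, liftSub_natAdd, subst_append_subst, subst_liftSub_append, subst_var]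

theorem idTele_wk {m n : ℕ} (l : ℕ) (Φ : Tele S m n) (a b : Sub S n m) :
    (idTele Φ a b).wk l = idTele (Φ.wk l) (fun i => (a i).wk l) (fun i => (b i).wk l) := by
  simp only [Tele.wk, idTele_subst, Expr.wk, rename_eq_subst]
  rfl

end Raw

/-! ### Dependent elements as halves of context morphisms -/

section Elements

variable {T : TypeTheory.{u}}

theorem Derivable.isCtx {T : TypeTheory.{u}} : {n : ℕ} → {Γ : Ctx T.sig n} →
    {j : Judgement T.sig n} → Derivable T Γ j → IsCtx T Γ
  | _, .nil, _, _ => trivial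
  | _, .snoc _ _, _, h => ⟨h.presup_ctx.isCtx, h.presup_ctx⟩

theorem IsCtx.of_append {m : ℕ} {Γ : Ctx T.sig m} : {k : ℕ} → {Θ : Tele T.sig m k} →
    IsCtx T (Γ.append Θ) → IsCtx T Γ
  | _, .nil, h => h
  | _, .snoc _ _, h => IsCtx.of_append h.1

/-- Pointwise definitional equality of dependent elements. -/
def ElemEq (T : TypeTheory.{u}) {m : ℕ} (Γ : Ctx T.sig m) :
    {k : ℕ} → Tele T.sig m k → Sub T.sig k m → Sub T.sig k m → Prop
  | _, .nil, _, _ => True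
  | _, .snoc (k := k) Θ A, a, b => ElemEq T Γ Θ (fun i => a i.castSucc) (fun i => b i.castSucc) ∧
      Derivable T Γ (.eqTerm (a (Fin.last k)) (b (Fin.last k))
        (A.subst (Fin.append Expr.var fun i => a i.castSucc)))

/-- Through this splitting, dependent elements inherit substitution, equality and conversion from
context morphisms. -/
theorem isMor_append_iff {m l : ℕ} {Δ : Ctx T.sig l} {Γ : Ctx T.sig m} {σ : Sub T.sig m l} :
    {k : ℕ} → {Θ : Tele T.sig m k} → {a : Sub T.sig k l} →
    (IsMor T Δ (Γ.append Θ) (Fin.append σ a) ↔ IsMor T Δ Γ σ ∧ IsElem T Δ (Θ.subst σ) a)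
  | _, .nil, a => by simp [append_zero, Ctx.append, IsElem, Tele.subst]
  | _, .snoc Θ A, a => by
    simp only [Ctx.append, IsMor, Tele.subst, IsElem, append_comp_castSucc, append_last,
      subst_liftSub_append, isMor_append_iff (Θ := Θ), and_assoc, subst_var]

theorem morEq_append_iff {m l : ℕ} {Δ : Ctx T.sig l} {Γ : Ctx T.sig m} {σ τ : Sub T.sig m l} :
    {k : ℕ} → {Θ : Tele T.sig m k} → {a b : Sub T.sig k l} →
    (MorEq T Δ (Γ.append Θ) (Fin.append σ a) (Fin.append τ b) ↔
      MorEq T Δ Γ σ τ ∧ ElemEq T Δ (Θ.subst σ) a b)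
  | _, .nil, a, b => by simp [append_zero, Ctx.append, ElemEq, Tele.subst]
  | _, .snoc Θ A, a, b => by
    simp only [Ctx.append, MorEq, Tele.subst, ElemEq, append_comp_castSucc, append_last,
      subst_liftSub_append, morEq_append_iff (Θ := Θ), and_assoc, subst_var]

theorem isElem_iff {m : ℕ} {Γ : Ctx T.sig m} (hΓ : IsCtx T Γ) {k : ℕ} {Θ : Tele T.sig m k}
    {a : Sub T.sig k m} : IsElem T Γ Θ a ↔ IsMor T Γ (Γ.append Θ) (Fin.append Expr.var a) := by
  rw [isMor_append_iff, Tele.subst_var]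
  exact ⟨fun h => ⟨isMor_var hΓ, h⟩, fun h => h.2⟩

theorem elemEq_iff {m : ℕ} {Γ : Ctx T.sig m} (hΓ : IsCtx T Γ) {k : ℕ} {Θ : Tele T.sig m k}
    {a b : Sub T.sig k m} : ElemEq T Γ Θ a b ↔
      MorEq T Γ (Γ.append Θ) (Fin.append Expr.var a) (Fin.append Expr.var b) := by
  rw [morEq_append_iff, Tele.subst_var]
  exact ⟨fun h => ⟨MorEq.refl (isMor_var hΓ), h⟩, fun h => h.2⟩

theorem IsElem.subst {m l k : ℕ} {Γ : Ctx T.sig m} {Δ : Ctx T.sig l} {σ : Sub T.sig m l}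
    {Θ : Tele T.sig m k} {a : Sub T.sig k m} (h : IsElem T Γ Θ a) (hΓ : IsCtx T Γ)
    (hΔ : IsCtx T Δ) (hσ : IsMor T Δ Γ σ) :
    IsElem T Δ (Θ.subst σ) fun i => (a i).subst σ := by
  have := IsMor.comp hΔ hσ ((isElem_iff hΓ).1 h)
  rw [map_append (fun e => Expr.subst e σ)] at this
  exact (isMor_append_iff.1 this).2

theorem ElemEq.subst {m l k : ℕ} {Γ : Ctx T.sig m} {Δ : Ctx T.sig l} {σ τ : Sub T.sig m l}
    {Θ : Tele T.sig m k} {a b : Sub T.sig k m} (h : ElemEq T Γ Θ a b) (hΓ : IsCtx T Γ)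
    (hΔ : IsCtx T Δ) (hσ : MorEq T Δ Γ σ τ) :
    ElemEq T Δ (Θ.subst σ) (fun i => (a i).subst σ) (fun i => (b i).subst τ) := by
  have := MorEq.comp hΔ hσ ((elemEq_iff hΓ).1 h)
  rw [map_append (fun e => Expr.subst e σ), map_append (fun e => Expr.subst e τ)] at this
  exact (morEq_append_iff.1 this).2

theorem ElemEq.refl {m k : ℕ} {Γ : Ctx T.sig m} (hΓ : IsCtx T Γ) {Θ : Tele T.sig m k}
    {a : Sub T.sig k m} (h : IsElem T Γ Θ a) : ElemEq T Γ Θ a a :=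
  (elemEq_iff hΓ).2 (MorEq.refl ((isElem_iff hΓ).1 h))

theorem ElemEq.symm {m k : ℕ} {Γ : Ctx T.sig m} {Θ : Tele T.sig m k}
    (hΘ : IsCtx T (Γ.append Θ)) {a b : Sub T.sig k m} (h : ElemEq T Γ Θ a b) :
    ElemEq T Γ Θ b a :=
  (elemEq_iff hΘ.of_append).2 (MorEq.symm hΘ.of_append hΘ ((elemEq_iff hΘ.of_append).1 h))

theorem ElemEq.trans {m k : ℕ} {Γ : Ctx T.sig m} {Θ : Tele T.sig m k}
    (hΘ : IsCtx T (Γ.append Θ)) {a b c : Sub T.sig k m} (h : ElemEq T Γ Θ a b)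
    (h' : ElemEq T Γ Θ b c) : ElemEq T Γ Θ a c :=
  (elemEq_iff hΘ.of_append).2 (MorEq.trans hΘ.of_append hΘ ((elemEq_iff hΘ.of_append).1 h)
    ((elemEq_iff hΘ.of_append).1 h'))

theorem ElemEq.left {m k : ℕ} {Γ : Ctx T.sig m} (hΓ : IsCtx T Γ) {Θ : Tele T.sig m k}
    {a b : Sub T.sig k m} (h : ElemEq T Γ Θ a b) : IsElem T Γ Θ a :=
  (isElem_iff hΓ).2 ((elemEq_iff hΓ).1 h).isMor_left

theorem ElemEq.right {m k : ℕ} {Γ : Ctx T.sig m} {Θ : Tele T.sig m k}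
    (hΘ : IsCtx T (Γ.append Θ)) {a b : Sub T.sig k m} (h : ElemEq T Γ Θ a b) :
    IsElem T Γ Θ b :=
  (h.symm hΘ).left hΘ.of_append

theorem IsElem.conv {m k : ℕ} {Γ : Ctx T.sig m} (hΓ : IsCtx T Γ) {Θ Θ' : Tele T.sig m k}
    {a : Sub T.sig k m} (h : IsElem T Γ Θ a) (e : CtxEq T (Γ.append Θ) (Γ.append Θ')) :
    IsElem T Γ Θ' a :=
  (isElem_iff hΓ).2 (((isElem_iff hΓ).1 h).congr_cod hΓ e)

theorem ElemEq.conv {m k : ℕ} {Γ : Ctx T.sig m} (hΓ : IsCtx T Γ) {Θ Θ' : Tele T.sig m k}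
    {a b : Sub T.sig k m} (h : ElemEq T Γ Θ a b) (e : CtxEq T (Γ.append Θ) (Γ.append Θ')) :
    ElemEq T Γ Θ' a b :=
  (elemEq_iff hΓ).2 (((elemEq_iff hΓ).1 h).congr_cod hΓ e)

theorem IsMor.lift {m l : ℕ} {Γ : Ctx T.sig m} {Δ : Ctx T.sig l} {σ : Sub T.sig m l}
    (h : IsMor T Δ Γ σ) {A : Expr T.sig m} (hA : Derivable T Δ (.isType (A.subst σ))) :
    IsMor T (Δ.snoc (A.subst σ)) (Γ.snoc A) (liftSub σ 1) := by
  refine ⟨?_, ?_⟩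
  · simpa only [liftSub_one_castSucc] using h.wk hA
  · simpa only [liftSub_one_last, liftSub_one_castSucc, ← subst_wk] using Derivable.var hA

theorem IsMor.lift_append {m l : ℕ} {Γ : Ctx T.sig m} {Δ : Ctx T.sig l} {σ : Sub T.sig m l}
    (hΔ : IsCtx T Δ) (h : IsMor T Δ Γ σ) : {k : ℕ} → {Θ : Tele T.sig m k} →
    IsCtx T (Γ.append Θ) →
    IsCtx T (Δ.append (Θ.subst σ)) ∧
      IsMor T (Δ.append (Θ.subst σ)) (Γ.append Θ) (liftSub σ k)
  | _, .nil, _ => ⟨hΔ, h⟩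
  | _, .snoc Θ A, hΘ => by
    obtain ⟨h₁, h₂⟩ := IsMor.lift_append hΔ h hΘ.1
    have hA := hΘ.2.msubst h₁ h₂
    exact ⟨⟨h₁, hA⟩, h₂.lift hA⟩

theorem IsMor.wk_append {n : ℕ} {Γ : Ctx T.sig n} {m : ℕ} {Ψ : Ctx T.sig m} {f : Sub T.sig m n}
    (h : IsMor T Γ Ψ f) : {k : ℕ} → {Θ : Tele T.sig n k} → IsCtx T (Γ.append Θ) →
    IsMor T (Γ.append Θ) Ψ fun i => (f i).wk k
  | _, .nil, _ => by simp only [wk_zero]; exact h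
  | _, .snoc Θ A, hΘ => by
    have := (h.wk_append hΘ.1).wk hΘ.2
    simp only [wk_succ] at this
    exact this

theorem isMor_castAdd {n k : ℕ} {Γ : Ctx T.sig n} {Θ : Tele T.sig n k}
    (hΘ : IsCtx T (Γ.append Θ)) :
    IsMor T (Γ.append Θ) Γ fun i => .var (Fin.castAdd k i) :=
  (isMor_var hΘ.of_append).wk_append hΘ

theorem IsElem.wk {n k l : ℕ} {Γ : Ctx T.sig n} {Θ : Tele T.sig n k} {Ξ : Tele T.sig n l}
    (hΘ : IsCtx T (Γ.append Θ)) {a : Sub T.sig l n} (h : IsElem T Γ Ξ a) :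
    IsElem T (Γ.append Θ) (Ξ.wk k) fun i => (a i).wk k := by
  simp only [wk_eq_subst]
  exact h.subst hΘ.of_append hΘ (isMor_castAdd hΘ)

theorem isElem_natAdd {n k : ℕ} {Γ : Ctx T.sig n} {Θ : Tele T.sig n k}
    (hΘ : IsCtx T (Γ.append Θ)) :
    IsElem T (Γ.append Θ) (Θ.wk k) fun j => .var (Fin.natAdd n j) := by
  have := isMor_var hΘ
  rw [← append_eta Expr.var] at this
  exact (isMor_append_iff.1 this).2

theorem isCtx_wk {n k l : ℕ} {Γ : Ctx T.sig n} {Θ : Tele T.sig n k} {Ξ : Tele T.sig n l}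
    (hΘ : IsCtx T (Γ.append Θ)) (hΞ : IsCtx T (Γ.append Ξ)) :
    IsCtx T ((Γ.append Θ).append (Ξ.wk k)) :=
  ((isMor_castAdd hΘ).lift_append hΘ hΞ).1

/-- Identity types of definitionally equal types and elements. -/
theorem Derivable.id_eq {n : ℕ} {Γ : Ctx T.sig n} {A A' a a' b b' : Expr T.sig n}
    (hA : Derivable T Γ (.eqType A A')) (ha : Derivable T Γ (.eqTerm a a' A))
    (hb : Derivable T Γ (.eqTerm b b' A)) :
    Derivable T Γ (.eqType (.id A a b) (.id A' a' b')) := by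
  have hA₁ := hA.presup_eqType_left
  have hA₂ : Derivable T (Γ.snoc A) (.isType (A.wk 1)) := hA₁.wk hA₁
  have h₃ : Derivable T ((Γ.snoc A).snoc (A.wk 1)) (.isType (.id (A.wk 2)
      (.var (Fin.last n).castSucc) (.var (Fin.last (n + 1))))) := by
    have hx := (Derivable.var hA₁).wk hA₂
    have hy := Derivable.var hA₂
    have e : (A.wk 1).wk 1 = A.wk 2 := wk_succ A 1
    rw [e] at hy
    rw [Judgement.rename] at hx
    have e' : (A.wk 1).rename Fin.castSucc = A.wk 2 := e
    rw [e'] at hx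
    exact .id_form (hy.presup_hasType) hx hy
  -- The endpoints are changed by substituting equal elements into `Id_A(x, y)`; only the change of
  -- the type `A` needs the congruence rule.
  have hm : MorEq T Γ ((Γ.snoc A).snoc (A.wk 1))
      (Fin.snoc (α := fun _ => Expr T.sig n) (inst a) b)
      (Fin.snoc (α := fun _ => Expr T.sig n) (inst a') b') := by
    refine ⟨⟨?_, ?_⟩, ?_⟩
    · simpa [inst] using MorEq.refl (isMor_var hA.isCtx)
    · simpa [inst] using ha
    · simpa [inst, wk_subst_castSucc] using hb
  have h₄ := hm.eqType hA.isCtx h₃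
  have e : ∀ a b : Expr T.sig n,
      (A.wk 2).subst (Fin.snoc (α := fun _ => Expr T.sig n) (inst a) b) = A := by
    intro a b
    rw [← wk_succ A 1, wk_subst_castSucc, wk_subst_castSucc]
    simp [inst]
  simp only [id_subst, var_subst, e, Fin.snoc_castSucc, Fin.snoc_last] at h₄
  simp only [inst, Fin.snoc_last] at h₄
  exact h₄.eqType_trans (.id_congr hA ha.presup_eqTerm_right hb.presup_eqTerm_right)

end Elements

/-! ### Abstract elimination principles and their composition -/

/-- The data of an elimination principle along a context morphism `δ` from `src` to `tgt`, whose
eliminator is the iterated `J` at `X`, `Y`, `U`; the renaming `ρ` says which variables it binds. -/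
structure ElimData (S : Signature.{u}) (N M n : ℕ) where
  tgt : Ctx S N
  src : Ctx S M
  δ : Sub S N M
  X : Sub S n N
  Y : Sub S n N
  U : Sub S n N
  ρ : Fin M → Fin (N + n)

namespace ElimData

variable {S : Signature.{u}} {N M L n : ℕ}

/-- The elimination data over the extension of `tgt` by a further variable. -/
def snoc (E : ElimData S N M n) (A : Expr S N) : ElimData S (N + 1) (M + 1) n where
  tgt := E.tgt.snoc A
  src := E.src.snoc (A.subst E.δ)
  δ := liftSub E.δ 1
  X := fun i => (E.X i).wk 1
  Y := fun i => (E.Y i).wk 1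
  U := fun i => (E.U i).wk 1
  -- The added variable is a parameter that `J` does not bind, so it is placed below the `n` bound
  -- variables.
  ρ := Fin.snoc (α := fun _ => Fin (N + 1 + n)) (fun i => liftRen Fin.castSucc n (E.ρ i))
    (Fin.castAdd n (Fin.last N))

/-- The elimination data over the extension of `tgt` by a dependent context. -/
def append (E : ElimData S N M n) : {k : ℕ} → Tele S N k → ElimData S (N + k) (M + k) n
  | _, .nil => E
  | _, .snoc Θ A => (E.append Θ).snoc A

/-- The eliminator. -/
def J (E : ElimData S N M n) (d : Expr S M) : Expr S N := ctxJ n E.X E.Y E.U (d.rename E.ρ)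

/-- `E'` is the extension of `E` by some dependent context. -/
inductive Extends (E : ElimData S N M n) : {N' M' : ℕ} → ElimData S N' M' n → Prop
  | base : Extends E E
  | snoc {N' M' : ℕ} {E' : ElimData S N' M' n} (A : Expr S N') :
      Extends E E' → Extends E (E'.snoc A)

/-- Quantifying over a predicate `Q` on all elimination data replaces an equation between structures
whose length indices agree only propositionally. -/
theorem Extends.eq_append {E : ElimData S N M n} {N' M' : ℕ} {E' : ElimData S N' M' n}
    (h : E.Extends E') :
    ∀ Q : ({N' M' : ℕ} → ElimData S N' M' n → Prop),
      (∀ (k : ℕ) (Θ : Tele S N k), Q (E.append Θ)) → Q E' := by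
  induction h with
  | base => intro Q h; exact h 0 .nil
  | snoc A _ ih => intro Q h; exact ih (fun E' => ∀ A, Q (E'.snoc A)) (fun k Θ A => h _ (Θ.snoc A)) A

theorem extends_append (E : ElimData S N M n) : {k : ℕ} → (Θ : Tele S N k) →
    E.Extends (E.append Θ)
  | _, .nil => .base
  | _, .snoc Θ A => .snoc A (E.extends_append Θ)

theorem Extends.trans {E : ElimData S N M n} {N' M' N'' M'' : ℕ} {E' : ElimData S N' M' n}
    {E'' : ElimData S N'' M'' n} (h : E.Extends E') (h' : E'.Extends E'') : E.Extends E'' := by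
  induction h' with
  | base => exact h
  | snoc A _ ih => exact .snoc A ih

section Append

variable (E : ElimData S N M n)

theorem append_tgt : {k : ℕ} → (Θ : Tele S N k) → (E.append Θ).tgt = E.tgt.append Θ
  | _, .nil => rfl
  | _, .snoc Θ A => by rw [append, snoc, append_tgt Θ]; rfl

theorem append_δ : {k : ℕ} → (Θ : Tele S N k) → (E.append Θ).δ = liftSub E.δ k
  | _, .nil => rfl
  | _, .snoc Θ A => by rw [append, snoc, append_δ Θ]; rfl

theorem append_src : {k : ℕ} → (Θ : Tele S N k) →
    (E.append Θ).src = E.src.append (Θ.subst E.δ)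
  | _, .nil => rfl
  | _, .snoc Θ A => by rw [append, snoc, append_src Θ, append_δ]; rfl

theorem append_X : {k : ℕ} → (Θ : Tele S N k) → (E.append Θ).X = fun i => (E.X i).wk k
  | _, .nil => by simp only [wk_zero]; rfl
  | _, .snoc Θ A => by
    rw [append, snoc, append_X Θ]
    funext i
    exact wk_succ _ _

theorem append_Y : {k : ℕ} → (Θ : Tele S N k) → (E.append Θ).Y = fun i => (E.Y i).wk k
  | _, .nil => by simp only [wk_zero]; rfl
  | _, .snoc Θ A => by
    rw [append, snoc, append_Y Θ]
    funext i
    exact wk_succ _ _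

theorem append_U : {k : ℕ} → (Θ : Tele S N k) → (E.append Θ).U = fun i => (E.U i).wk k
  | _, .nil => by simp only [wk_zero]; rfl
  | _, .snoc Θ A => by
    rw [append, snoc, append_U Θ]
    funext i
    exact wk_succ _ _

theorem append_ρ : {k : ℕ} → (Θ : Tele S N k) → (E.append Θ).ρ =
    Fin.append (fun i => liftRen (Fin.castAdd k) n (E.ρ i))
      (fun j => Fin.castAdd n (Fin.natAdd N j))
  | _, .nil => by
    rw [append_zero]
    funext i
    show E.ρ i = _
    refine Fin.addCases (motive := fun x => x = liftRen (Fin.castAdd 0) n x) (fun i => ?_)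
      (fun j => ?_) (E.ρ i)
    · rw [liftRen_castAdd]; rfl
    · rw [liftRen_natAdd]; rfl
  | _, .snoc (k := k) Θ A => by
    rw [append, snoc, append_ρ Θ]
    funext i
    dsimp only
    refine Fin.lastCases ?_ (fun i => ?_) i
    · refine (Fin.snoc_last (α := fun _ => Fin (N + k + 1 + n)) _ _).trans ?_
      refine Eq.trans ?_ (append_last _ _).symm
      rfl
    · refine (Fin.snoc_castSucc (α := fun _ => Fin (N + k + 1 + n)) _ _ _).trans ?_
      refine Eq.trans ?_ (append_castSucc _ _ _).symm
      refine Fin.addCases (fun i => ?_) (fun j => ?_) i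
      · simp only [Fin.append_left]
        refine Fin.addCases (fun i => ?_) (fun j => ?_) (E.ρ i)
        · simp only [liftRen_castAdd]; rfl
        · simp only [liftRen_natAdd]; rfl
      · simp only [Fin.append_right, liftRen_castAdd]
        rfl

end Append

variable {T : TypeTheory.{u}}

/-- The eliminator is well-typed and satisfies the computation rule. -/
def Sound (E : ElimData T.sig N M n) : Prop :=
  ∀ C d, Derivable T E.tgt (.isType C) → Derivable T E.src (.hasType d (C.subst E.δ)) →
    Derivable T E.tgt (.hasType (E.J d) C) ∧
      Derivable T E.src (.eqTerm ((E.J d).subst E.δ) d (C.subst E.δ))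

/-- The elimination principle holds relative to any further dependent context. -/
def Elim (E : ElimData T.sig N M n) : Prop :=
  ∀ ⦃N' M' : ℕ⦄ ⦃E' : ElimData T.sig N' M' n⦄, E.Extends E' → E'.Sound

theorem Elim.append {E : ElimData T.sig N M n} (h : E.Elim) {k : ℕ} (Θ : Tele T.sig N k) :
    (E.append Θ).Elim :=
  fun _ _ _ h' => h ((E.extends_append Θ).trans h')

/-- `R` is the composite of `P` and the single elimination `Q`. -/
structure IsComp (P : ElimData S N M n) (Q : ElimData S M L 1) (R : ElimData S N L (n + 1)) :
    Prop where
  mid : P.src = Q.tgt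
  tgt : R.tgt = P.tgt
  src : R.src = Q.src
  δ : R.δ = fun i => (P.δ i).subst Q.δ
  X : (fun i => R.X i.castSucc) = P.X
  Y : (fun i => R.Y i.castSucc) = P.Y
  U : (fun i => R.U i.castSucc) = P.U
  -- The arguments of the inner `J` stand under the `n` binders of `P`, where `P.ρ` puts the
  -- variables of `Q`; that they are weakenings says that they do not involve the bound variables.
  X_last : (R.X (Fin.last n)).wk n = (Q.X 0).rename P.ρ
  Y_last : (R.Y (Fin.last n)).wk n = (Q.Y 0).rename P.ρ
  U_last : (R.U (Fin.last n)).wk n = (Q.U 0).rename P.ρ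
  ρ : R.ρ = liftRen P.ρ 1 ∘ Q.ρ

theorem wk_wk_comm (e : Expr S N) : (e.wk 1).wk n = (e.wk n).rename (liftRen Fin.castSucc n) := by
  simp only [Expr.wk, rename_rename]
  congr 1
  funext i
  exact (liftRen_castAdd _ _ _).symm

theorem rename_snoc_ρ (E : ElimData S N M n) (A : Expr S N) (e : Expr S M) :
    (e.wk 1).rename (E.snoc A).ρ = (e.rename E.ρ).rename (liftRen Fin.castSucc n) := by
  simp only [Expr.wk, rename_rename]
  congr 1
  funext i
  exact Fin.snoc_castSucc (α := fun _ => Fin (N + 1 + n)) (Fin.castAdd n (Fin.last N))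
    (fun i => liftRen Fin.castSucc n (E.ρ i)) i

/-- A parameter added to the composite is added to both factors; `Q` lives over the source of `P`,
so there its type is restricted along `P.δ`. -/
theorem IsComp.snoc {P : ElimData S N M n} {Q : ElimData S M L 1} {R : ElimData S N L (n + 1)}
    (h : IsComp P Q R) (A : Expr S N) :
    IsComp (P.snoc A) (Q.snoc (A.subst P.δ)) (R.snoc A) where
  mid := by simp only [ElimData.snoc, h.mid]
  tgt := by simp only [ElimData.snoc, h.tgt]
  src := by simp only [ElimData.snoc, h.src, h.δ, subst_subst]
  δ := by simp only [ElimData.snoc, h.δ, ← liftSub_comp]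
  X := by simp only [ElimData.snoc, ← h.X]
  Y := by simp only [ElimData.snoc, ← h.Y]
  U := by simp only [ElimData.snoc, ← h.U]
  X_last := by
    refine Eq.trans ?_ (rename_snoc_ρ P A _).symm
    rw [← h.X_last]
    exact wk_wk_comm _
  Y_last := by
    refine Eq.trans ?_ (rename_snoc_ρ P A _).symm
    rw [← h.Y_last]
    exact wk_wk_comm _
  U_last := by
    refine Eq.trans ?_ (rename_snoc_ρ P A _).symm
    rw [← h.U_last]
    exact wk_wk_comm _
  ρ := by
    funext i
    refine Fin.lastCases ?_ (fun i => ?_) i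
    · simp only [ElimData.snoc, Fin.snoc_last, Function.comp_apply]
      have : (Fin.castAdd 1 (Fin.last M)) = (Fin.last M).castSucc := rfl
      rw [this, liftRen_one_castSucc, Fin.snoc_last]
      rfl
    · simp only [ElimData.snoc, Fin.snoc_castSucc, Function.comp_apply, h.ρ]
      refine Fin.lastCases ?_ (fun j => ?_) (Q.ρ i)
      · rw [liftRen_one_last, liftRen_one_last, liftRen_one_last]
        exact liftRen_one_last _
      · rw [liftRen_one_castSucc, liftRen_one_castSucc, liftRen_one_castSucc, Fin.snoc_castSucc]
        exact liftRen_one_castSucc _ _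

/-- This reduces elimination with parameters for a composite to elimination with parameters for its
two factors. -/
theorem Extends.decomp {P : ElimData S N M n} {Q : ElimData S M L 1}
    {R : ElimData S N L (n + 1)} (hc : IsComp P Q R) {N' L' : ℕ}
    {R' : ElimData S N' L' (n + 1)} (h : R.Extends R') :
    ∃ (M' : ℕ) (P' : ElimData S N' M' n) (Q' : ElimData S M' L' 1),
      P.Extends P' ∧ Q.Extends Q' ∧ IsComp P' Q' R' := by
  induction h with
  | base => exact ⟨M, P, Q, .base, .base, hc⟩
  | snoc A _ ih =>
    obtain ⟨M', P', Q', hP, hQ, hc'⟩ := ih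
    exact ⟨M' + 1, P'.snoc A, Q'.snoc _, .snoc _ hP, .snoc _ hQ, hc'.snoc A⟩

theorem IsComp.J_eq {P : ElimData S N M n} {Q : ElimData S M L 1} {R : ElimData S N L (n + 1)}
    (h : IsComp P Q R) (d : Expr S L) : R.J d = P.J (Q.J d) := by
  simp only [J, ctxJ, h.X, h.Y, h.U, h.X_last, h.Y_last, h.U_last, h.ρ, Expr.rename, wk_zero,
    ← rename_rename]
  rfl

/-- The contexts are well-formed, and `δ` is a context morphism. -/
structure WF (E : ElimData T.sig N M n) : Prop where
  tgt : IsCtx T E.tgt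
  src : IsCtx T E.src
  δ : IsMor T E.src E.tgt E.δ

theorem WF.snoc {E : ElimData T.sig N M n} (h : E.WF) {A : Expr T.sig N}
    (hA : Derivable T E.tgt (.isType A)) : (E.snoc A).WF :=
  have hA' := hA.msubst h.src h.δ
  ⟨⟨h.tgt, hA⟩, ⟨h.src, hA'⟩, h.δ.lift hA'⟩

theorem WF.extends {E : ElimData T.sig N M n} (h : E.WF) {N' M' : ℕ}
    {E' : ElimData T.sig N' M' n} (h' : E.Extends E') : IsCtx T E'.tgt → E'.WF := by
  induction h' with
  | base => exact fun _ => h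
  | snoc A _ ih => exact fun hc => (ih hc.1).snoc hc.2

theorem WF.append {E : ElimData T.sig N M n} (h : E.WF) {k : ℕ} {Θ : Tele T.sig N k}
    (hΘ : IsCtx T (E.tgt.append Θ)) : (E.append Θ).WF :=
  h.extends (E.extends_append Θ) (by rwa [append_tgt])

theorem IsComp.wf {P : ElimData T.sig N M n} {Q : ElimData T.sig M L 1}
    {R : ElimData T.sig N L (n + 1)} (h : IsComp P Q R) (hP : P.WF) (hQ : Q.WF) : R.WF where
  tgt := h.tgt ▸ hP.tgt
  src := h.src ▸ hQ.src
  δ := by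
    rw [h.δ, h.tgt, h.src]
    exact IsMor.comp hQ.src hQ.δ (h.mid ▸ hP.δ)

/-- Restrict the family along `P.δ`, eliminate by `Q`, and feed the result to `P`. The computation
rule of `P`, restricted along `Q.δ`, is followed by that of `Q`. -/
theorem IsComp.sound {P : ElimData T.sig N M n} {Q : ElimData T.sig M L 1}
    {R : ElimData T.sig N L (n + 1)} (h : IsComp P Q R) (hP : P.Sound) (hQ : Q.Sound)
    (hP' : P.WF) (hQ' : Q.WF) : R.Sound := by
  intro C d hC hd
  rw [h.tgt] at hC
  rw [h.src, h.δ, ← subst_subst] at hd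
  rw [h.tgt, h.src, h.J_eq, h.δ, ← subst_subst, ← subst_subst]
  have hC' := hC.msubst hP'.src hP'.δ
  have hmid := h.mid
  obtain ⟨h₁, h₂⟩ := hQ _ d (hmid ▸ hC') hd
  obtain ⟨h₃, h₄⟩ := hP C (Q.J d) hC (hmid ▸ h₁)
  rw [hmid] at h₄
  exact ⟨h₃, (h₄.msubst hQ'.src hQ'.δ).eqTerm_trans h₂⟩

theorem IsComp.elim {P : ElimData T.sig N M n} {Q : ElimData T.sig M L 1}
    {R : ElimData T.sig N L (n + 1)} (h : IsComp P Q R) (hP : P.Elim) (hQ : Q.Elim)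
    (hP' : P.WF) (hQ' : Q.WF) : R.Elim := by
  intro N' L' R' hR C d hC hd
  obtain ⟨M', P', Q', h₁, h₂, h₃⟩ := hR.decomp h
  have hP₂ := hP'.extends h₁ (h₃.tgt ▸ hC.isCtx)
  have hQ₂ := hQ'.extends h₂ (h₃.mid ▸ hP₂.src)
  exact h₃.sound (hP h₁) (hQ h₂) hP₂ hQ₂ C d hC hd

end ElimData

/-! ### The ordinary `J` as an elimination principle -/

section Step

variable {S : Signature.{u}} {m l k : ℕ}

/-- The data of the elimination principle for a single identity type `W`. -/
def stepData (Γ : Ctx S m) (A : Expr S m) (W : Expr S (m + 2)) : ElimData S (m + 3) (m + 1) 1 where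
  tgt := ((Γ.snoc A).snoc (A.wk 1)).snoc W
  src := Γ.snoc A
  δ := diag
  X := fun _ => .var (Fin.last m).castSucc.castSucc
  Y := fun _ => .var (Fin.last (m + 1)).castSucc
  U := fun _ => .var (Fin.last (m + 2))
  ρ := Fin.snoc (α := fun _ => Fin (m + 4)) (fun i => (Fin.castAdd 3 i).castSucc) (Fin.last (m + 3))

/-- The identity type of the last two variables of `(Γ, x ∈ A, y ∈ A)`. -/
def idVar (A : Expr S m) : Expr S (m + 2) :=
  .id (A.wk 2) (.var (Fin.last m).castSucc) (.var (Fin.last (m + 1)))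

/-- The dependent context `(x ∈ A, y ∈ A, u ∈ Id_A(x, y))`. -/
def pathTele (A : Expr S m) : Tele S m 3 :=
  ((Tele.nil.snoc A).snoc (A.wk 1)).snoc (idVar A)

theorem append_pathTele (Γ : Ctx S m) (A : Expr S m) :
    Γ.append (pathTele A) = Γ.pathSpace A := rfl

theorem pathTele_subst (A : Expr S m) (σ : Sub S m l) :
    (pathTele A).subst σ = pathTele (A.subst σ) := by
  have h₁ := liftSub_natAdd σ 2 0
  have h₂ := liftSub_natAdd σ 2 1
  have e₁ : (Fin.last m).castSucc = Fin.natAdd m (0 : Fin 2) := rfl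
  have e₂ : Fin.last (m + 1) = Fin.natAdd m (1 : Fin 2) := rfl
  simp only [pathTele, idVar, Tele.subst, wk_subst_liftSub, id_subst, var_subst]
  rw [e₁, e₂, h₁, h₂]
  rfl

theorem forall_fin_add_three {P : Fin (m + 3) → Prop} (h : ∀ i : Fin m, P (Fin.castAdd 3 i))
    (h₀ : P (Fin.last m).castSucc.castSucc) (h₁ : P (Fin.last (m + 1)).castSucc)
    (h₂ : P (Fin.last (m + 2))) (i : Fin (m + 3)) : P i := by
  refine Fin.lastCases h₂ (fun i => ?_) i
  refine Fin.lastCases h₁ (fun i => ?_) i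
  exact Fin.lastCases h₀ h i

/-- Extension of a substitution by three expressions. -/
def snoc3 (σ : Sub S m l) (a b p : Expr S l) : Sub S (m + 3) l :=
  Fin.snoc (α := fun _ => Expr S l) (Fin.snoc (α := fun _ => Expr S l)
    (Fin.snoc (α := fun _ => Expr S l) σ a) b) p

@[simp] theorem snoc3_castAdd (σ : Sub S m l) (a b p : Expr S l) (i : Fin m) :
    snoc3 σ a b p (Fin.castAdd 3 i) = σ i := by
  have : Fin.castAdd 3 i = i.castSucc.castSucc.castSucc := rfl
  rw [this, snoc3, Fin.snoc_castSucc, Fin.snoc_castSucc, Fin.snoc_castSucc]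

@[simp] theorem snoc3_first (σ : Sub S m l) (a b p : Expr S l) :
    snoc3 σ a b p (Fin.last m).castSucc.castSucc = a := by
  rw [snoc3, Fin.snoc_castSucc, Fin.snoc_castSucc, Fin.snoc_last]

@[simp] theorem snoc3_second (σ : Sub S m l) (a b p : Expr S l) :
    snoc3 σ a b p (Fin.last (m + 1)).castSucc = b := by
  rw [snoc3, Fin.snoc_castSucc, Fin.snoc_last]

@[simp] theorem snoc3_third (σ : Sub S m l) (a b p : Expr S l) :
    snoc3 σ a b p (Fin.last (m + 2)) = p := by
  rw [snoc3, Fin.snoc_last]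

theorem inst3_eq (a b p : Expr S m) : inst3 a b p = snoc3 Expr.var a b p := rfl

/-- Writing `diag`, `inst3` and lifted substitutions uniformly as `snoc3` makes their composites
computable. -/
theorem diag_eq : diag (S := S) (n := m) = snoc3 (fun i => .var i.castSucc)
    (.var (Fin.last m)) (.var (Fin.last m)) (.refl (.var (Fin.last m))) := by
  have h : (Expr.var : Sub S (m + 1) (m + 1)) =
      Fin.snoc (α := fun _ => Expr S (m + 1)) (fun i => .var i.castSucc) (.var (Fin.last m)) :=
    (snoc_eta _).symm
  rw [diag, snoc3, ← h]

theorem snoc3_subst {n : ℕ} (σ : Sub S m l) (a b p : Expr S l) (τ : Sub S l n) :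
    (fun i => (snoc3 σ a b p i).subst τ) =
      snoc3 (fun i => (σ i).subst τ) (a.subst τ) (b.subst τ) (p.subst τ) := by
  funext i
  induction i using forall_fin_add_three <;> simp

theorem liftSub_three (σ : Sub S m l) : liftSub σ 3 = snoc3 (fun i => (σ i).wk 3)
    (.var (Fin.last l).castSucc.castSucc) (.var (Fin.last (l + 1)).castSucc)
    (.var (Fin.last (l + 2))) := by
  funext i
  induction i using forall_fin_add_three with
  | h i => rw [liftSub_castAdd, snoc3_castAdd]
  | h₀ => rw [snoc3_first]; exact liftSub_natAdd σ 3 0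
  | h₁ => rw [snoc3_second]; exact liftSub_natAdd σ 3 1
  | h₂ => rw [snoc3_third]; exact liftSub_natAdd σ 3 2

theorem wk_subst_snoc3 (e : Expr S m) (σ : Sub S m l) (a b p : Expr S l) :
    (e.wk 3).subst (snoc3 σ a b p) = e.subst σ := by
  rw [wk_subst]
  simp

theorem liftSub_three_inst3 (σ : Sub S m l) (a b p : Expr S l) :
    (fun i => (liftSub σ 3 i).subst (inst3 a b p)) = snoc3 σ a b p := by
  rw [liftSub_three, snoc3_subst, inst3_eq]
  simp [wk_subst_snoc3]

/-- Naturality of the diagonal in the base context. -/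
theorem liftSub_three_diag (σ : Sub S m l) :
    (fun i => (liftSub σ 3 i).subst diag) = fun i => (diag i).subst (liftSub σ 1) := by
  rw [liftSub_three, snoc3_subst, diag_eq, diag_eq, snoc3_subst]
  simp only [wk_subst_snoc3, var_subst, snoc3_first, snoc3_second, snoc3_third, refl_subst,
    liftSub_one_castSucc, liftSub_one_last]
  congr 1
  funext i
  exact (wk_eq_subst _ 1).symm

theorem snoc3_var : snoc3 (S := S) (fun i => .var (Fin.castAdd 3 i))
    (.var (Fin.last m).castSucc.castSucc) (.var (Fin.last (m + 1)).castSucc)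
    (.var (Fin.last (m + 2))) = Expr.var := by
  funext i
  induction i using forall_fin_add_three <;> simp

variable {T : TypeTheory.{u}}

theorem isMor_pathSpace {Γ : Ctx T.sig m} {Δ : Ctx T.sig l} {A : Expr T.sig m}
    {Θ : Tele T.sig (m + 3) k} (h : IsCtx T ((Γ.pathSpace A).append Θ)) {σ : Sub T.sig m l}
    (hΔ : IsCtx T Δ) (hσ : IsMor T Δ Γ σ) :
    IsCtx T ((Δ.pathSpace (A.subst σ)).append (Θ.subst (liftSub σ 3))) ∧
      IsMor T ((Δ.pathSpace (A.subst σ)).append (Θ.subst (liftSub σ 3)))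
        ((Γ.pathSpace A).append Θ) (liftSub (liftSub σ 3) k) := by
  have h' := h.of_append
  rw [← append_pathTele] at h' h
  obtain ⟨h₁, h₂⟩ := hσ.lift_append hΔ h'
  rw [pathTele_subst] at h₁ h₂
  exact h₂.lift_append h₁ h

theorem isMor_diag {Γ : Ctx T.sig m} {Δ : Ctx T.sig l} {A : Expr T.sig m}
    {Θ : Tele T.sig (m + 3) k} (h : IsCtx T ((Γ.snoc A).append (Θ.subst diag))) {σ : Sub T.sig m l}
    (hΔ : IsCtx T Δ) (hσ : IsMor T Δ Γ σ) :
    IsCtx T ((Δ.snoc (A.subst σ)).append ((Θ.subst (liftSub σ 3)).subst diag)) ∧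
      IsMor T ((Δ.snoc (A.subst σ)).append ((Θ.subst (liftSub σ 3)).subst diag))
        ((Γ.snoc A).append (Θ.subst diag)) (liftSub (liftSub σ 1) k) := by
  have hA : IsCtx T (Γ.snoc A) := h.of_append
  have hA' := hA.2.msubst hΔ hσ
  have hΔ' : IsCtx T (Δ.snoc (A.subst σ)) := ⟨hΔ, hA'⟩
  have := (hσ.lift hA').lift_append hΔ' h
  rwa [Tele.subst_subst, ← liftSub_three_diag, ← Tele.subst_subst] at this

theorem liftSub_three_diag_lift (C : Expr S (m + 3 + k)) (σ : Sub S m l) :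
    (C.subst (liftSub (liftSub σ 3) k)).subst (liftSub diag k) =
      (C.subst (liftSub diag k)).subst (liftSub (liftSub σ 1) k) := by
  simp only [subst_subst, liftSub_comp, liftSub_three_diag]

theorem liftSub_three_inst3_lift (C : Expr S (m + 3 + k)) (σ : Sub S m l) (a b p : Expr S l) :
    (C.subst (liftSub (liftSub σ 3) k)).subst (liftSub (inst3 a b p) k) =
      C.subst (liftSub (snoc3 σ a b p) k) := by
  simp only [subst_subst, liftSub_comp, liftSub_three_inst3]

/-- The elimination rule wants the family and the elements over the same context. Pulling the family
back along `σ` permits elements over another context, in particular the generic ones over the path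
space itself. -/
theorem Derivable.elim_subst {Γ : Ctx T.sig m} {Δ : Ctx T.sig l} {A : Expr T.sig m}
    {Θ : Tele T.sig (m + 3) k} {C : Expr T.sig (m + 3 + k)} {d : Expr T.sig (m + 1 + k)}
    {σ : Sub T.sig m l} {a b p : Expr T.sig l}
    (hC : Derivable T ((Γ.pathSpace A).append Θ) (.isType C))
    (hd : Derivable T ((Γ.snoc A).append (Θ.subst diag)) (.hasType d (C.subst (liftSub diag k))))
    (hΔ : IsCtx T Δ) (hσ : IsMor T Δ Γ σ) (ha : Derivable T Δ (.hasType a (A.subst σ)))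
    (hb : Derivable T Δ (.hasType b (A.subst σ)))
    (hp : Derivable T Δ (.hasType p (.id (A.subst σ) a b))) :
    Derivable T (Δ.append (Θ.subst (snoc3 σ a b p)))
      (.hasType (elimTerm k a b p (d.subst (liftSub (liftSub σ 1) k)))
        (C.subst (liftSub (snoc3 σ a b p) k))) := by
  obtain ⟨h₁, h₂⟩ := isMor_pathSpace hC.isCtx hΔ hσ
  obtain ⟨h₃, h₄⟩ := isMor_diag hd.isCtx hΔ hσ
  have hd' := hd.msubst h₃ h₄
  rw [Judgement.subst, ← liftSub_three_diag_lift] at hd'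
  have := Derivable.id_elim ha hb hp (hC.msubst h₁ h₂) hd'
  rwa [liftSub_three_inst3_lift, Tele.subst_subst, liftSub_three_inst3] at this

theorem Derivable.comp_subst {Γ : Ctx T.sig m} {Δ : Ctx T.sig l} {A : Expr T.sig m}
    {Θ : Tele T.sig (m + 3) k} {C : Expr T.sig (m + 3 + k)} {d : Expr T.sig (m + 1 + k)}
    {σ : Sub T.sig m l} {a : Expr T.sig l}
    (hC : Derivable T ((Γ.pathSpace A).append Θ) (.isType C))
    (hd : Derivable T ((Γ.snoc A).append (Θ.subst diag)) (.hasType d (C.subst (liftSub diag k))))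
    (hΔ : IsCtx T Δ) (hσ : IsMor T Δ Γ σ) (ha : Derivable T Δ (.hasType a (A.subst σ))) :
    Derivable T (Δ.append (Θ.subst (snoc3 σ a a (.refl a))))
      (.eqTerm (elimTerm k a a (.refl a) (d.subst (liftSub (liftSub σ 1) k)))
        ((d.subst (liftSub (liftSub σ 1) k)).subst (liftSub (inst a) k))
        (C.subst (liftSub (snoc3 σ a a (.refl a)) k))) := by
  obtain ⟨h₁, h₂⟩ := isMor_pathSpace hC.isCtx hΔ hσ
  obtain ⟨h₃, h₄⟩ := isMor_diag hd.isCtx hΔ hσ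
  have hd' := hd.msubst h₃ h₄
  rw [Judgement.subst, ← liftSub_three_diag_lift] at hd'
  have := Derivable.id_comp ha (hC.msubst h₁ h₂) hd'
  rwa [liftSub_three_inst3_lift, Tele.subst_subst, liftSub_three_inst3] at this

theorem forall_fin_succ_add {P : Fin (m + 1 + k) → Prop}
    (h₀ : ∀ i : Fin m, P (Fin.castAdd k i.castSucc)) (h₁ : P (Fin.castAdd k (Fin.last m)))
    (h₂ : ∀ j : Fin k, P (Fin.natAdd (m + 1) j)) (i : Fin (m + 1 + k)) : P i :=
  Fin.addCases (fun i => Fin.lastCases h₁ h₀ i) h₂ i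

@[simp] theorem toEnd_castAdd_castSucc (i : Fin m) :
    toEnd m k (Fin.castAdd k i.castSucc) = (Fin.castAdd k i).castSucc := by simp [toEnd]

@[simp] theorem toEnd_castAdd_last :
    toEnd m k (Fin.castAdd k (Fin.last m)) = Fin.last (m + k) := by simp [toEnd]

@[simp] theorem toEnd_natAdd (j : Fin k) :
    toEnd m k (Fin.natAdd (m + 1) j) = (Fin.natAdd m j).castSucc := by simp [toEnd]

theorem stepData_ρ_castAdd_castSucc (Γ : Ctx S m) (A : Expr S m) (W : Expr S (m + 2))
    (Θ : Tele S (m + 3) k) (i : Fin m) :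
    ((stepData Γ A W).append Θ).ρ (Fin.castAdd k i.castSucc) =
      (Fin.castAdd k (Fin.castAdd 3 i)).castSucc := by
  rw [ElimData.append_ρ, Fin.append_left, stepData]
  simp only [Fin.snoc_castSucc]
  exact liftRen_castAdd _ 1 _

theorem stepData_ρ_castAdd_last (Γ : Ctx S m) (A : Expr S m) (W : Expr S (m + 2))
    (Θ : Tele S (m + 3) k) :
    ((stepData Γ A W).append Θ).ρ (Fin.castAdd k (Fin.last m)) = Fin.last (m + 3 + k) := by
  rw [ElimData.append_ρ, Fin.append_left, stepData]
  simp only [Fin.snoc_last]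
  exact liftRen_one_last _

theorem stepData_ρ_natAdd (Γ : Ctx S m) (A : Expr S m) (W : Expr S (m + 2))
    (Θ : Tele S (m + 3) k) (j : Fin k) :
    ((stepData Γ A W).append Θ).ρ (Fin.natAdd (m + 1) j) = (Fin.natAdd (m + 3) j).castSucc := by
  rw [ElimData.append_ρ, Fin.append_right]
  rfl

/-- The renaming `ρ` does in one go what the elimination rule does in two: weakening `d` to the path
space, then moving the variable to be bound to the end. The type `W` does not occur in the result.
-/
theorem stepData_J (Γ : Ctx S m) (A : Expr S m) (W : Expr S (m + 2))
    (Θ : Tele S (m + 3) k) (d : Expr S (m + 1 + k)) :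
    ((stepData Γ A W).append Θ).J d =
      elimTerm k (.var (Fin.last m).castSucc.castSucc) (.var (Fin.last (m + 1)).castSucc)
        (.var (Fin.last (m + 2)))
        (d.subst (liftSub (liftSub (fun i => .var (Fin.castAdd 3 i)) 1) k)) := by
  have hρ : d.rename ((stepData Γ A W).append Θ).ρ =
      (d.subst (liftSub (liftSub (fun i => .var (Fin.castAdd 3 i)) 1) k)).rename
        (toEnd (m + 3) k) := by
    rw [rename_eq_subst, subst_rename]
    congr 1
    funext i
    induction i using forall_fin_succ_add with
    | h₀ i =>
      simp only [Function.comp_apply, stepData_ρ_castAdd_castSucc, liftSub_castAdd,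
        liftSub_one_castSucc, Expr.wk, Expr.rename]
      exact congrArg _ (toEnd_castAdd_castSucc _).symm
    | h₁ =>
      simp only [Function.comp_apply, stepData_ρ_castAdd_last, liftSub_castAdd,
        liftSub_one_last, Expr.wk, Expr.rename]
      exact congrArg _ toEnd_castAdd_last.symm
    | h₂ j =>
      simp only [Function.comp_apply, stepData_ρ_natAdd, liftSub_natAdd, Expr.rename]
      exact congrArg _ (toEnd_natAdd _).symm
  rw [ElimData.J, hρ, ElimData.append_X, ElimData.append_Y, ElimData.append_U]
  simp only [ctxJ, wk_zero]
  rfl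

theorem elimTerm_subst (a b p : Expr S m) (d : Expr S (m + 1 + k)) (σ : Sub S m l) :
    (elimTerm k a b p d).subst (liftSub σ k) =
      elimTerm k (a.subst σ) (b.subst σ) (p.subst σ) (d.subst (liftSub (liftSub σ 1) k)) := by
  simp only [elimTerm, Expr.subst, wk_subst_liftSub]
  congr 1
  rw [rename_subst, subst_rename]
  congr 1
  funext i
  induction i using forall_fin_succ_add with
  | h₀ i =>
    simp only [Function.comp_apply, toEnd_castAdd_castSucc, liftSub_castAdd,
      liftSub_one_castSucc, Expr.wk, rename_rename]
    congr 1
    funext i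
    exact (toEnd_castAdd_castSucc i).symm
  | h₁ =>
    simp only [Function.comp_apply, toEnd_castAdd_last, liftSub_castAdd,
      liftSub_one_last, Expr.wk, Expr.rename]
  | h₂ j =>
    simp only [Function.comp_apply, toEnd_natAdd, liftSub_natAdd, liftSub_one_castSucc, Expr.wk,
      Expr.rename]
    rfl

/-- Typing is the elimination rule pulled back to the path space, at its three variables `x, y, u`.
Computation is the computation rule pulled back to `(Γ, x ∈ A)`, at `x`. -/
theorem stepData_sound {Γ : Ctx T.sig m} {A : Expr T.sig m} (Θ : Tele T.sig (m + 3) k) :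
    ((stepData Γ A (idVar A)).append Θ).Sound := by
  intro C d hC hd
  rw [ElimData.append_tgt] at hC
  rw [ElimData.append_src, ElimData.append_δ] at hd
  rw [ElimData.append_tgt, ElimData.append_src, ElimData.append_δ, stepData_J]
  have hΓ₃ : IsCtx T (Γ.append (pathTele A)) := hC.isCtx.of_append
  have hΓ₁ : IsCtx T (Γ.snoc A) := hΓ₃.1.1
  have e₁ := wk_succ A 1
  have e₂ := wk_succ A 2
  have eA : A.subst (fun i => .var (Fin.castAdd 3 i)) = A.wk 3 := (wk_eq_subst A 3).symm
  have eA' : A.subst (fun i => .var i.castSucc) = A.wk 1 := (wk_eq_subst A 1).symm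
  constructor
  · have hx : Derivable T (Γ.pathSpace A)
        (.hasType (.var (Fin.last m).castSucc.castSucc) (A.wk 3)) := by
      have := ((Derivable.var hΓ₃.1.1.2).wk hΓ₃.1.2).wk hΓ₃.2
      rw [← e₂, ← e₁]
      exact this
    have hy : Derivable T (Γ.pathSpace A)
        (.hasType (.var (Fin.last (m + 1)).castSucc) (A.wk 3)) := by
      have := (Derivable.var hΓ₃.1.2).wk hΓ₃.2
      rw [← e₂, ← e₁]
      exact this
    have hu : Derivable T (Γ.pathSpace A) (.hasType (.var (Fin.last (m + 2))) (.id (A.wk 3)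
        (.var (Fin.last m).castSucc.castSucc) (.var (Fin.last (m + 1)).castSucc))) := by
      have := Derivable.var hΓ₃.2
      rw [← e₂]
      exact this
    rw [← eA] at hx hy hu
    have := hC.elim_subst hd hΓ₃ (isMor_castAdd hΓ₃) hx hy hu
    rw [snoc3_var, Tele.subst_var, liftSub_var, subst_var] at this
    exact this
  · have hx := Derivable.var hΓ₁.2
    rw [← eA'] at hx
    have := hC.comp_subst hd hΓ₁ ((isMor_var hΓ₁.1).wk hΓ₁.2) hx
    have e : (fun i => (Expr.var (S := T.sig) i).wk 1) = fun i : Fin m => .var i.castSucc := rfl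
    rw [e, ← diag_eq, subst_subst, liftSub_comp] at this
    have e' : (fun i => (liftSub (fun i : Fin m => Expr.var (S := T.sig) i.castSucc) 1 i).subst
        (inst (.var (Fin.last m)))) = Expr.var := by
      funext i
      refine Fin.lastCases ?_ (fun i => ?_) i
      · rw [liftSub_one_last, var_subst, inst, Fin.snoc_last]
      · rw [liftSub_one_castSucc, wk_subst_castSucc, inst]
        simp
    rw [e', liftSub_var, subst_var] at this
    -- Restricted along the diagonal, the generic eliminator becomes `J` at `x, x, r(x)`, as in the
    -- computation rule.
    rw [elimTerm_subst, subst_subst, liftSub_comp, liftSub_comp]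
    have e₃ : (fun i => (liftSub (fun i : Fin m => Expr.var (S := T.sig) (Fin.castAdd 3 i)) 1
        i).subst (liftSub diag 1)) = liftSub (fun i => .var i.castSucc) 1 := by
      rw [liftSub_comp]
      congr 1
      funext i
      rw [var_subst, diag_eq, snoc3_castAdd]
    rw [liftSub_comp] at e₃
    rw [show (stepData Γ A (idVar A)).δ = diag from rfl, e₃]
    simp only [var_subst]
    rw [show diag (S := T.sig) (n := m) (Fin.last m).castSucc.castSucc = .var (Fin.last m) by
        rw [diag_eq, snoc3_first],
      show diag (S := T.sig) (n := m) (Fin.last (m + 1)).castSucc = .var (Fin.last m) by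
        rw [diag_eq, snoc3_second],
      show diag (S := T.sig) (n := m) (Fin.last (m + 2)) = .refl (.var (Fin.last m)) by
        rw [diag_eq, snoc3_third]]
    exact this

end Step

/-! ### `J` for a type definitionally equal to an identity type -/

section StepElim

variable {T : TypeTheory.{u}} {m k : ℕ}

theorem CtxEq.append {Γ Γ' : Ctx T.sig m} (h : CtxEq T Γ Γ') (hΓ' : IsCtx T Γ') : {k : ℕ} →
    {Θ : Tele T.sig m k} → IsCtx T (Γ.append Θ) →
    CtxEq T (Γ.append Θ) (Γ'.append Θ) ∧ IsCtx T (Γ'.append Θ)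
  | _, .nil, _ => ⟨h, hΓ'⟩
  | _, .snoc Θ A, hΘ => by
    obtain ⟨h₁, h₂⟩ := h.append hΓ' hΘ.1
    exact ⟨⟨h₁, hΘ.2.eqType_refl⟩, h₂, hΘ.2.ctxConv h₂ h₁⟩

theorem stepData_append_J (Γ : Ctx T.sig m) (A : Expr T.sig m) (W W' : Expr T.sig (m + 2))
    (Θ : Tele T.sig (m + 3) k) :
    ((stepData Γ A W).append Θ).J = ((stepData Γ A W').append Θ).J := by
  funext d
  rw [stepData_J, stepData_J]

variable {Γ : Ctx T.sig m} {A : Expr T.sig m} {W : Expr T.sig (m + 2)}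

/-- Since the eliminator does not mention `W`, conversion of contexts transports the principle from
the identity type to `W`. The induction on identity contexts meets a `W` that contains a transport
along a trivial path. -/
theorem stepData_elim
    (hW : Derivable T ((Γ.snoc A).snoc (A.wk 1)) (.eqType W (idVar A))) :
    (stepData Γ A W).Elim := by
  intro N' M' E' hE
  refine hE.eq_append ElimData.Sound fun k Θ => ?_
  intro C d hC hd
  have hs := stepData_sound (Γ := Γ) (A := A) Θ C d
  rw [stepData_append_J Γ A W (idVar A)]
  rw [ElimData.append_tgt, ElimData.append_src, ElimData.append_δ] at *
  have h₀ : IsCtx T (stepData Γ A W).tgt := hC.isCtx.of_append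
  have h₁ : IsCtx T (stepData Γ A (idVar A)).tgt := ⟨h₀.1, hW.presup_eqType_right⟩
  have e : CtxEq T (stepData Γ A W).tgt (stepData Γ A (idVar A)).tgt := ⟨CtxEq.refl h₀.1, hW⟩
  obtain ⟨h₂, h₃⟩ := e.append h₁ hC.isCtx
  obtain ⟨h₄, h₅⟩ := hs (hC.ctxConv h₃ h₂) hd
  exact ⟨h₄.ctxConv hC.isCtx (CtxEq.symm h₃ h₂), h₅⟩

/-- Restricting `W = Id_A(x, y)` to `y = x` shows by conversion that `r(x)` has the type required of
the last component of the diagonal. -/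
theorem stepData_wf (hW : Derivable T ((Γ.snoc A).snoc (A.wk 1)) (.eqType W (idVar A))) :
    (stepData Γ A W).WF := by
  have h₀ : IsCtx T ((Γ.snoc A).snoc (A.wk 1)) := hW.isCtx
  have hv := Derivable.var h₀.1.2
  have h₁ : IsMor T (Γ.snoc A) ((Γ.snoc A).snoc (A.wk 1)) (Fin.snoc Expr.var (.var (Fin.last m))) := by
    refine ⟨?_, ?_⟩
    · simpa using isMor_var h₀.1
    · simpa using hv
  have e₁ : (Fin.snoc Expr.var (.var (Fin.last m)) : Sub T.sig (m + 2) (m + 1)) (Fin.last m).castSucc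
      = .var (Fin.last m) := by rw [Fin.snoc_castSucc]
  have e₂ : (Fin.snoc Expr.var (.var (Fin.last m)) : Sub T.sig (m + 2) (m + 1)) (Fin.last (m + 1))
      = .var (Fin.last m) := by rw [Fin.snoc_last]
  refine ⟨⟨h₀, hW.presup_eqType_left⟩, h₀.1, ?_⟩
  refine ⟨?_, ?_⟩
  · simpa [stepData, diag] using h₁
  · have h₂ := hW.msubst h₀.1 h₁
    have e : (idVar A).subst (Fin.snoc Expr.var (.var (Fin.last m)) : Sub T.sig (m + 2) (m + 1)) =
        .id (A.wk 1) (.var (Fin.last m)) (.var (Fin.last m)) := by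
      rw [idVar, id_subst, ← wk_succ A 1, wk_subst_castSucc, var_subst, var_subst, e₁, e₂]
      simp
    rw [Judgement.subst, e] at h₂
    have := (Derivable.id_intro hv).conv h₂.eqType_symm
    simpa [stepData, diag] using this

end StepElim

/-! ### The interleaved context of paths -/

section PathCtx

variable {S : Signature.{u}} {m l : ℕ}

/-- The length of the context of paths in a dependent context. -/
def plen (m : ℕ) : ℕ → ℕ
  | 0 => m
  | n + 1 => plen m n + 3

/-- The context morphism into the context of paths with components `σ`, `a`, `b`, `p`. -/
def inter : {n : ℕ} → (σ : Sub S m l) → (a b p : Sub S n l) → Sub S (plen m n) l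
  | 0, σ, _, _, _ => σ
  | n + 1, σ, a, b, p =>
    snoc3 (inter σ (fun i => a i.castSucc) (fun i => b i.castSucc) (fun i => p i.castSucc))
      (a (Fin.last n)) (b (Fin.last n)) (p (Fin.last n))

/-- The variables of the base context in the context of paths. -/
def pathBase (m : ℕ) : (n : ℕ) → Fin m → Fin (plen m n)
  | 0 => id
  | n + 1 => fun i => Fin.castAdd 3 (pathBase m n i)

/-- The source of the generic path. -/
def pathX (m : ℕ) : (n : ℕ) → Fin n → Fin (plen m n)
  | 0 => Fin.elim0
  | n + 1 => Fin.snoc (α := fun _ => Fin (plen m n + 3)) (fun i => Fin.castAdd 3 (pathX m n i))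
      (Fin.last (plen m n)).castSucc.castSucc

/-- The target of the generic path. -/
def pathY (m : ℕ) : (n : ℕ) → Fin n → Fin (plen m n)
  | 0 => Fin.elim0
  | n + 1 => Fin.snoc (α := fun _ => Fin (plen m n + 3)) (fun i => Fin.castAdd 3 (pathY m n i))
      (Fin.last (plen m n + 1)).castSucc

/-- The generic path. -/
def pathU (m : ℕ) : (n : ℕ) → Fin n → Fin (plen m n)
  | 0 => Fin.elim0
  | n + 1 => Fin.snoc (α := fun _ => Fin (plen m n + 3)) (fun i => Fin.castAdd 3 (pathU m n i))
      (Fin.last (plen m n + 2))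

@[simp] theorem inter_base (i : Fin m) : {n : ℕ} → (σ : Sub S m l) → (a b p : Sub S n l) →
    inter σ a b p (pathBase m n i) = σ i
  | 0, _, _, _, _ => rfl
  | _ + 1, _, _, _, _ => (snoc3_castAdd _ _ _ _ _).trans (inter_base i _ _ _ _)

@[simp] theorem inter_X : {n : ℕ} → (σ : Sub S m l) → (a b p : Sub S n l) → (i : Fin n) →
    inter σ a b p (pathX m n i) = a i
  | 0, _, _, _, _, i => i.elim0
  | n + 1, σ, a, b, p, i => by
    refine Fin.lastCases ?_ (fun i => ?_) i
    · rw [pathX, Fin.snoc_last]; exact snoc3_first _ _ _ _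
    · rw [pathX, Fin.snoc_castSucc]; exact (snoc3_castAdd _ _ _ _ _).trans (inter_X _ _ _ _ _)

@[simp] theorem inter_Y : {n : ℕ} → (σ : Sub S m l) → (a b p : Sub S n l) → (i : Fin n) →
    inter σ a b p (pathY m n i) = b i
  | 0, _, _, _, _, i => i.elim0
  | n + 1, σ, a, b, p, i => by
    refine Fin.lastCases ?_ (fun i => ?_) i
    · rw [pathY, Fin.snoc_last]; exact snoc3_second _ _ _ _
    · rw [pathY, Fin.snoc_castSucc]; exact (snoc3_castAdd _ _ _ _ _).trans (inter_Y _ _ _ _ _)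

@[simp] theorem inter_U : {n : ℕ} → (σ : Sub S m l) → (a b p : Sub S n l) → (i : Fin n) →
    inter σ a b p (pathU m n i) = p i
  | 0, _, _, _, _, i => i.elim0
  | n + 1, σ, a, b, p, i => by
    refine Fin.lastCases ?_ (fun i => ?_) i
    · rw [pathU, Fin.snoc_last]; exact snoc3_third _ _ _ _
    · rw [pathU, Fin.snoc_castSucc]; exact (snoc3_castAdd _ _ _ _ _).trans (inter_U _ _ _ _ _)

theorem inter_subst {r : ℕ} (τ : Sub S l r) : {n : ℕ} → (σ : Sub S m l) → (a b p : Sub S n l) →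
    (fun i => (inter σ a b p i).subst τ) = inter (fun i => (σ i).subst τ)
      (fun i => (a i).subst τ) (fun i => (b i).subst τ) (fun i => (p i).subst τ)
  | 0, _, _, _, _ => rfl
  | n + 1, σ, a, b, p => by
    refine (snoc3_subst _ _ _ _ _).trans ?_
    rw [inter_subst]
    rfl

theorem inter_wk (k : ℕ) {n : ℕ} (σ : Sub S m l) (a b p : Sub S n l) :
    (fun i => (inter σ a b p i).wk k) = inter (fun i => (σ i).wk k)
      (fun i => (a i).wk k) (fun i => (b i).wk k) (fun i => (p i).wk k) := by
  simp only [wk_eq_subst, inter_subst]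

/-- The identity morphism has the generic path as its components; facts about morphisms into the
context of paths therefore apply to the generic path. -/
theorem inter_var : (n : ℕ) → inter (S := S) (fun i => .var (pathBase m n i))
    (fun i => .var (pathX m n i)) (fun i => .var (pathY m n i)) (fun i => .var (pathU m n i)) =
      Expr.var
  | 0 => rfl
  | n + 1 => by
    have ih := congrArg (fun τ : Sub S (plen m n) (plen m n) => fun i => (τ i).wk 3) (inter_var n)
    rw [inter_wk] at ih
    refine Eq.trans ?_ snoc3_var
    simp only [inter, pathX, pathY, pathU, Fin.snoc_castSucc, Fin.snoc_last]
    congr 1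

/-- The context of paths in the dependent context `Φ` relative to `Γ`, in the order
`(Γ, x_0, y_0, u_0, x_1, y_1, u_1, ...)`. -/
def pathCtx (Γ : Ctx S m) : {n : ℕ} → Tele S m n → Ctx S (plen m n)
  | _, .nil => Γ
  | _, .snoc (k := n) Φ A =>
    let AX := A.subst (Fin.append (fun i => .var (pathBase m n i)) fun i => .var (pathX m n i))
    let AY := A.subst (Fin.append (fun i => .var (pathBase m n i)) fun i => .var (pathY m n i))
    (((pathCtx Γ Φ).snoc AX).snoc (AY.wk 1)).snoc
      (.id (AY.wk 2)
        (transport (fun i => (Expr.var (pathX m n i)).wk 2) (fun i => (Expr.var (pathY m n i)).wk 2)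
          (fun i => (Expr.var (pathU m n i)).wk 2) (.var (Fin.last (plen m n)).castSucc))
        (.var (Fin.last (plen m n + 1))))

/-- The trivial generic path. -/
def pathDiag (m n : ℕ) : Sub S (plen m n) (m + n) :=
  inter (fun i => .var (Fin.castAdd n i)) (fun i => .var (Fin.natAdd m i))
    (fun i => .var (Fin.natAdd m i)) (fun i => .refl (.var (Fin.natAdd m i)))

/-- The data of the elimination principle for identity contexts. -/
def pathData (Γ : Ctx S m) {n : ℕ} (Φ : Tele S m n) : ElimData S (plen m n) (m + n) n where
  tgt := pathCtx Γ Φ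
  src := Γ.append Φ
  δ := pathDiag m n
  X := fun i => .var (pathX m n i)
  Y := fun i => .var (pathY m n i)
  U := fun i => .var (pathU m n i)
  ρ := Fin.append (fun i => Fin.castAdd n (pathBase m n i)) (Fin.natAdd (plen m n))

/-- The diagonal factors as required of a composite elimination: first the shorter path is made
trivial, with the last three variables kept, then the last one. -/
theorem pathDiag_succ (m n : ℕ) : pathDiag (S := S) m (n + 1) =
    fun i => (liftSub (pathDiag m n) 3 i).subst diag := by
  refine Eq.trans ?_ (liftSub_three_diag _).symm
  rw [diag_eq, snoc3_subst]
  simp only [var_subst, liftSub_one_castSucc, refl_subst, liftSub_one_last]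
  rw [pathDiag, pathDiag, inter_wk, inter]
  rfl

/-- The types of the last three variables of the context of paths. -/
def pathLast {n : ℕ} (A : Expr S (m + n)) : Tele S (plen m n) 3 :=
  let AX := A.subst (Fin.append (fun i => .var (pathBase m n i)) fun i => .var (pathX m n i))
  let AY := A.subst (Fin.append (fun i => .var (pathBase m n i)) fun i => .var (pathY m n i))
  ((Tele.nil.snoc AX).snoc (AY.wk 1)).snoc
    (.id (AY.wk 2)
      (transport (fun i => (Expr.var (pathX m n i)).wk 2) (fun i => (Expr.var (pathY m n i)).wk 2)
        (fun i => (Expr.var (pathU m n i)).wk 2) (.var (Fin.last (plen m n)).castSucc))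
      (.var (Fin.last (plen m n + 1))))

theorem subst_X_pathDiag {n : ℕ} (A : Expr S (m + n)) :
    (A.subst (Fin.append (fun i => .var (pathBase m n i)) fun i => .var (pathX m n i))).subst
      (pathDiag m n) = A := by
  rw [subst_append_subst, pathDiag]
  simp only [var_subst, inter_base, inter_X]
  rw [append_eta, subst_var]

theorem subst_Y_pathDiag {n : ℕ} (A : Expr S (m + n)) :
    (A.subst (Fin.append (fun i => .var (pathBase m n i)) fun i => .var (pathY m n i))).subst
      (pathDiag m n) = A := by
  rw [subst_append_subst, pathDiag]
  simp only [var_subst, inter_base, inter_Y]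
  rw [append_eta, subst_var]

/-- The type of paths over the trivial path. -/
def pathOver {n : ℕ} (A : Expr S (m + n)) : Expr S (m + n + 2) :=
  .id (A.wk 2)
    (transport (fun i => (Expr.var (Fin.natAdd m i)).wk 2)
      (fun i => (Expr.var (Fin.natAdd m i)).wk 2)
      (fun i => (Expr.refl (.var (Fin.natAdd m i))).wk 2) (.var (Fin.last (m + n)).castSucc))
    (.var (Fin.last (m + n + 1)))

/-- On trivial paths the two copies of `A` coincide, but the type of the last variable still
contains `r_!(x)`; replacing this by `x` is a definitional equality and has to wait for typing. -/
theorem pathLast_subst {n : ℕ} (A : Expr S (m + n)) :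
    (pathLast A).subst (pathDiag m n) = ((Tele.nil.snoc A).snoc (A.wk 1)).snoc (pathOver A) := by
  have h₁ := liftSub_natAdd (pathDiag (S := S) m n) 2 0
  have h₂ := liftSub_natAdd (pathDiag (S := S) m n) 2 1
  have e₁ : (Fin.last (plen m n)).castSucc = Fin.natAdd (plen m n) (0 : Fin 2) := rfl
  have e₂ : Fin.last (plen m n + 1) = Fin.natAdd (plen m n) (1 : Fin 2) := rfl
  simp only [pathLast, pathOver, Tele.subst, wk_subst_liftSub, id_subst, var_subst,
    transport_subst, subst_Y_pathDiag]
  rw [e₁, e₂, h₁, h₂, pathDiag]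
  simp only [inter_X, inter_Y, inter_U]
  congr 1
  · congr 1
    exact congrArg _ (subst_X_pathDiag A)

/-- The induction step in raw form: the last three variables are parameters for the elimination over
`Φ`, and one `J` remains for the last path. -/
theorem pathData_isComp (Γ : Ctx S m) {n : ℕ} (Φ : Tele S m n) (A : Expr S (m + n)) :
    ElimData.IsComp ((pathData Γ Φ).append (pathLast A)) (stepData (Γ.append Φ) A (pathOver A))
      (pathData Γ (Φ.snoc A)) where
  mid := by
    rw [ElimData.append_src]
    refine (congrArg _ (pathLast_subst A)).trans ?_
    rfl
  tgt := rfl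
  src := rfl
  δ := pathDiag_succ m n
  X := by
    rw [ElimData.append_X]
    funext i
    simp only [pathData, pathX, Fin.snoc_castSucc]
    rfl
  Y := by
    rw [ElimData.append_Y]
    funext i
    simp only [pathData, pathY, Fin.snoc_castSucc]
    rfl
  U := by
    rw [ElimData.append_U]
    funext i
    simp only [pathData, pathU, Fin.snoc_castSucc]
    rfl
  X_last := by
    rw [ElimData.append_ρ]
    simp only [pathData, pathX, Fin.snoc_last, stepData, Expr.rename]
    rw [show (Fin.last (m + n)).castSucc.castSucc = Fin.natAdd (m + n) (0 : Fin 3) from rfl,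
      Fin.append_right]
    rfl
  Y_last := by
    rw [ElimData.append_ρ]
    simp only [pathData, pathY, Fin.snoc_last, stepData, Expr.rename]
    rw [show (Fin.last (m + n + 1)).castSucc = Fin.natAdd (m + n) (1 : Fin 3) from rfl,
      Fin.append_right]
    rfl
  U_last := by
    rw [ElimData.append_ρ]
    simp only [pathData, pathU, Fin.snoc_last, stepData, Expr.rename]
    rw [show Fin.last (m + n + 2) = Fin.natAdd (m + n) (2 : Fin 3) from rfl,
      Fin.append_right]
    rfl
  ρ := by
    rw [ElimData.append_ρ]
    funext i
    simp only [pathData, stepData, Function.comp_apply]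
    refine Fin.lastCases ?_ (fun i => ?_) i
    · refine (append_last _ _).trans ?_
      rw [Fin.snoc_last]
      exact (liftRen_one_last _).symm
    · refine (append_castSucc _ _ _).trans ?_
      rw [Fin.snoc_castSucc, liftRen_one_castSucc, Fin.append_left]
      refine Fin.addCases (fun i => ?_) (fun j => ?_) i
      · rw [Fin.append_left, liftRen_castAdd]
        exact Fin.append_left _ _ i
      · rw [Fin.append_right, liftRen_natAdd]
        exact Fin.append_right _ _ j

end PathCtx

/-! ### Elimination for identity contexts, and their well-formedness -/

section PathMor

variable {T : TypeTheory.{u}} {m l : ℕ}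

theorem wk_two_subst {S : Signature.{u}} (e : Expr S m) (σ : Sub S m l) (a b : Expr S l) :
    (e.wk 2).subst (Fin.snoc (α := fun _ => Expr S l)
      (Fin.snoc (α := fun _ => Expr S l) σ a) b) = e.subst σ := by
  rw [← wk_succ e 1, wk_subst_castSucc, wk_subst_castSucc]
  simp

theorem subst_append_var_wk {S : Signature.{u}} {k : ℕ} (A : Expr S (m + k)) (a : Sub S k m)
    (n : ℕ) : (A.subst (Fin.append Expr.var a)).wk n =
      A.subst (Fin.append (fun i => .var (Fin.castAdd n i)) fun i => (a i).wk n) := by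
  simp only [wk_eq_subst, subst_append_subst, var_subst]

/-- The context of paths and the identity contexts order the same data differently; this is the
dictionary between them. -/
theorem isMor_inter_iff {Δ : Ctx T.sig l} {Γ : Ctx T.sig m} {σ : Sub T.sig m l} :
    {n : ℕ} → {Φ : Tele T.sig m n} → {a b p : Sub T.sig n l} →
    (IsMor T Δ (pathCtx Γ Φ) (inter σ a b p) ↔ IsMor T Δ Γ σ ∧ IsElem T Δ (Φ.subst σ) a ∧
      IsElem T Δ (Φ.subst σ) b ∧ IsElem T Δ (idTele (Φ.subst σ) a b) p)
  | _, .nil, _, _, _ => by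
    simp only [pathCtx, inter, IsElem, Tele.subst, idTele, and_true]
    rfl
  | _, .snoc Φ A, a, b, p => by
    simp only [pathCtx, inter, snoc3, IsMor, IsElem, Tele.subst, idTele, Fin.snoc_castSucc,
      Fin.snoc_last, isMor_inter_iff (Φ := Φ), wk_subst_castSucc, id_subst, wk_two_subst,
      transport_subst, var_subst, subst_append_subst, inter_base, inter_X, inter_Y, inter_U,
      wk_subst_append, subst_var, subst_liftSub_append, Fin.append_right]
    tauto

theorem morEq_inter_iff {Δ : Ctx T.sig l} {Γ : Ctx T.sig m} {σ σ' : Sub T.sig m l} :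
    {n : ℕ} → {Φ : Tele T.sig m n} → {a b p a' b' p' : Sub T.sig n l} →
    (MorEq T Δ (pathCtx Γ Φ) (inter σ a b p) (inter σ' a' b' p') ↔
      MorEq T Δ Γ σ σ' ∧ ElemEq T Δ (Φ.subst σ) a a' ∧
      ElemEq T Δ (Φ.subst σ) b b' ∧ ElemEq T Δ (idTele (Φ.subst σ) a b) p p')
  | _, .nil, _, _, _, _, _, _ => by
    simp only [pathCtx, inter, ElemEq, Tele.subst, idTele, and_true]
    rfl
  | _, .snoc Φ A, a, b, p, a', b', p' => by
    simp only [pathCtx, inter, snoc3, MorEq, ElemEq, Tele.subst, idTele, Fin.snoc_castSucc,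
      Fin.snoc_last, morEq_inter_iff (Φ := Φ), wk_subst_castSucc, id_subst, wk_two_subst,
      transport_subst, var_subst, subst_append_subst, inter_base, inter_X, inter_Y, inter_U,
      wk_subst_append, subst_var, subst_liftSub_append, Fin.append_right]
    tauto

variable {n : ℕ}

theorem generic_path {Γ : Ctx T.sig m} {Φ : Tele T.sig m n} (h : IsCtx T (pathCtx Γ Φ)) :
    IsMor T (pathCtx Γ Φ) Γ (fun i => .var (pathBase m n i)) ∧
    IsElem T (pathCtx Γ Φ) (Φ.subst fun i => .var (pathBase m n i)) (fun i => .var (pathX m n i)) ∧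
    IsElem T (pathCtx Γ Φ) (Φ.subst fun i => .var (pathBase m n i)) (fun i => .var (pathY m n i)) ∧
    IsElem T (pathCtx Γ Φ) (idTele (Φ.subst fun i => .var (pathBase m n i))
      (fun i => .var (pathX m n i)) (fun i => .var (pathY m n i))) (fun i => .var (pathU m n i)) := by
  rw [← isMor_inter_iff, inter_var]
  exact isMor_var h

theorem pathData_snoc_J {S : Signature.{u}} (Γ : Ctx S m) (Φ : Tele S m n) (B : Expr S (plen m n)) :
    ((pathData Γ Φ).snoc B).J (.var (Fin.last (m + n))) =
      transport (fun i => (Expr.var (pathX m n i)).wk 1) (fun i => (Expr.var (pathY m n i)).wk 1)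
        (fun i => (Expr.var (pathU m n i)).wk 1) (.var (Fin.last (plen m n))) := by
  simp only [ElimData.J, ElimData.snoc, Expr.rename, Fin.snoc_last]
  rfl

/-- Transport is elimination into `A(y)` with one parameter `x ∈ A(x)`, where over the diagonal the
parameter itself is the given element. Its computation rule is `r_!(x) = x`. Elimination for `Φ` is
a hypothesis because this is used inside the induction that proves it. -/
theorem transport_generic {Γ : Ctx T.sig m} {Φ : Tele T.sig m n} {A : Expr T.sig (m + n)}
    (hwf : (pathData Γ Φ).WF) (hE : (pathData Γ Φ).Elim)
    (hA : Derivable T (Γ.append Φ) (.isType A)) :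
    Derivable T ((pathCtx Γ Φ).snoc
      (A.subst (Fin.append (fun i => .var (pathBase m n i)) fun i => .var (pathX m n i))))
      (.hasType (transport (fun i => (Expr.var (pathX m n i)).wk 1)
        (fun i => (Expr.var (pathY m n i)).wk 1) (fun i => (Expr.var (pathU m n i)).wk 1)
        (.var (Fin.last (plen m n)))) ((A.subst (Fin.append (fun i => .var (pathBase m n i))
          fun i => .var (pathY m n i))).wk 1)) ∧
    Derivable T ((Γ.append Φ).snoc A) (.eqTerm (transport (fun i => (Expr.var (Fin.natAdd m i)).wk 1)
      (fun i => (Expr.var (Fin.natAdd m i)).wk 1)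
      (fun i => (Expr.refl (.var (Fin.natAdd m i))).wk 1) (.var (Fin.last (m + n))))
      (.var (Fin.last (m + n))) (A.wk 1)) := by
  have hP : IsCtx T (pathCtx Γ Φ) := hwf.tgt
  obtain ⟨hσ, hX, hY, -⟩ := generic_path hP
  have hAX := hA.msubst hP (isMor_append_iff.2 ⟨hσ, hX⟩)
  have hAY := hA.msubst hP (isMor_append_iff.2 ⟨hσ, hY⟩)
  rw [Judgement.subst] at hAX hAY
  have eX := subst_X_pathDiag A
  have eY := subst_Y_pathDiag A
  -- From here on the two copies of `A` matter only through their restrictions along the diagonal.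
  generalize A.subst (Fin.append (fun i => Expr.var (pathBase m n i))
    fun i => .var (pathX m n i)) = AX at *
  generalize A.subst (Fin.append (fun i => Expr.var (pathBase m n i))
    fun i => .var (pathY m n i)) = AY at *
  have hAY₁ : Derivable T ((pathCtx Γ Φ).snoc AX) (.isType (AY.wk 1)) := hAY.wk hAX
  have eY₁ : (AY.wk 1).subst (liftSub (pathDiag m n) 1) = A.wk 1 := by
    rw [wk_subst_liftSub, eY]
  have hs := hE (.snoc AX .base) (AY.wk 1) (.var (Fin.last (m + n))) hAY₁
  rw [pathData_snoc_J] at hs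
  simp only [ElimData.snoc, pathData, eX, eY₁] at hs
  obtain ⟨ht, ht'⟩ := hs (.var hA)
  refine ⟨ht, ?_⟩
  simpa only [transport_subst, wk_subst_liftSub, var_subst, liftSub_one_last,
    pathDiag, inter_X, inter_Y, inter_U] using ht'

/-- The elimination principle for identity contexts. -/
theorem pathData_wf_elim {Γ : Ctx T.sig m} : {n : ℕ} → {Φ : Tele T.sig m n} →
    IsCtx T (Γ.append Φ) → (pathData Γ Φ).WF ∧ (pathData Γ Φ).Elim
  | _, .nil, h => by
    have hδ : (pathData Γ (.nil : Tele T.sig m 0)).δ = Expr.var := rfl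
    have hwf : (pathData Γ (.nil : Tele T.sig m 0)).WF := ⟨h, h, isMor_var h⟩
    refine ⟨hwf, fun N' M' E' hE => ?_⟩
    refine hE.eq_append ElimData.Sound fun k Θ => ?_
    intro C d hC hd
    -- For the empty context there is nothing to eliminate: the eliminator is `d`, and the diagonal
    -- is the identity.
    have hJ : ((pathData Γ (.nil : Tele T.sig m 0)).append Θ).J d = d := by
      refine (rename_eq_subst _ _).trans ?_
      rw [ElimData.append_ρ]
      refine Eq.trans (congrArg _ ?_) (subst_var d)
      funext i
      refine Fin.addCases (fun i => ?_) (fun j => ?_) i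
      · have hρ : (pathData Γ (.nil : Tele T.sig m 0)).ρ i = i :=
          congrFun (append_zero (fun i => Fin.castAdd 0 (pathBase m 0 i)) _) i
        refine congrArg Expr.var (a₂ := Fin.castAdd k i) ((Fin.append_left _ _ i).trans ?_)
        exact congrArg (liftRen (Fin.castAdd k) 0) hρ
      · refine congrArg _ ((Fin.append_right _ _ j).trans ?_)
        rfl
    rw [hJ]
    rw [ElimData.append_tgt, ElimData.append_src, ElimData.append_δ, hδ] at *
    have e : liftSub (S := T.sig) (n := m) (m := m) Expr.var k = Expr.var := liftSub_var m k
    have e₁ : d.subst (liftSub (S := T.sig) (n := m) (m := m) Expr.var k) = d := by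
      rw [e, subst_var]
    have e₂ : C.subst (liftSub (S := T.sig) (n := m) (m := m) Expr.var k) = C := by
      rw [e]
      exact subst_var C
    have e₃ : Θ.subst (Expr.var (S := T.sig) (n := m)) = Θ := Tele.subst_var Θ
    exact ⟨e₂ ▸ e₃ ▸ hd, e₁.symm ▸ hd.eqTerm_refl⟩
  | n + 1, .snoc Φ A, h => by
    obtain ⟨hwf, hE⟩ := pathData_wf_elim h.1
    have hP : IsCtx T (pathCtx Γ Φ) := hwf.tgt
    have hD : IsCtx T (Γ.append Φ) := h.1
    obtain ⟨hσ, hX, hY, -⟩ := generic_path hP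
    have hAX := h.2.msubst hP (isMor_append_iff.2 ⟨hσ, hX⟩)
    have hAY := h.2.msubst hP (isMor_append_iff.2 ⟨hσ, hY⟩)
    rw [Judgement.subst] at hAX hAY
    obtain ⟨ht, ht'⟩ := transport_generic hwf hE h.2
    have hlast : pathLast A = pathLast A := rfl
    conv_rhs at hlast => rw [pathLast]
    generalize A.subst (Fin.append (fun i => Expr.var (pathBase m n i))
      fun i => .var (pathX m n i)) = AX at *
    generalize A.subst (Fin.append (fun i => Expr.var (pathBase m n i))
      fun i => .var (pathY m n i)) = AY at *
    have hAY₁ : Derivable T ((pathCtx Γ Φ).snoc AX) (.isType (AY.wk 1)) := hAY.wk hAX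
    have hη := Derivable.var hAY₁
    rw [wk_succ] at hη
    have ht₂ : Derivable T (((pathCtx Γ Φ).snoc AX).snoc (AY.wk 1)) (.hasType
        (transport (fun i => (Expr.var (pathX m n i)).wk 2) (fun i => (Expr.var (pathY m n i)).wk 2)
          (fun i => (Expr.var (pathU m n i)).wk 2) (.var (Fin.last (plen m n)).castSucc))
        (AY.wk 2)) := by
      have := ht.wk hAY₁
      rw [← wk_succ AY 1]
      have e := transport_wk (k := 1) (fun i => (Expr.var (S := T.sig) (pathX m n i)).wk 1)
        (fun i => (Expr.var (pathY m n i)).wk 1)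
        (fun i => (Expr.var (pathU m n i)).wk 1) (.var (Fin.last (plen m n)))
      simp only [wk_succ] at e
      exact e ▸ this
    have hid := Derivable.id_form ht₂.presup_hasType ht₂ hη
    have hctx : IsCtx T ((pathCtx Γ Φ).append (pathLast A)) := by
      rw [hlast]
      exact ⟨⟨⟨hP, hAX⟩, hAY₁⟩, hid⟩
    have hA₁ : Derivable T ((Γ.append Φ).snoc A) (.isType (A.wk 1)) := h.2.wk h.2
    -- Here `r_!(x) = x` turns the type of the last path over the trivial path into `Id_A(x, y)`.
    have hW : Derivable T (((Γ.append Φ).snoc A).snoc (A.wk 1))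
        (.eqType (pathOver A) (idVar A)) := by
      have hη' := Derivable.var hA₁
      rw [wk_succ] at hη'
      have h₁ := ht'.wk hA₁
      refine Derivable.id_eq hη'.presup_hasType.eqType_refl ?_ hη'.eqTerm_refl
      have e := transport_wk (k := 1) (fun i => (Expr.var (S := T.sig) (Fin.natAdd m i)).wk 1)
        (fun i => (Expr.var (Fin.natAdd m i)).wk 1)
        (fun i => (Expr.refl (.var (Fin.natAdd m i))).wk 1) (.var (Fin.last (m + n)))
      simp only [wk_succ] at e
      rw [← wk_succ A 1]
      exact e ▸ h₁
    have hc := pathData_isComp Γ Φ A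
    have hw := hwf.append hctx
    exact ⟨hc.wf hw (stepData_wf hW), hc.elim (hE.append _) (stepData_elim hW) hw (stepData_wf hW)⟩

/-- The target is the context of paths for `(Φ, x ∈ A)` without its last variable; the type of that
variable can thus be instantiated at given endpoints. -/
theorem isMor_ends {Δ : Ctx T.sig l} {Γ : Ctx T.sig m} {Φ : Tele T.sig m n} {A : Expr T.sig (m + n)}
    {σ : Sub T.sig m l} {a b p : Sub T.sig n l} {α β : Expr T.sig l}
    (h : IsMor T Δ (pathCtx Γ Φ) (inter σ a b p))
    (hα : Derivable T Δ (.hasType α (A.subst (Fin.append σ a))))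
    (hβ : Derivable T Δ (.hasType β (A.subst (Fin.append σ b)))) :
    IsMor T Δ (((pathCtx Γ Φ).snoc
      (A.subst (Fin.append (fun i => .var (pathBase m n i)) fun i => .var (pathX m n i)))).snoc
        ((A.subst (Fin.append (fun i => .var (pathBase m n i))
          fun i => .var (pathY m n i))).wk 1))
      (Fin.snoc (α := fun _ => Expr T.sig l)
        (Fin.snoc (α := fun _ => Expr T.sig l) (inter σ a b p) α) β) := by
  simp only [IsMor, Fin.snoc_castSucc, Fin.snoc_last, wk_subst_castSucc, subst_append_subst,
    var_subst, inter_base, inter_X, inter_Y]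
  exact ⟨⟨h, hα⟩, hβ⟩

theorem isMor_inter_natAdd {Γ : Ctx T.sig m} {Φ : Tele T.sig m n} {a b : Sub T.sig n m}
    (h : IsCtx T (Γ.append (idTele Φ a b))) (ha : IsElem T Γ Φ a) (hb : IsElem T Γ Φ b) :
    IsMor T (Γ.append (idTele Φ a b)) (pathCtx Γ Φ) (inter (fun i => .var (Fin.castAdd n i))
      (fun i => (a i).wk n) (fun i => (b i).wk n) fun i => .var (Fin.natAdd m i)) := by
  have hu := isElem_natAdd h
  rw [idTele_wk] at hu
  exact isMor_inter_iff.2 ⟨isMor_castAdd h, ha.wk h, hb.wk h, hu⟩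

theorem Derivable.subst_append_wk {Γ : Ctx T.sig m} {Θ : Tele T.sig m n} {k : ℕ}
    (h : IsCtx T (Γ.append Θ)) {A : Expr T.sig (m + k)} {a : Sub T.sig k m} {e : Expr T.sig m}
    (he : Derivable T Γ (.hasType e (A.subst (Fin.append Expr.var a)))) :
    Derivable T (Γ.append Θ) (.hasType (e.wk n)
      (A.subst (Fin.append (fun i => .var (Fin.castAdd n i)) fun i => (a i).wk n))) := by
  have := he.msubst h (isMor_castAdd h)
  simpa only [Judgement.subst, subst_append_subst, var_subst, wk_eq_subst] using this

theorem Derivable.subst_append_wk_eq {Γ : Ctx T.sig m} {Θ : Tele T.sig m n} {k : ℕ}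
    (h : IsCtx T (Γ.append Θ)) {A : Expr T.sig (m + k)} {a : Sub T.sig k m} {e e' : Expr T.sig m}
    (he : Derivable T Γ (.eqTerm e e' (A.subst (Fin.append Expr.var a)))) :
    Derivable T (Γ.append Θ) (.eqTerm (e.wk n) (e'.wk n)
      (A.subst (Fin.append (fun i => .var (Fin.castAdd n i)) fun i => (a i).wk n))) := by
  have := he.msubst h (isMor_castAdd h)
  simpa only [Judgement.subst, subst_append_subst, var_subst, wk_eq_subst] using this

/-- Each type in an identity context is a substitution instance of one in the context of paths,
which is well-formed by the elimination principle. -/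
theorem isCtx_idTele {Γ : Ctx T.sig m} : {n : ℕ} → {Φ : Tele T.sig m n} → {a b : Sub T.sig n m} →
    IsCtx T (Γ.append Φ) → IsElem T Γ Φ a → IsElem T Γ Φ b →
    IsCtx T (Γ.append (idTele Φ a b))
  | _, .nil, _, _, h, _, _ => h
  | n + 1, .snoc Φ A, a, b, h, ha, hb => by
    have ih := isCtx_idTele h.1 ha.1 hb.1
    refine ⟨ih, ?_⟩
    have hp : IsCtx T (pathCtx Γ (Φ.snoc A)) := (pathData_wf_elim h).1.tgt
    have := hp.2.msubst ih (isMor_ends (isMor_inter_natAdd ih ha.1 hb.1)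
      (ha.2.subst_append_wk ih) (hb.2.subst_append_wk ih))
    simpa only [Judgement.subst, id_subst, wk_two_subst, transport_subst, var_subst,
      subst_append_subst, inter_base, inter_X, inter_Y, inter_U, Fin.snoc_castSucc, Fin.snoc_last,
      subst_append_var_wk] using this

/-- Substitution of two equal morphisms into the generic transport. -/
theorem transport_congr {Δ : Ctx T.sig l} {Γ : Ctx T.sig m} {Φ : Tele T.sig m n}
    {A : Expr T.sig (m + n)} {σ σ' : Sub T.sig m l} {a b p a' b' p' : Sub T.sig n l}
    {α α' : Expr T.sig l} (hA : Derivable T (Γ.append Φ) (.isType A)) (hΔ : IsCtx T Δ)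
    (h : MorEq T Δ (pathCtx Γ Φ) (inter σ a b p) (inter σ' a' b' p'))
    (hα : Derivable T Δ (.eqTerm α α' (A.subst (Fin.append σ a)))) :
    Derivable T Δ (.eqTerm (transport a b p α) (transport a' b' p' α')
      (A.subst (Fin.append σ b))) := by
  obtain ⟨hwf, hE⟩ := pathData_wf_elim hA.isCtx
  have ht := (transport_generic hwf hE hA).1
  have hm : MorEq T Δ ((pathCtx Γ Φ).snoc
      (A.subst (Fin.append (fun i => .var (pathBase m n i)) fun i => .var (pathX m n i))))
      (Fin.snoc (α := fun _ => Expr T.sig l) (inter σ a b p) α)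
      (Fin.snoc (α := fun _ => Expr T.sig l) (inter σ' a' b' p') α') := by
    simp only [MorEq, Fin.snoc_castSucc, Fin.snoc_last, subst_append_subst,
      var_subst, inter_base, inter_X]
    exact ⟨h, hα⟩
  have := hm.eqTerm hΔ ht
  simpa only [transport_subst, wk_subst_castSucc, Fin.snoc_castSucc, Fin.snoc_last, var_subst,
    inter_X, inter_Y, inter_U, subst_append_subst, inter_base] using this

/-- Identity contexts of definitionally equal contexts and elements. -/
theorem ctxEq_idTele {Γ : Ctx T.sig m} : {n : ℕ} → {Φ Φ' : Tele T.sig m n} →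
    {a b a' b' : Sub T.sig n m} → IsCtx T (Γ.append Φ) → CtxEq T (Γ.append Φ) (Γ.append Φ') →
    ElemEq T Γ Φ a a' → ElemEq T Γ Φ b b' →
    CtxEq T (Γ.append (idTele Φ a b)) (Γ.append (idTele Φ' a' b'))
  | _, .nil, .nil, _, _, _, _, h, e, _, _ => e
  | n + 1, .snoc Φ A, .snoc Φ' A', a, b, a', b', h, e, ha, hb => by
    have hΓ : IsCtx T Γ := h.1.of_append
    refine ⟨ctxEq_idTele h.1 e.1 ha.1 hb.1, ?_⟩
    have hi := isCtx_idTele h.1 (ha.1.left hΓ) (hb.1.left hΓ)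
    have hp : IsCtx T (pathCtx Γ (Φ.snoc A)) := (pathData_wf_elim h).1.tgt
    have hw : MorEq T (Γ.append (idTele Φ (fun i => a i.castSucc) fun i => b i.castSucc)) Γ
        (fun i => .var (Fin.castAdd n i)) (fun i => .var (Fin.castAdd n i)) :=
      MorEq.refl (isMor_castAdd hi)
    have ha' := ha.1.subst hΓ hi hw
    have hb' := hb.1.subst hΓ hi hw
    simp only [← wk_eq_subst] at ha' hb'
    have hu := isElem_natAdd hi
    rw [idTele_wk] at hu
    have hm := morEq_inter_iff.2 ⟨hw, ha', hb', ElemEq.refl hi hu⟩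
    have hb₂ := hb.2.subst_append_wk_eq hi
    have ht := transport_congr h.2 hi hm (ha.2.subst_append_wk_eq hi)
    -- The types are compared in two steps, from `A(b)` to `A(b')` and on to `A'(b')`.
    have hm' : MorEq T _ (Γ.append Φ) _ _ := morEq_append_iff.2 ⟨hw, hb'⟩
    have hA₁ := hm'.eqType hi h.2
    have hA₂ := e.2.msubst hi (isMor_append_iff.2 ⟨hw.isMor_left, hb'.right ?_⟩)
    · have := Derivable.id_eq (hA₁.eqType_trans hA₂) ht hb₂
      simpa only [subst_append_var_wk] using this
    · exact (hw.isMor_left.lift_append hi h.1).1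

end PathMor

/-! ### Path induction -/

section TeleElim

theorem Tele.subst_append_subst {S : Signature.{u}} {m k n l r : ℕ} (Θ : Tele S (m + k) r)
    (σ : Sub S m n) (a : Sub S k n) (τ : Sub S n l) :
    (Θ.subst (Fin.append σ a)).subst τ =
      Θ.subst (Fin.append (fun i => (σ i).subst τ) fun j => (a j).subst τ) := by
  rw [Tele.subst_subst, map_append (fun e => Expr.subst e τ)]

variable {T : TypeTheory.{u}} {m l n k N M : ℕ}

/-- The elimination principle with values in a dependent context. -/
theorem ElimData.Sound.elem {E : ElimData T.sig N M n} (hE : E.Sound) (hwf : E.WF) :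
    {k : ℕ} → {Ξ : Tele T.sig N k} → IsCtx T (E.tgt.append Ξ) → {d : Sub T.sig k M} →
    IsElem T E.src (Ξ.subst E.δ) d → IsElem T E.tgt Ξ (fun i => E.J (d i)) ∧
      ElemEq T E.src (Ξ.subst E.δ) (fun i => (E.J (d i)).subst E.δ) d
  | _, .nil, _, _, _ => ⟨trivial, trivial⟩
  | k + 1, .snoc Ξ A, hΞ, d, hd => by
    obtain ⟨h₁, h₂⟩ := hE.elem hwf hΞ.1 hd.1
    have hC := hΞ.2.msubst hwf.tgt ((isElem_iff hwf.tgt).1 h₁)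
    have hA := hΞ.2.msubst (hwf.δ.lift_append hwf.src hΞ.1).1 (hwf.δ.lift_append hwf.src hΞ.1).2
    -- The last component is wanted in `A` at the restricted eliminators, and given in `A` at `d`;
    -- by the computation rule for the earlier components these types are equal.
    have e := ((elemEq_iff hwf.src).1 h₂).eqType hwf.src hA
    have eC : (A.subst (Fin.append Expr.var fun i => E.J (d i.castSucc))).subst E.δ =
        (A.subst (liftSub E.δ k)).subst
          (Fin.append Expr.var fun i => (E.J (d i.castSucc)).subst E.δ) := by
      simp only [subst_append_subst, subst_liftSub_append, var_subst, subst_var]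
    obtain ⟨h₃, h₄⟩ := hE _ (d (Fin.last k)) hC (eC ▸ hd.2.conv e.eqType_symm)
    exact ⟨⟨h₁, h₃⟩, h₂, eC ▸ h₄⟩

theorem inter_pathDiag {S : Signature.{u}} (σ : Sub S m l) (a : Sub S n l) :
    (fun i => (pathDiag m n i).subst (Fin.append σ a)) = inter σ a a (pathRefl a) := by
  simp only [pathDiag, inter_subst, var_subst, refl_subst, Fin.append_left, Fin.append_right]
  rfl

/-- The type of each component is an identity type from a transport along trivial paths, not
literally `Id(a_i, a_i)`. The conversion is contained in the fact that the diagonal is a context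
morphism. -/
theorem pathRefl_isElem {Γ : Ctx T.sig m} {Φ : Tele T.sig m n} {a : Sub T.sig n m}
    (h : IsCtx T (Γ.append Φ)) (ha : IsElem T Γ Φ a) :
    IsElem T Γ (idTele Φ a a) (pathRefl a) := by
  have hδ := (pathData_wf_elim h).1.δ
  have := IsMor.comp h.of_append ((isElem_iff h.of_append).1 ha) hδ
  have e := inter_pathDiag Expr.var a
  have h' : IsMor T Γ (pathCtx Γ Φ) (inter Expr.var a a (pathRefl a)) := e ▸ this
  rw [isMor_inter_iff, Tele.subst_var] at h'
  exact h'.2.2.2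

/-- Definitional equality implies homotopy, by conversion of the identity context. -/
theorem pathRefl_isElem_of_eq {Γ : Ctx T.sig m} {Φ : Tele T.sig m n} {a b : Sub T.sig n m}
    (h : IsCtx T (Γ.append Φ)) (hab : ElemEq T Γ Φ a b) :
    IsElem T Γ (idTele Φ a b) (pathRefl a) := by
  have ha := hab.left h.of_append
  exact (pathRefl_isElem h ha).conv h.of_append
    (ctxEq_idTele h (CtxEq.refl h) (ElemEq.refl h.of_append ha) hab)

theorem pathRefl_congr {Γ : Ctx T.sig m} {Φ : Tele T.sig m n} {a b : Sub T.sig n m}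
    (h : IsCtx T (Γ.append Φ)) (hab : ElemEq T Γ Φ a b) :
    ElemEq T Γ (idTele Φ a a) (pathRefl a) (pathRefl b) := by
  have hΦ' := isCtx_wk h h
  have := (ElemEq.refl h (pathRefl_isElem hΦ' (isElem_natAdd h))).subst h h.of_append
    ((elemEq_iff h.of_append).1 hab)
  simp only [idTele_subst, Tele.wk_subst_append, Tele.subst_var, var_subst, Fin.append_right,
    pathRefl, refl_subst] at this
  exact this

/-- Two families of elements over the context of paths that agree on trivial paths are homotopic. -/
theorem homotopy_of_diag {E : ElimData T.sig N M n} (hE : E.Sound) (hwf : E.WF)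
    {Ψ : Tele T.sig N k} (hΨ : IsCtx T (E.tgt.append Ψ)) {s t : Sub T.sig k N}
    (hs : IsElem T E.tgt Ψ s) (ht : IsElem T E.tgt Ψ t)
    (h : ElemEq T E.src (Ψ.subst E.δ) (fun i => (s i).subst E.δ) (fun i => (t i).subst E.δ)) :
    ∃ w, IsElem T E.tgt (idTele Ψ s t) w := by
  have hΨ' := (hwf.δ.lift_append hwf.src hΨ).1
  have hd := pathRefl_isElem_of_eq hΨ' h
  rw [← idTele_subst] at hd
  exact ⟨_, (hE.elem hwf (isCtx_idTele hΨ hs ht) hd).1⟩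

/-- The homotopy is constructed over the generic path and then specialized by substitution. -/
theorem path_induction {Γ : Ctx T.sig m} {Φ : Tele T.sig m n}
    (hΦ : IsCtx T (Γ.append Φ)) {Ψ : Tele T.sig (plen m n) k}
    (hΨ : IsCtx T ((pathCtx Γ Φ).append Ψ)) {s t : Sub T.sig k (plen m n)}
    (hs : IsElem T (pathCtx Γ Φ) Ψ s) (ht : IsElem T (pathCtx Γ Φ) Ψ t)
    (h : ElemEq T (Γ.append Φ) (Ψ.subst (pathDiag m n)) (fun i => (s i).subst (pathDiag m n))
      (fun i => (t i).subst (pathDiag m n)))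
    {a b p : Sub T.sig n m} (ha : IsElem T Γ Φ a) (hb : IsElem T Γ Φ b)
    (hp : IsElem T Γ (idTele Φ a b) p) :
    ∃ w, IsElem T Γ (idTele (Ψ.subst (inter Expr.var a b p))
      (fun i => (s i).subst (inter Expr.var a b p))
      (fun i => (t i).subst (inter Expr.var a b p))) w := by
  obtain ⟨hwf, hE⟩ := pathData_wf_elim hΦ
  obtain ⟨w, hw⟩ := homotopy_of_diag (hE .base) hwf hΨ hs ht h
  have hm : IsMor T Γ (pathCtx Γ Φ) (inter Expr.var a b p) := by
    rw [isMor_inter_iff, Tele.subst_var]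
    exact ⟨isMor_var hΦ.of_append, ha, hb, hp⟩
  have := hw.subst hwf.tgt hΦ.of_append hm
  rw [idTele_subst] at this
  exact ⟨_, this⟩

/-- Path induction with parameters `θ` in a context `Θ` that may depend on the endpoints and on the
path. It serves laws with a second path that ends where the generic one starts. -/
theorem path_induction_append {Γ : Ctx T.sig m} {Φ : Tele T.sig m n}
    (hΦ : IsCtx T (Γ.append Φ)) {r : ℕ} {Θ : Tele T.sig (plen m n) r}
    (hΘ : IsCtx T ((pathCtx Γ Φ).append Θ)) {Ψ : Tele T.sig (plen m n + r) k}
    (hΨ : IsCtx T (((pathCtx Γ Φ).append Θ).append Ψ)) {s t : Sub T.sig k (plen m n + r)}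
    (hs : IsElem T ((pathCtx Γ Φ).append Θ) Ψ s) (ht : IsElem T ((pathCtx Γ Φ).append Θ) Ψ t)
    (h : IsCtx T ((Γ.append Φ).append (Θ.subst (pathDiag m n))) →
      ElemEq T ((Γ.append Φ).append (Θ.subst (pathDiag m n)))
      (Ψ.subst (liftSub (pathDiag m n) r)) (fun i => (s i).subst (liftSub (pathDiag m n) r))
      (fun i => (t i).subst (liftSub (pathDiag m n) r)))
    {a b p : Sub T.sig n m} {θ : Sub T.sig r m} (ha : IsElem T Γ Φ a) (hb : IsElem T Γ Φ b)
    (hp : IsElem T Γ (idTele Φ a b) p) (hθ : IsElem T Γ (Θ.subst (inter Expr.var a b p)) θ) :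
    ∃ w, IsElem T Γ (idTele (Ψ.subst (Fin.append (inter Expr.var a b p) θ))
      (fun i => (s i).subst (Fin.append (inter Expr.var a b p) θ))
      (fun i => (t i).subst (Fin.append (inter Expr.var a b p) θ))) w := by
  obtain ⟨hwf, hE⟩ := pathData_wf_elim hΦ
  have hwf' := hwf.append hΘ
  have hE' := hE ((pathData Γ Φ).extends_append Θ)
  have eδ : ((pathData Γ Φ).append Θ).δ = liftSub (pathDiag m n) r := ElimData.append_δ _ _
  have et : ((pathData Γ Φ).append Θ).tgt = (pathCtx Γ Φ).append Θ := ElimData.append_tgt _ _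
  have es : ((pathData Γ Φ).append Θ).src = (Γ.append Φ).append (Θ.subst (pathDiag m n)) :=
    ElimData.append_src _ _
  obtain ⟨w, hw⟩ := homotopy_of_diag hE' hwf' (et ▸ hΨ) (et ▸ hs) (et ▸ ht)
    (by rw [eδ, es]; exact h (es ▸ hwf'.src))
  rw [et] at hw
  have hm : IsMor T Γ (pathCtx Γ Φ) (inter Expr.var a b p) := by
    rw [isMor_inter_iff, Tele.subst_var]
    exact ⟨isMor_var hΦ.of_append, ha, hb, hp⟩
  have := hw.subst hΘ hΦ.of_append (isMor_append_iff.2 ⟨hm, hθ⟩)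
  rw [idTele_subst] at this
  exact ⟨_, this⟩

end TeleElim

/-! ### Operations on paths under substitution; transport of sequences -/

section Operations

variable {S : Signature.{u}} {m l n k : ℕ}

/-- The image of the path `p` under a dependent context morphism `f`. -/
def relMap (f : Sub S k (m + n)) (a b p : Sub S n m) : Sub S k m :=
  fun i => ctxJ n a b p (.refl (f i))

theorem pathRefl_subst (σ : Sub S m l) (a : Sub S n m) :
    (fun i => (pathRefl a i).subst σ) = pathRefl fun i => (a i).subst σ := rfl

theorem pathComp_subst (σ : Sub S m l) (b c p q : Sub S n m) :
    (fun i => (pathComp b c p q i).subst σ) = pathComp (fun i => (b i).subst σ)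
      (fun i => (c i).subst σ) (fun i => (p i).subst σ) (fun i => (q i).subst σ) := by
  funext i
  exact transport_subst σ b c q (p i)

theorem pathInv_subst (σ : Sub S m l) (a b p : Sub S n m) :
    (fun i => (pathInv a b p i).subst σ) = pathInv (fun i => (a i).subst σ)
      (fun i => (b i).subst σ) (fun i => (p i).subst σ) := by
  funext i
  simp only [pathInv, ctxJ_subst, refl_subst, var_subst, liftSub_natAdd]

theorem relMap_subst (σ : Sub S m l) (f : Sub S k (m + n)) (a b p : Sub S n m) :
    (fun i => (relMap f a b p i).subst σ) = relMap (fun i => (f i).subst (liftSub σ n))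
      (fun i => (a i).subst σ) (fun i => (b i).subst σ) (fun i => (p i).subst σ) := by
  funext i
  simp only [relMap, ctxJ_subst, refl_subst]

variable {T : TypeTheory.{u}}

/-- Transport in a family of contexts is the eliminator with the transported sequence as parameter,
and with its variables as the element over the diagonal. -/
theorem transport_var_isElem {Γ : Ctx T.sig m} {Φ : Tele T.sig m n} {Ω : Tele T.sig (m + n) k}
    (hΩ : IsCtx T ((Γ.append Φ).append Ω)) :
    IsElem T ((pathCtx Γ Φ).append
      (Ω.subst (Fin.append (fun i => .var (pathBase m n i)) fun i => .var (pathX m n i))))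
      ((Ω.subst (Fin.append (fun i => .var (pathBase m n i)) fun i => .var (pathY m n i))).wk k)
      (fun j => transport (fun i => (Expr.var (pathX m n i)).wk k)
        (fun i => (Expr.var (pathY m n i)).wk k) (fun i => (Expr.var (pathU m n i)).wk k)
        (.var (Fin.natAdd (plen m n) j))) ∧
    ElemEq T ((Γ.append Φ).append Ω) (Ω.wk k)
      (fun j => transport (fun i => (Expr.var (Fin.natAdd m i)).wk k)
        (fun i => (Expr.var (Fin.natAdd m i)).wk k)
        (fun i => (Expr.refl (.var (Fin.natAdd m i))).wk k) (.var (Fin.natAdd (m + n) j)))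
      (fun j => .var (Fin.natAdd (m + n) j)) := by
  obtain ⟨hwf, hE⟩ := pathData_wf_elim hΩ.of_append
  obtain ⟨hσ, hX, hY, -⟩ := generic_path hwf.tgt
  have hAX := ((isMor_append_iff.2 ⟨hσ, hX⟩).lift_append hwf.tgt hΩ).1
  have hAY := ((isMor_append_iff.2 ⟨hσ, hY⟩).lift_append hwf.tgt hΩ).1
  have eX : (Ω.subst (Fin.append (fun i => .var (pathBase m n i)) fun i =>
      .var (pathX m n i))).subst (pathDiag m n) = Ω := by
    rw [Tele.subst_append_subst]
    simp only [pathDiag, var_subst, inter_base, inter_X]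
    rw [append_eta, Tele.subst_var]
  have eY : (Ω.subst (Fin.append (fun i => .var (pathBase m n i)) fun i =>
      .var (pathY m n i))).subst (pathDiag m n) = Ω := by
    rw [Tele.subst_append_subst]
    simp only [pathDiag, var_subst, inter_base, inter_Y]
    rw [append_eta, Tele.subst_var]
  generalize Ω.subst (Fin.append (fun i => Expr.var (pathBase m n i))
    fun i => .var (pathX m n i)) = AX at *
  generalize Ω.subst (Fin.append (fun i => Expr.var (pathBase m n i))
    fun i => .var (pathY m n i)) = AY at *
  have hc := isCtx_wk hAX hAY
  have hs := ElimData.Sound.elem (hE ((pathData Γ Φ).extends_append AX)) (hwf.append hAX)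
    (Ξ := AY.wk k) (by rw [ElimData.append_tgt]; exact hc)
    (d := fun j => .var (Fin.natAdd (m + n) j))
  have hJ : ∀ j : Fin k, ((pathData Γ Φ).append AX).J (.var (Fin.natAdd (m + n) j)) =
      transport (fun i => (Expr.var (pathX m n i)).wk k)
        (fun i => (Expr.var (pathY m n i)).wk k) (fun i => (Expr.var (pathU m n i)).wk k)
        (.var (Fin.natAdd (plen m n) j)) := by
    intro j
    rw [ElimData.J, ElimData.append_X, ElimData.append_Y, ElimData.append_U, ElimData.append_ρ,
      Expr.rename, Fin.append_right]
    rfl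
  simp only [hJ] at hs
  rw [ElimData.append_tgt, ElimData.append_src, ElimData.append_δ] at hs
  have e₁ : ∀ Θ : Tele T.sig (plen m n) k, Θ.subst (pathData Γ Φ).δ = Θ.subst (pathDiag m n) :=
    fun _ => rfl
  simp only [Tele.wk_subst_liftSub, e₁, eX, eY, transport_subst, wk_subst_liftSub, var_subst,
    liftSub_natAdd] at hs
  simp only [pathData, pathDiag, inter_X, inter_Y, inter_U] at hs
  exact hs (isElem_natAdd hΩ)

theorem transport_elemEq {Γ : Ctx T.sig m} {Φ : Tele T.sig m n} {Ω : Tele T.sig (m + n) k}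
    (hΩ : IsCtx T ((Γ.append Φ).append Ω)) {Δ : Ctx T.sig l} (hΔ : IsCtx T Δ)
    {σ σ' : Sub T.sig m l} {a b p a' b' p' : Sub T.sig n l} {e e' : Sub T.sig k l}
    (h : MorEq T Δ (pathCtx Γ Φ) (inter σ a b p) (inter σ' a' b' p'))
    (he : ElemEq T Δ (Ω.subst (Fin.append σ a)) e e') :
    ElemEq T Δ (Ω.subst (Fin.append σ b)) (fun j => transport a b p (e j))
      (fun j => transport a' b' p' (e' j)) := by
  have h₀ := (transport_var_isElem hΩ).1
  obtain ⟨hwf, -⟩ := pathData_wf_elim hΩ.of_append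
  obtain ⟨hσ, hX, -, -⟩ := generic_path hwf.tgt
  have hAX := ((isMor_append_iff.2 ⟨hσ, hX⟩).lift_append hwf.tgt hΩ).1
  have := (ElemEq.refl hAX h₀).subst hAX hΔ (morEq_append_iff.2 ⟨h, (?_ : ElemEq T Δ _ e e')⟩)
  · simp only [Tele.wk_subst_append, Tele.subst_append_subst,
      var_subst, inter_base, inter_X, inter_Y, inter_U, transport_subst, wk_subst_append,
      Fin.append_right] at this
    exact this
  · simp only [Tele.subst_append_subst, var_subst, inter_base, inter_X]
    exact he

theorem transport_refl {Γ : Ctx T.sig m} {Φ : Tele T.sig m n} {Ω : Tele T.sig (m + n) k}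
    (hΩ : IsCtx T ((Γ.append Φ).append Ω)) {a : Sub T.sig n m} {e : Sub T.sig k m}
    (ha : IsElem T Γ Φ a) (he : IsElem T Γ (Ω.subst (Fin.append Expr.var a)) e) :
    ElemEq T Γ (Ω.subst (Fin.append Expr.var a)) (fun j => transport a a (pathRefl a) (e j)) e := by
  have hΓ : IsCtx T Γ := hΩ.of_append.of_append
  have := (transport_var_isElem hΩ).2.subst hΩ hΓ
    (MorEq.refl (isMor_append_iff.2 ⟨(isElem_iff hΓ).1 ha, he⟩))
  simp only [Tele.wk_subst_append, transport_subst, wk_subst_append, var_subst, refl_subst,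
    Fin.append_right] at this
  exact this

end Operations

/-! ### Typing and computation rules of the operations -/

section Typing

variable {T : TypeTheory.{u}} {m l n k : ℕ} {Γ : Ctx T.sig m} {Φ : Tele T.sig m n}

theorem pathComp_elemEq (h : IsCtx T (Γ.append Φ)) {a b c p q b' c' p' q' : Sub T.sig n m}
    (ha : IsElem T Γ Φ a) (hb : ElemEq T Γ Φ b b') (hc : ElemEq T Γ Φ c c')
    (hp : ElemEq T Γ (idTele Φ a b) p p') (hq : ElemEq T Γ (idTele Φ b c) q q') :
    ElemEq T Γ (idTele Φ a c) (pathComp b c p q) (pathComp b' c' p' q') := by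
  have hΓ : IsCtx T Γ := h.of_append
  -- The composite is the transport of `p` along `q` in the family `y ↦ Id_Φ(a, y)`.
  have hΩ := isCtx_idTele (isCtx_wk h h) (ha.wk h) (isElem_natAdd h)
  have hm : MorEq T Γ (pathCtx Γ Φ) (inter Expr.var b c q) (inter Expr.var b' c' q') := by
    rw [morEq_inter_iff, Tele.subst_var]
    exact ⟨MorEq.refl (isMor_var hΓ), hb, hc, hq⟩
  have := transport_elemEq hΩ hΓ (e := p) (e' := p') hm
  simp only [idTele_subst, Tele.wk_subst_append, wk_subst_append, Tele.subst_var, subst_var,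
    var_subst, Fin.append_right] at this
  exact this hp

theorem pathComp_isElem (h : IsCtx T (Γ.append Φ)) {a b c p q : Sub T.sig n m}
    (ha : IsElem T Γ Φ a) (hb : IsElem T Γ Φ b) (hc : IsElem T Γ Φ c)
    (hp : IsElem T Γ (idTele Φ a b) p) (hq : IsElem T Γ (idTele Φ b c) q) :
    IsElem T Γ (idTele Φ a c) (pathComp b c p q) :=
  have hΓ : IsCtx T Γ := h.of_append
  (pathComp_elemEq h ha (.refl hΓ hb) (.refl hΓ hc) (.refl hΓ hp) (.refl hΓ hq)).left hΓ

/-- This unit law is the computation rule of transport and needs no homotopy; it is the base of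
every path induction on a composite. -/
theorem pathComp_refl (h : IsCtx T (Γ.append Φ)) {a b p : Sub T.sig n m}
    (ha : IsElem T Γ Φ a) (hb : IsElem T Γ Φ b) (hp : IsElem T Γ (idTele Φ a b) p) :
    ElemEq T Γ (idTele Φ a b) (pathComp b b p (pathRefl b)) p := by
  have hΩ := isCtx_idTele (isCtx_wk h h) (ha.wk h) (isElem_natAdd h)
  have := transport_refl hΩ (e := p) hb
  simp only [idTele_subst, Tele.wk_subst_append, wk_subst_append, Tele.subst_var, subst_var,
    var_subst, Fin.append_right] at this
  exact this hp

/-- Elimination into the family of paths from `y` to `x`, given by `r(x)` on the diagonal. -/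
theorem pathInv_generic (h : IsCtx T (Γ.append Φ)) :
    IsElem T (pathCtx Γ Φ) (idTele (Φ.subst fun i => .var (pathBase m n i))
      (fun i => .var (pathY m n i)) (fun i => .var (pathX m n i)))
      (pathInv (fun i => .var (pathX m n i)) (fun i => .var (pathY m n i))
        (fun i => .var (pathU m n i))) ∧
    ElemEq T (Γ.append Φ) (idTele (Φ.wk n) (fun i => .var (Fin.natAdd m i))
      (fun i => .var (Fin.natAdd m i)))
      (pathInv (fun i => .var (Fin.natAdd m i)) (fun i => .var (Fin.natAdd m i))
        (pathRefl fun i => .var (Fin.natAdd m i))) (pathRefl fun i => .var (Fin.natAdd m i)) := by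
  obtain ⟨hwf, hE⟩ := pathData_wf_elim h
  obtain ⟨hσ, hX, hY, -⟩ := generic_path hwf.tgt
  have hΦ' := (hσ.lift_append hwf.tgt h).1
  have hs := ElimData.Sound.elem (hE .base) hwf (isCtx_idTele hΦ' hY hX)
    (d := pathRefl fun i => .var (Fin.natAdd m i))
  have hJ : (fun j : Fin n => (pathData Γ Φ).J (pathRefl (fun i => .var (Fin.natAdd m i)) j)) =
      pathInv (fun i => .var (pathX m n i)) (fun i => .var (pathY m n i))
        (fun i => .var (pathU m n i)) := by
    funext j
    simp only [ElimData.J, pathData, pathRefl, Expr.rename, Fin.append_right]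
    rfl
  have hJ' := congrArg (fun a => fun i => (a i : Expr T.sig _).subst (pathDiag m n)) hJ
  rw [pathInv_subst] at hJ'
  have e : (pathData Γ Φ).δ = pathDiag m n := rfl
  rw [hJ, e, hJ', idTele_subst, Tele.subst_subst] at hs
  simp only [var_subst, pathDiag, inter_base, inter_X, inter_Y, inter_U] at hs
  exact hs (pathRefl_isElem (isCtx_wk h h) (isElem_natAdd h))

theorem pathInv_elemEq (h : IsCtx T (Γ.append Φ)) {a b p a' b' p' : Sub T.sig n m}
    (ha : ElemEq T Γ Φ a a') (hb : ElemEq T Γ Φ b b')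
    (hp : ElemEq T Γ (idTele Φ a b) p p') :
    ElemEq T Γ (idTele Φ b a) (pathInv a b p) (pathInv a' b' p') := by
  have hΓ : IsCtx T Γ := h.of_append
  have hm : MorEq T Γ (pathCtx Γ Φ) (inter Expr.var a b p) (inter Expr.var a' b' p') := by
    rw [morEq_inter_iff, Tele.subst_var]
    exact ⟨MorEq.refl (isMor_var hΓ), ha, hb, hp⟩
  have hP := (pathData_wf_elim h).1.tgt
  have := (ElemEq.refl hP (pathInv_generic h).1).subst hP hΓ hm
  simp only [idTele_subst, Tele.subst_subst, pathInv_subst, var_subst, inter_base, inter_X,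
    inter_Y, inter_U, Tele.subst_var] at this
  exact this

theorem pathInv_isElem (h : IsCtx T (Γ.append Φ)) {a b p : Sub T.sig n m}
    (ha : IsElem T Γ Φ a) (hb : IsElem T Γ Φ b) (hp : IsElem T Γ (idTele Φ a b) p) :
    IsElem T Γ (idTele Φ b a) (pathInv a b p) :=
  have hΓ : IsCtx T Γ := h.of_append
  (pathInv_elemEq h (.refl hΓ ha) (.refl hΓ hb) (.refl hΓ hp)).left hΓ

theorem pathInv_refl (h : IsCtx T (Γ.append Φ)) {a : Sub T.sig n m} (ha : IsElem T Γ Φ a) :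
    ElemEq T Γ (idTele Φ a a) (pathInv a a (pathRefl a)) (pathRefl a) := by
  have hΓ : IsCtx T Γ := h.of_append
  have := (pathInv_generic h).2.subst h hΓ (MorEq.refl ((isElem_iff hΓ).1 ha))
  simp only [idTele_subst, Tele.wk_subst_append, pathInv_subst, pathRefl_subst, var_subst,
    Fin.append_right, Tele.subst_var] at this
  exact this

/-- Elimination into the family of paths from `f(x)` to `f(y)`, given by `r(f(x))` on the diagonal.
The renaming makes the variables of `Φ` in `f` the ones that `J` binds. -/
theorem relMap_generic (h : IsCtx T (Γ.append Φ)) {Ψ : Tele T.sig m k}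
    (hΨ : IsCtx T (Γ.append Ψ)) {f : Sub T.sig k (m + n)}
    (hf : IsElem T (Γ.append Φ) (Ψ.wk n) f) :
    IsElem T (pathCtx Γ Φ) (idTele (Ψ.subst fun i => .var (pathBase m n i))
      (fun i => (f i).subst
        (Fin.append (fun i => .var (pathBase m n i)) fun i => .var (pathX m n i)))
      (fun i => (f i).subst
        (Fin.append (fun i => .var (pathBase m n i)) fun i => .var (pathY m n i))))
      (relMap (fun i => (f i).rename (pathData Γ Φ).ρ) (fun i => .var (pathX m n i))
        (fun i => .var (pathY m n i)) (fun i => .var (pathU m n i))) ∧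
    ElemEq T (Γ.append Φ) (idTele (Ψ.wk n) f f)
      (fun i => (relMap (fun i => (f i).rename (pathData Γ Φ).ρ) (fun i => .var (pathX m n i))
        (fun i => .var (pathY m n i)) (fun i => .var (pathU m n i)) i).subst (pathDiag m n))
      (pathRefl f) := by
  obtain ⟨hwf, hE⟩ := pathData_wf_elim h
  obtain ⟨hσ, hX, hY, -⟩ := generic_path hwf.tgt
  have hΨ' := (hσ.lift_append hwf.tgt hΨ).1
  have hfX := hf.subst h hwf.tgt (isMor_append_iff.2 ⟨hσ, hX⟩)
  have hfY := hf.subst h hwf.tgt (isMor_append_iff.2 ⟨hσ, hY⟩)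
  rw [Tele.wk_subst_append] at hfX hfY
  have hs := ElimData.Sound.elem (hE .base) hwf (isCtx_idTele hΨ' hfX hfY) (d := pathRefl f)
  have e : (pathData Γ Φ).δ = pathDiag m n := rfl
  rw [e, idTele_subst, Tele.subst_subst] at hs
  simp only [subst_X_pathDiag, subst_Y_pathDiag, var_subst] at hs
  simp only [pathDiag, inter_base] at hs
  exact hs (pathRefl_isElem (isCtx_wk h hΨ) hf)

/-- The bound argument sees the base variables and the bound ones only, so the path substituted for
the generic one disappears from it. -/
theorem rename_pathData_ρ_subst {S : Signature.{u}} (Γ : Ctx S m) (Φ : Tele S m n)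
    (e : Expr S (m + n)) (σ : Sub S m l) (a b p : Sub S n l) :
    (e.rename (pathData Γ Φ).ρ).subst (liftSub (inter σ a b p) n) = e.subst (liftSub σ n) := by
  rw [rename_subst]
  congr 1
  funext i
  refine Fin.addCases (fun i => ?_) (fun j => ?_) i <;> simp [pathData]

theorem relMap_elemEq (h : IsCtx T (Γ.append Φ)) {Ψ : Tele T.sig m k}
    (hΨ : IsCtx T (Γ.append Ψ)) {f : Sub T.sig k (m + n)}
    (hf : IsElem T (Γ.append Φ) (Ψ.wk n) f) {a b p a' b' p' : Sub T.sig n m}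
    (ha : ElemEq T Γ Φ a a') (hb : ElemEq T Γ Φ b b')
    (hp : ElemEq T Γ (idTele Φ a b) p p') :
    ElemEq T Γ (idTele Ψ (fun i => (f i).subst (Fin.append Expr.var a))
      (fun i => (f i).subst (Fin.append Expr.var b))) (relMap f a b p) (relMap f a' b' p') := by
  have hΓ : IsCtx T Γ := h.of_append
  have hm : MorEq T Γ (pathCtx Γ Φ) (inter Expr.var a b p) (inter Expr.var a' b' p') := by
    rw [morEq_inter_iff, Tele.subst_var]
    exact ⟨MorEq.refl (isMor_var hΓ), ha, hb, hp⟩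
  have hP := (pathData_wf_elim h).1.tgt
  have := (ElemEq.refl hP (relMap_generic h hΨ hf).1).subst hP hΓ hm
  simp only [idTele_subst, Tele.subst_subst, relMap_subst, rename_pathData_ρ_subst,
    subst_append_subst, var_subst, inter_base, inter_X, inter_Y, inter_U, Tele.subst_var,
    liftSub_var, subst_var] at this
  exact this

theorem relMap_isElem (h : IsCtx T (Γ.append Φ)) {Ψ : Tele T.sig m k}
    (hΨ : IsCtx T (Γ.append Ψ)) {f : Sub T.sig k (m + n)}
    (hf : IsElem T (Γ.append Φ) (Ψ.wk n) f) {a b p : Sub T.sig n m}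
    (ha : IsElem T Γ Φ a) (hb : IsElem T Γ Φ b) (hp : IsElem T Γ (idTele Φ a b) p) :
    IsElem T Γ (idTele Ψ (fun i => (f i).subst (Fin.append Expr.var a))
      (fun i => (f i).subst (Fin.append Expr.var b))) (relMap f a b p) :=
  have hΓ : IsCtx T Γ := h.of_append
  (relMap_elemEq h hΨ hf (.refl hΓ ha) (.refl hΓ hb) (.refl hΓ hp)).left hΓ

theorem relMap_refl (h : IsCtx T (Γ.append Φ)) {Ψ : Tele T.sig m k}
    (hΨ : IsCtx T (Γ.append Ψ)) {f : Sub T.sig k (m + n)}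
    (hf : IsElem T (Γ.append Φ) (Ψ.wk n) f) {a : Sub T.sig n m} (ha : IsElem T Γ Φ a) :
    ElemEq T Γ (idTele Ψ (fun i => (f i).subst (Fin.append Expr.var a))
      (fun i => (f i).subst (Fin.append Expr.var a))) (relMap f a a (pathRefl a))
      (pathRefl fun i => (f i).subst (Fin.append Expr.var a)) := by
  have hΓ : IsCtx T Γ := h.of_append
  have := (relMap_generic h hΨ hf).2.subst h hΓ (MorEq.refl ((isElem_iff hΓ).1 ha))
  simp only [subst_subst, inter_pathDiag] at this
  simp only [idTele_subst, Tele.wk_subst_append, relMap_subst, rename_pathData_ρ_subst,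
    pathRefl_subst, var_subst, inter_X, inter_Y, inter_U, Tele.subst_var,
    liftSub_var, subst_var] at this
  exact this

/-- The image of an element under a dependent context morphism. -/
theorem IsElem.app (h : IsCtx T (Γ.append Φ)) {Ψ : Tele T.sig m k} {f : Sub T.sig k (m + n)}
    (hf : IsElem T (Γ.append Φ) (Ψ.wk n) f) {a : Sub T.sig n m} (ha : IsElem T Γ Φ a) :
    IsElem T Γ Ψ fun i => (f i).subst (Fin.append Expr.var a) := by
  have := hf.subst h h.of_append ((isElem_iff h.of_append).1 ha)
  rwa [Tele.wk_subst_append, Tele.subst_var] at this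

theorem ElemEq.app (h : IsCtx T (Γ.append Φ)) {Ψ : Tele T.sig m k} {f g : Sub T.sig k (m + n)}
    (hf : ElemEq T (Γ.append Φ) (Ψ.wk n) f g) {a b : Sub T.sig n m} (ha : ElemEq T Γ Φ a b) :
    ElemEq T Γ Ψ (fun i => (f i).subst (Fin.append Expr.var a))
      (fun i => (g i).subst (Fin.append Expr.var b)) := by
  have := hf.subst h h.of_append ((elemEq_iff h.of_append).1 ha)
  rwa [Tele.wk_subst_append, Tele.subst_var] at this

theorem IsElem.lift (h : IsCtx T (Γ.append Φ)) {Ψ : Tele T.sig m k} {f : Sub T.sig k (m + n)}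
    (hf : IsElem T (Γ.append Φ) (Ψ.wk n) f) {Δ : Ctx T.sig l} {σ : Sub T.sig m l}
    (hΔ : IsCtx T Δ) (hσ : IsMor T Δ Γ σ) :
    IsElem T (Δ.append (Φ.subst σ)) ((Ψ.subst σ).wk n) fun i => (f i).subst (liftSub σ n) := by
  obtain ⟨h₁, h₂⟩ := hσ.lift_append hΔ h
  have := hf.subst h h₁ h₂
  rwa [Tele.wk_subst_liftSub] at this

end Typing

/-! ### Groupoid laws and preservation of composites -/

section Laws

theorem append_subst {S : Signature.{u}} {m k n l : ℕ} (σ : Sub S m n) (a : Sub S k n)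
    (τ : Sub S n l) : (fun i => (Fin.append σ a i).subst τ) =
      Fin.append (fun i => (σ i).subst τ) fun j => (a j).subst τ :=
  map_append (fun e => Expr.subst e τ) σ a

variable {T : TypeTheory.{u}} {m l n k : ℕ} {Γ : Ctx T.sig m} {Φ : Tele T.sig m n}

/-- Unlike the other unit law, this one needs induction on `p`; for trivial `p` it becomes an
instance of `pathComp_refl`. -/
theorem pathComp_refl_left (h : IsCtx T (Γ.append Φ)) {a b p : Sub T.sig n m}
    (ha : IsElem T Γ Φ a) (hb : IsElem T Γ Φ b) (hp : IsElem T Γ (idTele Φ a b) p) :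
    ∃ w, IsElem T Γ (idTele (idTele Φ a b) (pathComp a b (pathRefl a) p) p) w := by
  have hP := (pathData_wf_elim h).1.tgt
  obtain ⟨hσ, hX, hY, hU⟩ := generic_path hP
  have hΦ := (hσ.lift_append hP h).1
  have hr := pathRefl_isElem hΦ hX
  have := path_induction h (isCtx_idTele hΦ hX hY) (pathComp_isElem hΦ hX hX hY hr hU) hU ?_ ha hb hp
  · simp only [idTele_subst, Tele.subst_subst, pathComp_subst, pathRefl_subst, var_subst,
      inter_base, inter_X, inter_Y, inter_U, Tele.subst_var] at this
    exact this
  · simp only [idTele_subst, Tele.subst_subst, pathComp_subst, pathRefl_subst, var_subst, pathDiag,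
      inter_base, inter_X, inter_Y, inter_U]
    have hx := isElem_natAdd h
    have hΦ' := isCtx_wk h h
    exact pathComp_refl hΦ' hx hx (pathRefl_isElem hΦ' hx)

/-- By induction on `p`: a trivial path is definitionally its own inverse and its own square. -/
theorem pathComp_inv_left (h : IsCtx T (Γ.append Φ)) {a b p : Sub T.sig n m}
    (ha : IsElem T Γ Φ a) (hb : IsElem T Γ Φ b) (hp : IsElem T Γ (idTele Φ a b) p) :
    ∃ w, IsElem T Γ (idTele (idTele Φ b b) (pathComp a b (pathInv a b p) p) (pathRefl b)) w := by
  have hP := (pathData_wf_elim h).1.tgt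
  obtain ⟨hσ, hX, hY, hU⟩ := generic_path hP
  have hΦ := (hσ.lift_append hP h).1
  have := path_induction h (isCtx_idTele hΦ hY hY)
    (pathComp_isElem hΦ hY hX hY (pathInv_isElem hΦ hX hY hU) hU) (pathRefl_isElem hΦ hY) ?_ ha hb hp
  · simp only [idTele_subst, Tele.subst_subst, pathComp_subst, pathInv_subst, pathRefl_subst,
      var_subst, inter_base, inter_X, inter_Y, inter_U, Tele.subst_var] at this
    exact this
  · simp only [idTele_subst, Tele.subst_subst, pathComp_subst, pathInv_subst, pathRefl_subst,
      var_subst, pathDiag, inter_base, inter_X, inter_Y, inter_U]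
    have hx := isElem_natAdd h
    have hΦ' := isCtx_wk h h
    have hr := pathRefl_isElem hΦ' hx
    have hxx := isCtx_idTele hΦ' hx hx
    exact (pathComp_elemEq hΦ' hx (.refl h hx) (.refl h hx) (pathInv_refl hΦ' hx) (.refl h hr)).trans
      hxx (pathComp_refl hΦ' hx hx hr)

theorem pathComp_inv_right (h : IsCtx T (Γ.append Φ)) {a b p : Sub T.sig n m}
    (ha : IsElem T Γ Φ a) (hb : IsElem T Γ Φ b) (hp : IsElem T Γ (idTele Φ a b) p) :
    ∃ w, IsElem T Γ (idTele (idTele Φ a a) (pathComp b a p (pathInv a b p)) (pathRefl a)) w := by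
  have hP := (pathData_wf_elim h).1.tgt
  obtain ⟨hσ, hX, hY, hU⟩ := generic_path hP
  have hΦ := (hσ.lift_append hP h).1
  have := path_induction h (isCtx_idTele hΦ hX hX)
    (pathComp_isElem hΦ hX hY hX hU (pathInv_isElem hΦ hX hY hU)) (pathRefl_isElem hΦ hX) ?_ ha hb hp
  · simp only [idTele_subst, Tele.subst_subst, pathComp_subst, pathInv_subst, pathRefl_subst,
      var_subst, inter_base, inter_X, inter_Y, inter_U, Tele.subst_var] at this
    exact this
  · simp only [idTele_subst, Tele.subst_subst, pathComp_subst, pathInv_subst, pathRefl_subst,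
      var_subst, pathDiag, inter_base, inter_X, inter_Y, inter_U]
    have hx := isElem_natAdd h
    have hΦ' := isCtx_wk h h
    have hr := pathRefl_isElem hΦ' hx
    have hxx := isCtx_idTele hΦ' hx hx
    exact (pathComp_elemEq hΦ' hx (.refl h hx) (.refl h hx) (.refl h hr) (pathInv_refl hΦ' hx)).trans
      hxx (pathComp_refl hΦ' hx hx hr)

/-- The context of paths extended by the paths from `b` to the source of the generic path. -/
theorem isCtx_paths_to (h : IsCtx T (Γ.append Φ)) {b : Sub T.sig n m} (hb : IsElem T Γ Φ b) :
    IsCtx T ((pathCtx Γ Φ).append (idTele (Φ.subst fun i => .var (pathBase m n i))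
      (fun i => (b i).subst fun i => .var (pathBase m n i)) (fun i => .var (pathX m n i)))) := by
  have hP := (pathData_wf_elim h).1.tgt
  obtain ⟨hσ, hX, -, -⟩ := generic_path hP
  exact isCtx_idTele (hσ.lift_append hP h).1 (hb.subst h.of_append hP hσ) hX

/-- Induction on `r`. Its source is the target of `q`, so `q` varies along with it as a parameter,
while `a`, `b` and `p` stay fixed. For trivial `r` both sides are definitionally `q_!(p)`. -/
theorem pathComp_assoc (h : IsCtx T (Γ.append Φ)) {a b c d p q r : Sub T.sig n m}
    (ha : IsElem T Γ Φ a) (hb : IsElem T Γ Φ b) (hc : IsElem T Γ Φ c) (hd : IsElem T Γ Φ d)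
    (hp : IsElem T Γ (idTele Φ a b) p) (hq : IsElem T Γ (idTele Φ b c) q)
    (hr : IsElem T Γ (idTele Φ c d) r) :
    ∃ w, IsElem T Γ (idTele (idTele Φ a d) (pathComp c d (pathComp b c p q) r)
      (pathComp b d p (pathComp c d q r))) w := by
  have hΓ : IsCtx T Γ := h.of_append
  have hP := (pathData_wf_elim h).1.tgt
  obtain ⟨hσ, hX, hY, hU⟩ := generic_path hP
  have hΦ := (hσ.lift_append hP h).1
  have hΘ := isCtx_paths_to h hb
  have hΦ' := isCtx_wk hΘ hΦ
  have ha' := (ha.subst hΓ hP hσ).wk hΘ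
  have hb' := (hb.subst hΓ hP hσ).wk hΘ
  have hp' := (hp.subst hΓ hP hσ).wk hΘ
  rw [idTele_subst, idTele_wk] at hp'
  have hX' := hX.wk hΘ
  have hY' := hY.wk hΘ
  have hU' := hU.wk hΘ
  rw [idTele_wk] at hU'
  have hq' := isElem_natAdd hΘ
  rw [idTele_wk] at hq'
  have := path_induction_append h hΘ (isCtx_idTele hΦ' ha' hY')
    (pathComp_isElem hΦ' ha' hX' hY' (pathComp_isElem hΦ' ha' hb' hX' hp' hq') hU')
    (pathComp_isElem hΦ' ha' hb' hY' hp' (pathComp_isElem hΦ' hb' hX' hY' hq' hU'))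
    (fun hD => ?_) (θ := q) hc hd hr ?_
  · simp only [idTele_subst, Tele.subst_subst, pathComp_subst, wk_subst_append, Tele.wk_subst_append,
      subst_subst, Fin.append_right,
      var_subst, inter_base, inter_X, inter_Y, inter_U, Tele.subst_var, subst_var] at this
    exact this
  -- Over the diagonal, the parameter `q` becomes a path from `b` to the generic element `x`.
  · have e : (idTele (Φ.subst fun i => .var (pathBase m n i))
        (fun i => (b i).subst fun i => .var (pathBase m n i)) (fun i => .var (pathX m n i))).subst
        (pathDiag m n) = idTele (Φ.wk n) (fun i => (b i).wk n) (fun i => .var (Fin.natAdd m i)) := by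
      simp only [idTele_subst, Tele.subst_subst, subst_subst, var_subst, pathDiag, inter_base,
        inter_X, Tele.wk, wk_eq_subst]
    rw [e] at hD ⊢
    simp only [idTele_subst, pathComp_subst, wk_subst_liftSub, Tele.wk_subst_liftSub,
      Tele.subst_subst, subst_subst, var_subst, liftSub_natAdd]
    simp only [pathDiag, inter_base, inter_X, inter_Y, inter_U]
    simp only [← wk_eq_subst]
    have hx := (isElem_natAdd h).wk hD
    have hΦ₂ := isCtx_wk hD (isCtx_wk h h)
    have ha₂ := (ha.wk h).wk hD
    have hb₂ := (hb.wk h).wk hD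
    have hp₂ := (hp.wk h).wk hD
    have hq₂ := isElem_natAdd hD
    rw [idTele_wk] at hq₂
    rw [idTele_wk, idTele_wk] at hp₂
    have hc₂ := isCtx_idTele hΦ₂ ha₂ hx
    have e₁ := pathComp_refl hΦ₂ ha₂ hx (pathComp_isElem hΦ₂ ha₂ hb₂ hx hp₂ hq₂)
    have e₂ := pathComp_elemEq hΦ₂ ha₂ (.refl hD hb₂) (.refl hD hx) (.refl hD hp₂)
      (pathComp_refl hΦ₂ hb₂ hx hq₂)
    exact e₁.trans hc₂ (e₂.symm hc₂)
  · simp only [idTele_subst, Tele.subst_subst, subst_subst, var_subst, inter_base, inter_X,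
      Tele.subst_var, subst_var]
    exact hq

/-- The base case of `relMap_comp`: both sides are definitionally `f(p)`, as `r(x)_!(p) = p` and
`f(r(x)) = r(f(x))`. -/
theorem relMap_comp_refl (h : IsCtx T (Γ.append Φ)) {Ψ : Tele T.sig m k}
    (hΨ : IsCtx T (Γ.append Ψ)) {f : Sub T.sig k (m + n)}
    (hf : IsElem T (Γ.append Φ) (Ψ.wk n) f) {a x p : Sub T.sig n m}
    (ha : IsElem T Γ Φ a) (hx : IsElem T Γ Φ x) (hp : IsElem T Γ (idTele Φ a x) p) :
    ElemEq T Γ (idTele Ψ (fun i => (f i).subst (Fin.append Expr.var a))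
      (fun i => (f i).subst (Fin.append Expr.var x))) (relMap f a x (pathComp x x p (pathRefl x)))
      (pathComp (fun i => (f i).subst (Fin.append Expr.var x))
        (fun i => (f i).subst (Fin.append Expr.var x)) (relMap f a x p)
        (relMap f x x (pathRefl x))) := by
  have hΓ : IsCtx T Γ := h.of_append
  have hfa := hf.app h ha
  have hfx := hf.app h hx
  have hc := isCtx_idTele hΨ hfa hfx
  have hθ := relMap_isElem h hΨ hf ha hx hp
  have e₁ := relMap_elemEq h hΨ hf (.refl hΓ ha) (.refl hΓ hx) (pathComp_refl h ha hx hp)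
  have e₂ := pathComp_elemEq hΨ hfa (.refl hΓ hfx) (.refl hΓ hfx) (.refl hΓ hθ)
    (relMap_refl h hΨ hf hx)
  have e₃ := pathComp_refl hΨ hfa hfx hθ
  exact e₁.trans hc ((e₂.trans hc e₃).symm hc)

/-- Induction on `q`, with `p` as a parameter because its target is the source of `q`. -/
theorem relMap_comp (h : IsCtx T (Γ.append Φ)) {Ψ : Tele T.sig m k}
    (hΨ : IsCtx T (Γ.append Ψ)) {f : Sub T.sig k (m + n)}
    (hf : IsElem T (Γ.append Φ) (Ψ.wk n) f) {a b c p q : Sub T.sig n m}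
    (ha : IsElem T Γ Φ a) (hb : IsElem T Γ Φ b) (hc : IsElem T Γ Φ c)
    (hp : IsElem T Γ (idTele Φ a b) p) (hq : IsElem T Γ (idTele Φ b c) q) :
    ∃ w, IsElem T Γ (idTele (idTele Ψ (fun i => (f i).subst (Fin.append Expr.var a))
      (fun i => (f i).subst (Fin.append Expr.var c))) (relMap f a c (pathComp b c p q))
      (pathComp (fun i => (f i).subst (Fin.append Expr.var b))
        (fun i => (f i).subst (Fin.append Expr.var c)) (relMap f a b p) (relMap f b c q))) w := by
  have hΓ : IsCtx T Γ := h.of_append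
  have hP := (pathData_wf_elim h).1.tgt
  obtain ⟨hσ, hX, hY, hU⟩ := generic_path hP
  have hΘ := isCtx_paths_to h ha
  have hσ' := hσ.wk_append hΘ
  have hΦ' := (hσ'.lift_append hΘ h).1
  have hΨ' := (hσ'.lift_append hΘ hΨ).1
  have ha' := ha.subst hΓ hΘ hσ'
  have hf' := hf.lift h hΘ hσ'
  have hX' := hX.wk hΘ
  have hY' := hY.wk hΘ
  have hU' := hU.wk hΘ
  rw [idTele_wk] at hU'
  have hp' := isElem_natAdd hΘ
  rw [idTele_wk] at hp'
  simp only [Tele.subst_wk, subst_wk'] at hX' hY' hU' hp'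
  have hfa := hf'.app hΦ' ha'
  have hfX := hf'.app hΦ' hX'
  have hfY := hf'.app hΦ' hY'
  have := path_induction_append h hΘ (isCtx_idTele hΨ' hfa hfY)
    (relMap_isElem hΦ' hΨ' hf' ha' hY' (pathComp_isElem hΦ' ha' hX' hY' hp' hU'))
    (pathComp_isElem hΨ' hfa hfX hfY
      (relMap_isElem hΦ' hΨ' hf' ha' hX' hp') (relMap_isElem hΦ' hΨ' hf' hX' hY' hU'))
    (fun hD => ?_) (θ := p) hb hc hq ?_
  · simp only [idTele_subst, Tele.subst_subst, pathComp_subst, relMap_subst, wk_subst_append,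
      append_subst, subst_subst, Fin.append_right, liftSub_append, liftSub_comp,
      var_subst, inter_base, inter_X, inter_Y, inter_U, Tele.subst_var, subst_var,
      liftSub_var] at this
    exact this
  · have e : (idTele (Φ.subst fun i => .var (pathBase m n i))
        (fun i => (a i).subst fun i => .var (pathBase m n i)) (fun i => .var (pathX m n i))).subst
        (pathDiag m n) = idTele (Φ.wk n) (fun i => (a i).wk n) (fun i => .var (Fin.natAdd m i)) := by
      simp only [idTele_subst, Tele.subst_subst, subst_subst, var_subst, pathDiag, inter_base,
        inter_X, Tele.wk, wk_eq_subst]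
    rw [e] at hD ⊢
    have hσ₂ := (isMor_castAdd h).wk_append hD
    have hΦ₂ := (hσ₂.lift_append hD h).1
    have hΨ₂ := (hσ₂.lift_append hD hΨ).1
    have ha₂ := ha.subst hΓ hD hσ₂
    have hf₂ := hf.lift h hD hσ₂
    have hx := (isElem_natAdd h).wk hD
    have hp₂ := isElem_natAdd hD
    have e₁ : (Φ.wk n).wk n = Φ.subst fun i => (Expr.var (Fin.castAdd n i)).wk n :=
      Tele.subst_wk _ _ _
    have e₂ : (fun i => ((a i).wk n).wk n) =
        fun i => (a i).subst fun i => (Expr.var (Fin.castAdd n i)).wk n := by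
      funext i
      rw [wk_eq_subst (a i), subst_wk']
    rw [idTele_wk, e₂, e₁] at hp₂
    rw [e₁] at hx
    have := relMap_comp_refl hΦ₂ hΨ₂ hf₂ ha₂ hx hp₂
    simp only [idTele_subst, Tele.subst_subst, pathComp_subst, relMap_subst, subst_subst,
      append_subst, liftSub_append, liftSub_comp, var_subst, refl_subst, liftSub_castAdd,
      liftSub_natAdd, pathDiag, inter_base, inter_X, inter_Y, inter_U, Tele.wk, wk_eq_subst,
      subst_var] at this ⊢
    exact this
  · simp only [idTele_subst, Tele.subst_subst, subst_subst, var_subst, inter_base, inter_X,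
      Tele.subst_var, subst_var]
    exact hp

end Laws

/-! ### Composites, identities and equality of context morphisms acting on paths -/

section Functoriality

variable {T : TypeTheory.{u}} {m l n k r : ℕ} {Γ : Ctx T.sig m} {Φ : Tele T.sig m n}
  {Ψ : Tele T.sig m k} {Ξ : Tele T.sig m r}

/-- The composite of dependent context morphisms. -/
def relComp {S : Signature.{u}} (g : Sub S r (m + k)) (f : Sub S k (m + n)) : Sub S r (m + n) :=
  fun i => (g i).subst (Fin.append (fun i => .var (Fin.castAdd n i)) f)

theorem relComp_isElem (h : IsCtx T (Γ.append Φ)) (hΨ : IsCtx T (Γ.append Ψ))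
    {f : Sub T.sig k (m + n)} (hf : IsElem T (Γ.append Φ) (Ψ.wk n) f)
    {g : Sub T.sig r (m + k)} (hg : IsElem T (Γ.append Ψ) (Ξ.wk k) g) :
    IsElem T (Γ.append Φ) (Ξ.wk n) (relComp g f) := by
  have := (hg.lift hΨ h (isMor_castAdd h)).app (isCtx_wk h hΨ) hf
  simp only [subst_liftSub_append, var_subst] at this
  exact this

theorem relComp_app {S : Signature.{u}} (g : Sub S r (m + k)) (f : Sub S k (m + n))
    (a : Sub S n m) : (fun i => (relComp g f i).subst (Fin.append Expr.var a)) =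
      fun i => (g i).subst (Fin.append Expr.var fun i => (f i).subst (Fin.append Expr.var a)) := by
  funext i
  rw [relComp, subst_append_subst]
  simp only [var_subst, Fin.append_left]

theorem relComp_lift {S : Signature.{u}} (g : Sub S r (m + k)) (f : Sub S k (m + n))
    (σ : Sub S m l) : (fun i => (relComp g f i).subst (liftSub σ n)) =
      relComp (fun i => (g i).subst (liftSub σ k)) fun i => (f i).subst (liftSub σ n) := by
  funext i
  rw [relComp, relComp, subst_append_subst, subst_liftSub_append]
  simp only [var_subst, liftSub_castAdd, wk_eq_subst]

/-- On trivial paths, `g(f(r(a))) = g(r(f(a))) = r(g(f(a)))`, and the composite sends `r(a)` to the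
same path. -/
theorem relMap_relMap_refl (h : IsCtx T (Γ.append Φ)) (hΨ : IsCtx T (Γ.append Ψ))
    (hΞ : IsCtx T (Γ.append Ξ))
    {f : Sub T.sig k (m + n)} (hf : IsElem T (Γ.append Φ) (Ψ.wk n) f)
    {g : Sub T.sig r (m + k)} (hg : IsElem T (Γ.append Ψ) (Ξ.wk k) g)
    {a : Sub T.sig n m} (ha : IsElem T Γ Φ a) :
    ElemEq T Γ (idTele Ξ (fun i => (relComp g f i).subst (Fin.append Expr.var a))
      (fun i => (relComp g f i).subst (Fin.append Expr.var a)))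
      (relMap g (fun i => (f i).subst (Fin.append Expr.var a))
        (fun i => (f i).subst (Fin.append Expr.var a)) (relMap f a a (pathRefl a)))
      (relMap (relComp g f) a a (pathRefl a)) := by
  have hΓ : IsCtx T Γ := h.of_append
  have hgf := relComp_isElem h hΨ hf hg
  have hc := isCtx_idTele hΞ (hgf.app h ha) (hgf.app h ha)
  have hfa := hf.app h ha
  have e₁ := relMap_elemEq hΨ hΞ hg (.refl hΓ hfa) (.refl hΓ hfa) (relMap_refl h hΨ hf ha)
  have e₂ := relMap_refl hΨ hΞ hg hfa
  have e₃ := relMap_refl h hΞ hgf ha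
  rw [relComp_app] at hc e₃ ⊢
  exact (e₁.trans hc e₂).trans hc (e₃.symm hc)

theorem relMap_relMap (h : IsCtx T (Γ.append Φ)) (hΨ : IsCtx T (Γ.append Ψ))
    (hΞ : IsCtx T (Γ.append Ξ))
    {f : Sub T.sig k (m + n)} (hf : IsElem T (Γ.append Φ) (Ψ.wk n) f)
    {g : Sub T.sig r (m + k)} (hg : IsElem T (Γ.append Ψ) (Ξ.wk k) g)
    {a b p : Sub T.sig n m} (ha : IsElem T Γ Φ a) (hb : IsElem T Γ Φ b)
    (hp : IsElem T Γ (idTele Φ a b) p) :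
    ∃ w, IsElem T Γ (idTele
      (idTele Ξ (fun i => (relComp g f i).subst (Fin.append Expr.var a))
        (fun i => (relComp g f i).subst (Fin.append Expr.var b)))
      (relMap g (fun i => (f i).subst (Fin.append Expr.var a))
        (fun i => (f i).subst (Fin.append Expr.var b)) (relMap f a b p))
      (relMap (relComp g f) a b p)) w := by
  have hP := (pathData_wf_elim h).1.tgt
  obtain ⟨hσ, hX, hY, hU⟩ := generic_path hP
  have hΦ' := (hσ.lift_append hP h).1
  have hΨ' := (hσ.lift_append hP hΨ).1
  have hΞ' := (hσ.lift_append hP hΞ).1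
  have hf' := hf.lift h hP hσ
  have hg' := hg.lift hΨ hP hσ
  have hgf' := relComp_isElem hΦ' hΨ' hf' hg'
  have hr := relMap_isElem hΨ' hΞ' hg' (hf'.app hΦ' hX) (hf'.app hΦ' hY)
    (relMap_isElem hΦ' hΨ' hf' hX hY hU)
  rw [← relComp_app, ← relComp_app] at hr
  have := path_induction h (isCtx_idTele hΞ' (hgf'.app hΦ' hX) (hgf'.app hΦ' hY)) hr
    (relMap_isElem hΦ' hΞ' hgf' hX hY hU) ?_ ha hb hp
  · simp only [← relComp_lift, idTele_subst, Tele.subst_subst, relMap_subst, subst_subst,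
      append_subst, liftSub_append, liftSub_comp, var_subst, inter_base, inter_X, inter_Y, inter_U,
      Tele.subst_var, subst_var, liftSub_var] at this
    exact this
  · have hσ₂ := isMor_castAdd (Θ := Φ) h
    have := relMap_relMap_refl (isCtx_wk h h) (isCtx_wk h hΨ) (isCtx_wk h hΞ)
      (hf.lift h h hσ₂) (hg.lift hΨ h hσ₂) (isElem_natAdd h)
    simp only [← relComp_lift, idTele_subst, Tele.subst_subst, relMap_subst, subst_subst,
      append_subst, liftSub_append, liftSub_comp, var_subst, pathDiag, inter_base, inter_X,
      inter_Y, inter_U, Tele.wk, subst_var] at this ⊢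
    exact this

/-- By path induction: the image of `p` under the identity morphism and `p` itself both become
`r(x)` on the diagonal. -/
theorem relMap_var (h : IsCtx T (Γ.append Φ)) {a b p : Sub T.sig n m} (ha : IsElem T Γ Φ a)
    (hb : IsElem T Γ Φ b) (hp : IsElem T Γ (idTele Φ a b) p) :
    ∃ w, IsElem T Γ (idTele (idTele Φ a b)
      (relMap (fun i => .var (Fin.natAdd m i)) a b p) p) w := by
  have hP := (pathData_wf_elim h).1.tgt
  obtain ⟨hσ, hX, hY, hU⟩ := generic_path hP
  have hΦ' := (hσ.lift_append hP h).1
  have hr := relMap_isElem hΦ' hΦ' (isElem_natAdd hΦ') hX hY hU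
  simp only [var_subst, Fin.append_right] at hr
  have := path_induction h (isCtx_idTele hΦ' hX hY) hr hU ?_ ha hb hp
  · simp only [idTele_subst, Tele.subst_subst, relMap_subst, var_subst, inter_base, inter_X,
      inter_Y, inter_U, Tele.subst_var, liftSub_natAdd] at this
    exact this
  · have hΦ₂ := isCtx_wk h h
    have := relMap_refl hΦ₂ hΦ₂ (isElem_natAdd hΦ₂) (isElem_natAdd h)
    simp only [idTele_subst, Tele.subst_subst, relMap_subst, var_subst, pathDiag, inter_base,
      inter_X, inter_Y, inter_U, Tele.wk, liftSub_natAdd, Fin.append_right] at this ⊢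
    exact this

theorem relMap_congr_refl (h : IsCtx T (Γ.append Φ)) (hΨ : IsCtx T (Γ.append Ψ))
    {f g : Sub T.sig k (m + n)} (hfg : ElemEq T (Γ.append Φ) (Ψ.wk n) f g)
    {a : Sub T.sig n m} (ha : IsElem T Γ Φ a) :
    ElemEq T Γ (idTele Ψ (fun i => (f i).subst (Fin.append Expr.var a))
      (fun i => (f i).subst (Fin.append Expr.var a)))
      (relMap f a a (pathRefl a)) (relMap g a a (pathRefl a)) := by
  have hΓ : IsCtx T Γ := h.of_append
  have hf := hfg.left h
  have hg := hfg.right (isCtx_wk h hΨ)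
  have e := hfg.app h (ElemEq.refl hΓ ha)
  have hc := isCtx_idTele hΨ (hf.app h ha) (hf.app h ha)
  have hc' := isCtx_idTele hΨ (hg.app h ha) (hg.app h ha)
  have e₂ := (relMap_refl h hΨ hg ha).conv hΓ
    (CtxEq.symm hc' (ctxEq_idTele hΨ (CtxEq.refl hΨ) e e))
  exact (relMap_refl h hΨ hf ha).trans hc ((pathRefl_congr hΨ e).trans hc (e₂.symm hc))

/-- On trivial paths the images are `r(f(x))` and `r(g(x))`, which are definitionally equal; path
induction does the rest. -/
theorem relMap_congr (h : IsCtx T (Γ.append Φ)) (hΨ : IsCtx T (Γ.append Ψ))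
    {f g : Sub T.sig k (m + n)} (hfg : ElemEq T (Γ.append Φ) (Ψ.wk n) f g)
    {a b p : Sub T.sig n m} (ha : IsElem T Γ Φ a) (hb : IsElem T Γ Φ b)
    (hp : IsElem T Γ (idTele Φ a b) p) :
    ∃ w, IsElem T Γ (idTele (idTele Ψ (fun i => (f i).subst (Fin.append Expr.var a))
      (fun i => (f i).subst (Fin.append Expr.var b))) (relMap f a b p) (relMap g a b p)) w := by
  have hP := (pathData_wf_elim h).1.tgt
  obtain ⟨hσ, hX, hY, hU⟩ := generic_path hP
  have hΦ' := (hσ.lift_append hP h).1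
  have hΨ' := (hσ.lift_append hP hΨ).1
  have hl := hσ.lift_append hP h
  have hfg' := hfg.subst h hl.1 (MorEq.refl hl.2)
  rw [Tele.wk_subst_liftSub] at hfg'
  have hf' := hfg'.left hl.1
  have hg' := hfg'.right (isCtx_wk hΦ' hΨ')
  have hc := isCtx_idTele hΨ' (hf'.app hΦ' hX) (hf'.app hΦ' hY)
  have hc' := isCtx_idTele hΨ' (hg'.app hΦ' hX) (hg'.app hΦ' hY)
  -- The image under `g` is first converted to a path between the endpoints given by `f`, so that
  -- both images inhabit one identity context.
  have hr := (relMap_isElem hΦ' hΨ' hg' hX hY hU).conv hP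
    (CtxEq.symm hc' (ctxEq_idTele hΨ' (CtxEq.refl hΨ') (hfg'.app hΦ' (.refl hP hX))
      (hfg'.app hΦ' (.refl hP hY))))
  have := path_induction h hc (relMap_isElem hΦ' hΨ' hf' hX hY hU) hr ?_ ha hb hp
  · simp only [idTele_subst, Tele.subst_subst, relMap_subst, subst_subst,
      append_subst, liftSub_append, liftSub_comp, var_subst, inter_base, inter_X, inter_Y, inter_U,
      Tele.subst_var, subst_var, liftSub_var] at this
    exact this
  · have hσ₂ := isMor_castAdd (Θ := Φ) h
    have hl₂ := hσ₂.lift_append h h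
    have hfg₂ := hfg.subst h hl₂.1 (MorEq.refl hl₂.2)
    rw [Tele.wk_subst_liftSub] at hfg₂
    have := relMap_congr_refl (isCtx_wk h h) (isCtx_wk h hΨ) hfg₂ (isElem_natAdd h)
    simp only [idTele_subst, Tele.subst_subst, relMap_subst, subst_subst,
      append_subst, liftSub_append, liftSub_comp, var_subst, pathDiag, inter_base, inter_X,
      inter_Y, inter_U, Tele.wk, subst_var] at this ⊢
    exact this

end Functoriality

/-! ### Homotopy as an equivalence relation and a congruence -/

section Homotopy

variable {T : TypeTheory.{u}} {m l n k r : ℕ} {Γ : Ctx T.sig m} {Φ : Tele T.sig m n}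

/-- There is a homotopy between `p` and `q`, for elements `p` and `q` of `Φ`. -/
def Htpy (T : TypeTheory.{u}) (Γ : Ctx T.sig m) (Φ : Tele T.sig m n) (p q : Sub T.sig n m) : Prop :=
  ∃ w, IsElem T Γ (idTele Φ p q) w

theorem Htpy.of_eq (h : IsCtx T (Γ.append Φ)) {p q : Sub T.sig n m} (e : ElemEq T Γ Φ p q) :
    Htpy T Γ Φ p q :=
  ⟨_, pathRefl_isElem_of_eq h e⟩

/-- A homotopy is a path in `Φ`, so it can be inverted. In the application, `Φ` is itself an
identity context. -/
theorem Htpy.symm (h : IsCtx T (Γ.append Φ)) {p q : Sub T.sig n m} (hp : IsElem T Γ Φ p)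
    (hq : IsElem T Γ Φ q) : Htpy T Γ Φ p q → Htpy T Γ Φ q p
  | ⟨_, hw⟩ => ⟨_, pathInv_isElem h hp hq hw⟩

theorem Htpy.trans (h : IsCtx T (Γ.append Φ)) {p q s : Sub T.sig n m} (hp : IsElem T Γ Φ p)
    (hq : IsElem T Γ Φ q) (hs : IsElem T Γ Φ s) : Htpy T Γ Φ p q → Htpy T Γ Φ q s → Htpy T Γ Φ p s
  | ⟨_, hw⟩, ⟨_, hw'⟩ => ⟨_, pathComp_isElem h hp hq hs hw hw'⟩

/-- Dependent context morphisms preserve homotopies. -/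
theorem Htpy.app (h : IsCtx T (Γ.append Φ)) {Ψ : Tele T.sig m k} (hΨ : IsCtx T (Γ.append Ψ))
    {f : Sub T.sig k (m + n)} (hf : IsElem T (Γ.append Φ) (Ψ.wk n) f) {p q : Sub T.sig n m}
    (hp : IsElem T Γ Φ p) (hq : IsElem T Γ Φ q) : Htpy T Γ Φ p q →
    Htpy T Γ Ψ (fun i => (f i).subst (Fin.append Expr.var p))
      (fun i => (f i).subst (Fin.append Expr.var q))
  | ⟨_, hw⟩ => ⟨_, relMap_isElem h hΨ hf hp hq hw⟩

/-- Composition with `q` is a context morphism from `Id_Φ(a, b)` to `Id_Φ(a, c)`: it is the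
composite of the generic path and `q`. As such it preserves homotopies. -/
theorem Htpy.pathComp_left (h : IsCtx T (Γ.append Φ)) {a b c p p' q : Sub T.sig n m}
    (ha : IsElem T Γ Φ a) (hb : IsElem T Γ Φ b) (hc : IsElem T Γ Φ c)
    (hp : IsElem T Γ (idTele Φ a b) p) (hp' : IsElem T Γ (idTele Φ a b) p')
    (hq : IsElem T Γ (idTele Φ b c) q) (w : Htpy T Γ (idTele Φ a b) p p') :
    Htpy T Γ (idTele Φ a c) (pathComp b c p q) (pathComp b c p' q) := by
  have hΘ := isCtx_idTele h ha hb
  have hv := isElem_natAdd hΘ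
  have hq' := hq.wk hΘ
  rw [idTele_wk] at hv hq'
  have := pathComp_isElem (isCtx_wk hΘ h) (ha.wk hΘ) (hb.wk hΘ) (hc.wk hΘ) hv hq'
  rw [← idTele_wk] at this
  have := w.app hΘ (isCtx_idTele h ha hc) this hp hp'
  simp only [pathComp_subst, wk_subst_append, subst_var, var_subst, Fin.append_right] at this
  exact this

theorem Htpy.pathComp_right (h : IsCtx T (Γ.append Φ)) {a b c p q q' : Sub T.sig n m}
    (ha : IsElem T Γ Φ a) (hb : IsElem T Γ Φ b) (hc : IsElem T Γ Φ c)
    (hp : IsElem T Γ (idTele Φ a b) p) (hq : IsElem T Γ (idTele Φ b c) q)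
    (hq' : IsElem T Γ (idTele Φ b c) q') (w : Htpy T Γ (idTele Φ b c) q q') :
    Htpy T Γ (idTele Φ a c) (pathComp b c p q) (pathComp b c p q') := by
  have hΘ := isCtx_idTele h hb hc
  have hv := isElem_natAdd hΘ
  have hp' := hp.wk hΘ
  rw [idTele_wk] at hv hp'
  have := pathComp_isElem (isCtx_wk hΘ h) (ha.wk hΘ) (hb.wk hΘ) (hc.wk hΘ) hp' hv
  rw [← idTele_wk] at this
  have := w.app hΘ (isCtx_idTele h ha hc) this hq hq'
  simp only [pathComp_subst, wk_subst_append, subst_var, var_subst, Fin.append_right] at this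
  exact this

theorem Htpy.pathInv (h : IsCtx T (Γ.append Φ)) {a b p p' : Sub T.sig n m}
    (ha : IsElem T Γ Φ a) (hb : IsElem T Γ Φ b)
    (hp : IsElem T Γ (idTele Φ a b) p) (hp' : IsElem T Γ (idTele Φ a b) p')
    (w : Htpy T Γ (idTele Φ a b) p p') :
    Htpy T Γ (idTele Φ b a) (pathInv a b p) (pathInv a b p') := by
  have hΘ := isCtx_idTele h ha hb
  have hv := isElem_natAdd hΘ
  rw [idTele_wk] at hv
  have := pathInv_isElem (isCtx_wk hΘ h) (ha.wk hΘ) (hb.wk hΘ) hv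
  rw [← idTele_wk] at this
  have := w.app hΘ (isCtx_idTele h hb ha) this hp hp'
  simp only [pathInv_subst, wk_subst_append, subst_var, var_subst, Fin.append_right] at this
  exact this

theorem Htpy.relMap (h : IsCtx T (Γ.append Φ)) {Ψ : Tele T.sig m k} (hΨ : IsCtx T (Γ.append Ψ))
    {f : Sub T.sig k (m + n)} (hf : IsElem T (Γ.append Φ) (Ψ.wk n) f) {a b p p' : Sub T.sig n m}
    (ha : IsElem T Γ Φ a) (hb : IsElem T Γ Φ b)
    (hp : IsElem T Γ (idTele Φ a b) p) (hp' : IsElem T Γ (idTele Φ a b) p')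
    (w : Htpy T Γ (idTele Φ a b) p p') :
    Htpy T Γ (idTele Ψ (fun i => (f i).subst (Fin.append Expr.var a))
      (fun i => (f i).subst (Fin.append Expr.var b))) (relMap f a b p) (relMap f a b p') := by
  have hΘ := isCtx_idTele h ha hb
  have hv := isElem_natAdd hΘ
  rw [idTele_wk] at hv
  have hf' := hf.lift h hΘ (isMor_castAdd hΘ)
  have hfa := hf.app h ha
  have hfb := hf.app h hb
  have := relMap_isElem (isCtx_wk hΘ h) (isCtx_wk hΘ hΨ) hf' (ha.wk hΘ) (hb.wk hΘ) hv
  have e : ∀ a : Sub T.sig n m,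
      (fun i => ((f i).subst (liftSub (fun i => Expr.var (Fin.castAdd n i)) n)).subst
        (Fin.append Expr.var fun i => (a i).wk n)) =
      fun i => ((f i).subst (Fin.append Expr.var a)).wk n := by
    intro a
    funext i
    rw [subst_liftSub_append, wk_eq_subst, subst_append_subst]
    simp only [wk_eq_subst, var_subst]
  rw [e, e] at this
  erw [← idTele_wk] at this
  have := w.app hΘ (isCtx_idTele hΨ hfa hfb) this hp hp'
  simp only [relMap_subst, wk_subst_append, subst_var, var_subst, Fin.append_right, subst_subst,
    liftSub_comp, liftSub_var, Fin.append_left] at this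
  exact this

end Homotopy

/-! ### Closed contexts regarded as dependent contexts -/

section ToTele

variable {T : TypeTheory.{u}} {m l n k : ℕ}

/-- A closed context does not mention the ambient variables. -/
theorem Ctx.toTele_subst {S : Signature.{u}} (σ : Sub S m l) :
    {n : ℕ} → (Φ : Ctx S n) → (Φ.toTele m).subst σ = Φ.toTele l
  | _, .nil => rfl
  | _, .snoc Φ A => by
    rw [Ctx.toTele, Ctx.toTele, Tele.subst, toTele_subst σ Φ, rename_subst,
      rename_eq_subst A (Fin.natAdd l)]
    congr 2
    funext i
    exact liftSub_natAdd σ _ i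

theorem rename_natAdd_subst {S : Signature.{u}} (A : Expr S n) (σ : Sub S m l) (a : Sub S n l) :
    (A.rename (Fin.natAdd m)).subst (Fin.append σ a) = A.subst a := by
  rw [rename_subst]
  congr 1
  funext i
  exact Fin.append_right σ a i

theorem isCtx_nil : IsCtx T .nil := trivial

theorem rename_natAdd {S : Signature.{u}} (A : Expr S n) :
    A.rename (Fin.natAdd m) = A.subst fun i => .var (Fin.natAdd m i) :=
  rename_eq_subst A _

theorem isElem_toTele_iff {Γ : Ctx T.sig m} : {n : ℕ} → {Φ : Ctx T.sig n} → {a : Sub T.sig n m} →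
    (IsElem T Γ (Φ.toTele m) a ↔ IsMor T Γ Φ a)
  | _, .nil, _ => Iff.rfl
  | _, .snoc Φ A, a => by
    simp only [Ctx.toTele, IsElem, IsMor, rename_natAdd_subst, isElem_toTele_iff (Φ := Φ)]

theorem elemEq_toTele_iff {Γ : Ctx T.sig m} : {n : ℕ} → {Φ : Ctx T.sig n} →
    {a b : Sub T.sig n m} → (ElemEq T Γ (Φ.toTele m) a b ↔ MorEq T Γ Φ a b)
  | _, .nil, _, _ => Iff.rfl
  | _, .snoc Φ A, a, b => by
    simp only [Ctx.toTele, ElemEq, MorEq, rename_natAdd_subst, elemEq_toTele_iff (Φ := Φ)]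

theorem isMor_natAdd {Γ : Ctx T.sig m} {Φ : Ctx T.sig n} (h : IsCtx T (Γ.append (Φ.toTele m))) :
    IsMor T (Γ.append (Φ.toTele m)) Φ fun i => .var (Fin.natAdd m i) := by
  have := isElem_natAdd h
  rwa [Tele.wk, Ctx.toTele_subst, isElem_toTele_iff] at this

theorem isCtx_toTele {Γ : Ctx T.sig m} (hΓ : IsCtx T Γ) : {n : ℕ} → {Φ : Ctx T.sig n} →
    IsCtx T Φ → IsCtx T (Γ.append (Φ.toTele m))
  | _, .nil, _ => hΓ
  | _, .snoc Φ A, h => by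
    have h₁ := isCtx_toTele hΓ h.1
    have := h.2.msubst h₁ (isMor_natAdd h₁)
    rw [Judgement.subst, ← rename_natAdd] at this
    exact ⟨h₁, this⟩

theorem ctxEq_toTele {Γ : Ctx T.sig m} (hΓ : IsCtx T Γ) : {n : ℕ} → {Φ Φ' : Ctx T.sig n} →
    IsCtx T Φ → CtxEq T Φ Φ' → CtxEq T (Γ.append (Φ.toTele m)) (Γ.append (Φ'.toTele m))
  | _, .nil, .nil, _, _ => CtxEq.refl hΓ
  | _, .snoc Φ A, .snoc Φ' A', h, e => by
    have h₁ := isCtx_toTele hΓ h.1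
    have := e.2.msubst h₁ (isMor_natAdd h₁)
    rw [Judgement.subst, ← rename_natAdd, ← rename_natAdd] at this
    exact ⟨ctxEq_toTele hΓ h.1 e.1, this⟩

theorem IsMor.toTele {Γ : Ctx T.sig m} (hΓ : IsCtx T Γ) {Φ : Ctx T.sig n} {Ψ : Ctx T.sig k}
    (hΦ : IsCtx T Φ) {f : Sub T.sig k n} (hf : IsMor T Φ Ψ f) :
    IsElem T (Γ.append (Φ.toTele m)) ((Ψ.toTele m).wk n) fun i => (f i).rename (Fin.natAdd m) := by
  have h₁ := isCtx_toTele hΓ hΦ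
  have := IsMor.comp h₁ (isMor_natAdd h₁) hf
  rw [Tele.wk, Ctx.toTele_subst, isElem_toTele_iff]
  simpa only [rename_natAdd] using this

theorem MorEq.toTele {Γ : Ctx T.sig m} (hΓ : IsCtx T Γ) {Φ : Ctx T.sig n} {Ψ : Ctx T.sig k}
    (hΦ : IsCtx T Φ) {f g : Sub T.sig k n} (hf : MorEq T Φ Ψ f g) :
    ElemEq T (Γ.append (Φ.toTele m)) ((Ψ.toTele m).wk n) (fun i => (f i).rename (Fin.natAdd m))
      fun i => (g i).rename (Fin.natAdd m) := by
  have h₁ := isCtx_toTele hΓ hΦ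
  have := MorEq.comp h₁ (MorEq.refl (isMor_natAdd h₁)) hf
  rw [Tele.wk, Ctx.toTele_subst, elemEq_toTele_iff]
  simpa only [rename_natAdd] using this

end ToTele

/-! ### The case of the empty ambient context: global elements and paths -/

section Global

variable {T : TypeTheory.{u}} {n k r : ℕ} {Φ : Ctx T.sig n} {Ψ : Ctx T.sig k} {Ξ : Ctx T.sig r}

/-- `p` and `q` are homotopic paths from `a` to `b` in `Φ`. -/
def PathHtpy (T : TypeTheory.{u}) {n : ℕ} (Φ : Ctx T.sig n) (a b p q : Sub T.sig n 0) : Prop :=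
  Htpy T .nil (idTele (Φ.toTele 0) a b) p q

theorem isCtx_toTele_nil (hΦ : IsCtx T Φ) : IsCtx T (Ctx.nil.append (Φ.toTele 0)) :=
  isCtx_toTele isCtx_nil hΦ

theorem isCtx_paths (hΦ : IsCtx T Φ) {a b : Sub T.sig n 0} (ha : IsMor T .nil Φ a)
    (hb : IsMor T .nil Φ b) : IsCtx T (Ctx.nil.append (idTele (Φ.toTele 0) a b)) :=
  isCtx_idTele (isCtx_toTele_nil hΦ) (isElem_toTele_iff.2 ha) (isElem_toTele_iff.2 hb)

theorem ctxEq_paths (hΦ : IsCtx T Φ) {Φ' : Ctx T.sig n} (e : CtxEq T Φ Φ')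
    {a b a' b' : Sub T.sig n 0} (ha : MorEq T .nil Φ a a') (hb : MorEq T .nil Φ b b') :
    CtxEq T (Ctx.nil.append (idTele (Φ.toTele 0) a b))
      (Ctx.nil.append (idTele (Φ'.toTele 0) a' b')) :=
  ctxEq_idTele (isCtx_toTele_nil hΦ) (ctxEq_toTele isCtx_nil hΦ e)
    (elemEq_toTele_iff.2 ha) (elemEq_toTele_iff.2 hb)

theorem IsPath.conv (hΦ : IsCtx T Φ) {Φ' : Ctx T.sig n} (e : CtxEq T Φ Φ')
    {a b a' b' p : Sub T.sig n 0} (ha : MorEq T .nil Φ a a') (hb : MorEq T .nil Φ b b')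
    (hp : IsPath T Φ a b p) : IsPath T Φ' a' b' p :=
  IsElem.conv isCtx_nil hp (ctxEq_paths hΦ e ha hb)

theorem PathHtpy.conv (hΦ : IsCtx T Φ) {Φ' : Ctx T.sig n} (e : CtxEq T Φ Φ')
    {a b a' b' p q : Sub T.sig n 0} (ha : MorEq T .nil Φ a a') (hb : MorEq T .nil Φ b b')
    (hp : IsPath T Φ a b p) (hq : IsPath T Φ a b q) :
    PathHtpy T Φ a b p q → PathHtpy T Φ' a' b' p q
  | ⟨w, hw⟩ => ⟨w, IsElem.conv isCtx_nil hw
      (ctxEq_idTele (isCtx_paths hΦ ha.isMor_left hb.isMor_left) (ctxEq_paths hΦ e ha hb)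
        (ElemEq.refl isCtx_nil hp) (ElemEq.refl isCtx_nil hq))⟩

theorem IsPath.refl (hΦ : IsCtx T Φ) {a : Sub T.sig n 0} (ha : IsMor T .nil Φ a) :
    IsPath T Φ a a (pathRefl a) :=
  pathRefl_isElem (isCtx_toTele_nil hΦ) (isElem_toTele_iff.2 ha)

theorem IsPath.comp (hΦ : IsCtx T Φ) {a b c p q : Sub T.sig n 0} (ha : IsMor T .nil Φ a)
    (hb : IsMor T .nil Φ b) (hc : IsMor T .nil Φ c) (hp : IsPath T Φ a b p)
    (hq : IsPath T Φ b c q) : IsPath T Φ a c (pathComp b c p q) :=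
  pathComp_isElem (isCtx_toTele_nil hΦ) (isElem_toTele_iff.2 ha) (isElem_toTele_iff.2 hb)
    (isElem_toTele_iff.2 hc) hp hq

theorem IsPath.inv (hΦ : IsCtx T Φ) {a b p : Sub T.sig n 0} (ha : IsMor T .nil Φ a)
    (hb : IsMor T .nil Φ b) (hp : IsPath T Φ a b p) : IsPath T Φ b a (pathInv a b p) :=
  pathInv_isElem (isCtx_toTele_nil hΦ) (isElem_toTele_iff.2 ha) (isElem_toTele_iff.2 hb) hp

theorem IsPath.map (hΦ : IsCtx T Φ) (hΨ : IsCtx T Ψ) {f : Sub T.sig k n} (hf : IsMor T Φ Ψ f)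
    {a b p : Sub T.sig n 0} (ha : IsMor T .nil Φ a) (hb : IsMor T .nil Φ b)
    (hp : IsPath T Φ a b p) :
    IsPath T Ψ (fun i => (f i).subst a) (fun i => (f i).subst b) (pathMap f a b p) := by
  have := relMap_isElem (isCtx_toTele_nil hΦ) (isCtx_toTele_nil hΨ) (hf.toTele isCtx_nil hΦ)
    (isElem_toTele_iff.2 ha) (isElem_toTele_iff.2 hb) hp
  simp only [rename_natAdd_subst] at this
  exact this

theorem PathHtpy.of_eq (hΦ : IsCtx T Φ) {a b p q : Sub T.sig n 0} (ha : IsMor T .nil Φ a)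
    (hb : IsMor T .nil Φ b) (h : ElemEq T .nil (idTele (Φ.toTele 0) a b) p q) :
    PathHtpy T Φ a b p q :=
  Htpy.of_eq (isCtx_paths hΦ ha hb) h

theorem PathHtpy.map (hΦ : IsCtx T Φ) (hΨ : IsCtx T Ψ) {f : Sub T.sig k n} (hf : IsMor T Φ Ψ f)
    {a b p q : Sub T.sig n 0} (ha : IsMor T .nil Φ a) (hb : IsMor T .nil Φ b)
    (hp : IsPath T Φ a b p) (hq : IsPath T Φ a b q) (h : PathHtpy T Φ a b p q) :
    PathHtpy T Ψ (fun i => (f i).subst a) (fun i => (f i).subst b) (pathMap f a b p)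
      (pathMap f a b q) := by
  have := Htpy.relMap (isCtx_toTele_nil hΦ) (isCtx_toTele_nil hΨ) (hf.toTele isCtx_nil hΦ)
    (isElem_toTele_iff.2 ha) (isElem_toTele_iff.2 hb) hp hq h
  simp only [rename_natAdd_subst] at this
  exact this

/-- First `f` is replaced by `g` up to homotopy, then the endpoints up to definitional equality.
This yields independence of all representatives at once. -/
theorem pathMap_congr (hΦ : IsCtx T Φ) (hΨ : IsCtx T Ψ) {f g : Sub T.sig k n}
    (hfg : MorEq T Φ Ψ f g) {a b a' b' p : Sub T.sig n 0} (ha : MorEq T .nil Φ a a')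
    (hb : MorEq T .nil Φ b b') (hp : IsPath T Φ a b p) :
    PathHtpy T Ψ (fun i => (f i).subst a) (fun i => (f i).subst b) (pathMap f a b p)
      (pathMap g a' b' p) := by
  have hΦ' := isCtx_toTele_nil hΦ
  have hΨ' := isCtx_toTele_nil hΨ
  have hf := hfg.isMor_left
  have hg := MorEq.isMor_left (MorEq.symm hΦ hΨ hfg)
  have e := MorEq.comp (isCtx_nil (T := T)) (MorEq.refl ha.isMor_left) hfg
  have e' := MorEq.comp (isCtx_nil (T := T)) (MorEq.refl hb.isMor_left) hfg
  have hfa := IsMor.comp (isCtx_nil (T := T)) ha.isMor_left hf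
  have hfb := IsMor.comp (isCtx_nil (T := T)) hb.isMor_left hf
  have h₁ := relMap_congr hΦ' hΨ' (hfg.toTele isCtx_nil hΦ) (isElem_toTele_iff.2 ha.isMor_left)
    (isElem_toTele_iff.2 hb.isMor_left) hp
  have h₂ := relMap_elemEq hΦ' hΨ' (hg.toTele isCtx_nil hΦ) (elemEq_toTele_iff.2 ha)
    (elemEq_toTele_iff.2 hb) (ElemEq.refl isCtx_nil hp)
  simp only [rename_natAdd_subst] at h₁ h₂
  have h₃ := h₂.conv isCtx_nil (CtxEq.symm
    (isCtx_paths hΨ (IsMor.comp isCtx_nil ha.isMor_left hg) (IsMor.comp isCtx_nil hb.isMor_left hg))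
    (ctxEq_paths hΨ (CtxEq.refl hΨ) e e'))
  have hc := isCtx_paths hΨ hfa hfb
  exact Htpy.trans hc (IsPath.map hΦ hΨ hf ha.isMor_left hb.isMor_left hp) (h₃.left isCtx_nil)
    (h₃.right hc) h₁ (Htpy.of_eq hc h₃)

theorem pathMap_refl (hΦ : IsCtx T Φ) (hΨ : IsCtx T Ψ) {f : Sub T.sig k n} (hf : IsMor T Φ Ψ f)
    {a : Sub T.sig n 0} (ha : IsMor T .nil Φ a) :
    PathHtpy T Ψ (fun i => (f i).subst a) (fun i => (f i).subst a) (pathMap f a a (pathRefl a))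
      (pathRefl fun i => (f i).subst a) := by
  have := relMap_refl (isCtx_toTele_nil hΦ) (isCtx_toTele_nil hΨ) (hf.toTele isCtx_nil hΦ)
    (isElem_toTele_iff.2 ha)
  simp only [rename_natAdd_subst] at this
  have hfa := IsMor.comp (isCtx_nil (T := T)) ha hf
  exact PathHtpy.of_eq hΨ hfa hfa this

theorem pathMap_comp (hΦ : IsCtx T Φ) (hΨ : IsCtx T Ψ) {f : Sub T.sig k n} (hf : IsMor T Φ Ψ f)
    {a b c p q : Sub T.sig n 0} (ha : IsMor T .nil Φ a) (hb : IsMor T .nil Φ b)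
    (hc : IsMor T .nil Φ c) (hp : IsPath T Φ a b p) (hq : IsPath T Φ b c q) :
    PathHtpy T Ψ (fun i => (f i).subst a) (fun i => (f i).subst c)
      (pathMap f a c (pathComp b c p q))
      (pathComp (fun i => (f i).subst b) (fun i => (f i).subst c) (pathMap f a b p)
        (pathMap f b c q)) := by
  have := relMap_comp (isCtx_toTele_nil hΦ) (isCtx_toTele_nil hΨ) (hf.toTele isCtx_nil hΦ)
    (isElem_toTele_iff.2 ha) (isElem_toTele_iff.2 hb) (isElem_toTele_iff.2 hc) hp hq
  simp only [rename_natAdd_subst] at this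
  exact this

theorem pathMap_var (hΦ : IsCtx T Φ) {a b p : Sub T.sig n 0} (ha : IsMor T .nil Φ a)
    (hb : IsMor T .nil Φ b) (hp : IsPath T Φ a b p) :
    PathHtpy T Φ a b (pathMap Expr.var a b p) p :=
  relMap_var (isCtx_toTele_nil hΦ) (isElem_toTele_iff.2 ha) (isElem_toTele_iff.2 hb) hp

theorem pathMap_pathMap (hΦ : IsCtx T Φ) (hΨ : IsCtx T Ψ) (hΞ : IsCtx T Ξ) {f : Sub T.sig k n}
    (hf : IsMor T Φ Ψ f) {g : Sub T.sig r k} (hg : IsMor T Ψ Ξ g) {a b p : Sub T.sig n 0}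
    (ha : IsMor T .nil Φ a) (hb : IsMor T .nil Φ b) (hp : IsPath T Φ a b p) :
    PathHtpy T Ξ (fun i => (g i).subst fun j => (f j).subst a)
      (fun i => (g i).subst fun j => (f j).subst b)
      (pathMap g (fun i => (f i).subst a) (fun i => (f i).subst b) (pathMap f a b p))
      (pathMap (fun i => (g i).subst f) a b p) := by
  have := relMap_relMap (isCtx_toTele_nil hΦ) (isCtx_toTele_nil hΨ) (isCtx_toTele_nil hΞ)
    (hf.toTele isCtx_nil hΦ) (hg.toTele isCtx_nil hΨ)
    (isElem_toTele_iff.2 ha) (isElem_toTele_iff.2 hb) hp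
  simp only [relComp_app, rename_natAdd_subst] at this
  have e : relComp (fun i => (g i).rename (Fin.natAdd 0)) (fun i => (f i).rename (Fin.natAdd 0)) =
      fun i => ((g i).subst f).rename (Fin.natAdd 0) := by
    funext i
    rw [relComp, rename_natAdd_subst, subst_rename]
  rw [e] at this
  exact this

end Global

/-! ### Descent to the classifying category: groupoids, functors, functoriality -/

namespace Cl

variable {T : TypeTheory.{u}} {X Y Z : Cl T}

theorem exists_isRepr (X : Cl T) : ∃ Φ, X.IsRepr Φ :=
  Quotient.exists_rep X.ctx

theorem exists_homRepr (f : X ⟶ Y) : ∃ f', HomRepr f f' := by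
  obtain ⟨⟨f', h⟩, rfl⟩ := Quotient.exists_rep f
  exact ⟨f', h, rfl⟩

theorem IsRepr.ctxEq {Φ Φ' : WfCtx T X.length} (h : X.IsRepr Φ) (h' : X.IsRepr Φ') :
    CtxEq T Φ.1 Φ'.1 :=
  Quotient.exact (s := ctxSetoid T X.length) (h.trans h'.symm)

theorem IsRepr.isHom_iff {Φ : WfCtx T X.length} {Ψ : WfCtx T Y.length} (hΦ : X.IsRepr Φ)
    (hΨ : Y.IsRepr Ψ) {f : Sub T.sig Y.length X.length} : IsHom X Y f ↔ IsMor T Φ.1 Ψ.1 f := by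
  rw [IsHom, ← hΦ, ← hΨ]
  rfl

theorem IsRepr.homEq_iff {Φ : WfCtx T X.length} {Ψ : WfCtx T Y.length} (hΦ : X.IsRepr Φ)
    (hΨ : Y.IsRepr Ψ) {f g : Sub T.sig Y.length X.length} :
    HomEq X Y f g ↔ MorEq T Φ.1 Ψ.1 f g := by
  rw [HomEq, ← hΦ, ← hΨ]
  rfl

theorem HomRepr.isMor {Φ : WfCtx T X.length} {Ψ : WfCtx T Y.length} (hΦ : X.IsRepr Φ)
    (hΨ : Y.IsRepr Ψ) {f : X ⟶ Y} {f' : Sub T.sig Y.length X.length} (h : HomRepr f f') :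
    IsMor T Φ.1 Ψ.1 f' :=
  (hΦ.isHom_iff hΨ).1 h.1

theorem HomRepr.morEq {Φ : WfCtx T X.length} {Ψ : WfCtx T Y.length} (hΦ : X.IsRepr Φ)
    (hΨ : Y.IsRepr Ψ) {f : X ⟶ Y} {f' f'' : Sub T.sig Y.length X.length} (h : HomRepr f f')
    (h' : HomRepr f f'') : MorEq T Φ.1 Ψ.1 f' f'' := by
  obtain ⟨_, rfl⟩ := h
  obtain ⟨_, h'⟩ := h'
  exact (hΦ.homEq_iff hΨ).1 (Quotient.exact (s := homSetoid X Y) h'.symm)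

theorem isRepr_empty : (empty T).IsRepr ⟨.nil, isCtx_nil⟩ := rfl

/-- Paths in `X` are paths in every context that represents `X`. -/
theorem Path.isPath {Φ : WfCtx T X.length} (hΦ : X.IsRepr Φ) {a b : Pt X}
    {a' b' : Sub T.sig X.length 0} (ha : HomRepr a a') (hb : HomRepr b b') (p : Path X a b) :
    IsPath T Φ.1 a' b' p.1 := by
  obtain ⟨p, Φ₁, a₁, b₁, hΦ₁, ha₁, hb₁, hp⟩ := p
  exact hp.conv Φ₁.2 (hΦ₁.ctxEq hΦ) (ha₁.morEq isRepr_empty hΦ₁ ha)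
    (hb₁.morEq isRepr_empty hΦ₁ hb)

/-- Homotopy is defined by the existence of some representatives; conversion of identity contexts
shows that any fixed ones will do. -/
theorem homotopic_iff {Φ : WfCtx T X.length} (hΦ : X.IsRepr Φ) {a b : Pt X}
    {a' b' : Sub T.sig X.length 0} (ha : HomRepr a a') (hb : HomRepr b b') {p q : Path X a b} :
    Homotopic p q ↔ PathHtpy T Φ.1 a' b' p.1 q.1 := by
  constructor
  · rintro ⟨Φ₁, a₁, b₁, w, hΦ₁, ha₁, hb₁, hp, hq, hw⟩
    exact PathHtpy.conv Φ₁.2 (hΦ₁.ctxEq hΦ) (ha₁.morEq isRepr_empty hΦ₁ ha)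
      (hb₁.morEq isRepr_empty hΦ₁ hb) hp hq ⟨w, hw⟩
  · rintro ⟨w, hw⟩
    exact ⟨Φ, a', b', w, hΦ, ha, hb, p.isPath hΦ ha hb, q.isPath hΦ ha hb, hw⟩

theorem PathClass.mk_of_eq {Φ : WfCtx T X.length} {hΦ : X.IsRepr Φ} {a b : Pt X}
    {a' b' p q : Sub T.sig X.length 0} {ha : HomRepr a a'} {hb : HomRepr b b'}
    {hp : IsPath T Φ.1 a' b' p} {hq : IsPath T Φ.1 a' b' q} (h : PathHtpy T Φ.1 a' b' p q) :
    PathClass.mk (.of hΦ ha hb hp) = .mk (.of hΦ ha hb hq) :=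
  Quot.sound ((homotopic_iff hΦ ha hb).2 h)

theorem PathClass.exists_of {Φ : WfCtx T X.length} (hΦ : X.IsRepr Φ) {a b : Pt X}
    {a' b' : Sub T.sig X.length 0} (ha : HomRepr a a') (hb : HomRepr b b') (P : PathClass X a b) :
    ∃ p, ∃ hp : IsPath T Φ.1 a' b' p, P = .mk (.of hΦ ha hb hp) := by
  induction P using Quot.ind with
  | mk p => exact ⟨p.1, p.isPath hΦ ha hb, rfl⟩

theorem homotopic_equivalence (a b : Pt X) : Equivalence (Homotopic (X := X) (a := a) (b := b)) := by
  obtain ⟨Φ, hΦ⟩ := exists_isRepr X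
  obtain ⟨a', ha⟩ := exists_homRepr a
  obtain ⟨b', hb⟩ := exists_homRepr b
  have hc := isCtx_paths Φ.2 (ha.isMor isRepr_empty hΦ) (hb.isMor isRepr_empty hΦ)
  refine ⟨fun p => ?_, fun {p q} => ?_, fun {p q r} => ?_⟩ <;> simp only [homotopic_iff hΦ ha hb]
  · exact Htpy.of_eq hc (ElemEq.refl isCtx_nil (p.isPath hΦ ha hb))
  · exact Htpy.symm hc (p.isPath hΦ ha hb) (q.isPath hΦ ha hb)
  · exact Htpy.trans hc (p.isPath hΦ ha hb) (q.isPath hΦ ha hb) (r.isPath hΦ ha hb)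

/-- A context that represents `X`. -/
noncomputable def repr (X : Cl T) : WfCtx T X.length := (exists_isRepr X).choose

theorem isRepr_repr (X : Cl T) : X.IsRepr X.repr := (exists_isRepr X).choose_spec

/-- A context morphism that represents `f`. -/
noncomputable def homRepr (f : X ⟶ Y) : Sub T.sig Y.length X.length := (exists_homRepr f).choose

theorem homRepr_homRepr (f : X ⟶ Y) : HomRepr f (homRepr f) := (exists_homRepr f).choose_spec

theorem isMor_homRepr (f : X ⟶ Y) : IsMor T X.repr.1 Y.repr.1 (homRepr f) :=
  (homRepr_homRepr f).isMor X.isRepr_repr Y.isRepr_repr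

theorem isMor_pt (a : Pt X) : IsMor T .nil X.repr.1 (homRepr a) :=
  (homRepr_homRepr a).isMor isRepr_empty X.isRepr_repr

theorem Path.isPath_repr {a b : Pt X} (p : Path X a b) :
    IsPath T X.repr.1 (homRepr a) (homRepr b) p.1 :=
  p.isPath X.isRepr_repr (homRepr_homRepr a) (homRepr_homRepr b)

theorem homotopic_repr_iff {a b : Pt X} {p q : Path X a b} :
    Homotopic p q ↔ PathHtpy T X.repr.1 (homRepr a) (homRepr b) p.1 q.1 :=
  homotopic_iff X.isRepr_repr (homRepr_homRepr a) (homRepr_homRepr b)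

namespace Path

variable {a b c : Pt X}

/-- The trivial path. -/
noncomputable def refl (a : Pt X) : Path X a a :=
  .of X.isRepr_repr (homRepr_homRepr a) (homRepr_homRepr a) (.refl X.repr.2 (isMor_pt a))

/-- Composition of paths. -/
noncomputable def comp (p : Path X a b) (q : Path X b c) : Path X a c :=
  .of X.isRepr_repr (homRepr_homRepr a) (homRepr_homRepr c) (.comp X.repr.2 (isMor_pt a)
    (isMor_pt b) (isMor_pt c) p.isPath_repr q.isPath_repr)

/-- The inverse of a path. -/
noncomputable def inv (p : Path X a b) : Path X b a :=
  .of X.isRepr_repr (homRepr_homRepr b) (homRepr_homRepr a) (.inv X.repr.2 (isMor_pt a)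
    (isMor_pt b) p.isPath_repr)

/-- The image of a path. -/
noncomputable def map (f : X ⟶ Y) (p : Path X a b) : Path Y (a ≫ f) (b ≫ f) :=
  .of Y.isRepr_repr ((homRepr_homRepr a).comp (homRepr_homRepr f))
    ((homRepr_homRepr b).comp (homRepr_homRepr f)) (.map X.repr.2 Y.repr.2 (isMor_homRepr f)
    (isMor_pt a) (isMor_pt b) p.isPath_repr)

theorem comp_congr_left {p p' : Path X a b} (h : Homotopic p p') (q : Path X b c) :
    Homotopic (p.comp q) (p'.comp q) := by
  rw [homotopic_repr_iff] at h ⊢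
  exact Htpy.pathComp_left (isCtx_toTele_nil X.repr.2) (isElem_toTele_iff.2 (isMor_pt a))
    (isElem_toTele_iff.2 (isMor_pt b)) (isElem_toTele_iff.2 (isMor_pt c)) p.isPath_repr
    p'.isPath_repr q.isPath_repr h

theorem comp_congr_right (p : Path X a b) {q q' : Path X b c} (h : Homotopic q q') :
    Homotopic (p.comp q) (p.comp q') := by
  rw [homotopic_repr_iff] at h ⊢
  exact Htpy.pathComp_right (isCtx_toTele_nil X.repr.2) (isElem_toTele_iff.2 (isMor_pt a))
    (isElem_toTele_iff.2 (isMor_pt b)) (isElem_toTele_iff.2 (isMor_pt c)) p.isPath_repr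
    q.isPath_repr q'.isPath_repr h

theorem inv_congr {p p' : Path X a b} (h : Homotopic p p') : Homotopic p.inv p'.inv := by
  rw [homotopic_repr_iff] at h ⊢
  exact Htpy.pathInv (isCtx_toTele_nil X.repr.2) (isElem_toTele_iff.2 (isMor_pt a))
    (isElem_toTele_iff.2 (isMor_pt b)) p.isPath_repr p'.isPath_repr h

theorem map_congr (f : X ⟶ Y) {p p' : Path X a b} (h : Homotopic p p') :
    Homotopic (p.map f) (p'.map f) := by
  rw [homotopic_repr_iff] at h
  rw [homotopic_iff Y.isRepr_repr ((homRepr_homRepr a).comp (homRepr_homRepr f))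
    ((homRepr_homRepr b).comp (homRepr_homRepr f))]
  exact PathHtpy.map X.repr.2 Y.repr.2 (isMor_homRepr f) (isMor_pt a) (isMor_pt b) p.isPath_repr
    p'.isPath_repr h

end Path

/-- The fundamental groupoid of `X`. -/
noncomputable def fundamentalGroupoid (X : Cl T) : FundamentalGroupoid X where
  equivalence := homotopic_equivalence
  id a := .mk (.refl a)
  comp := Quot.map₂ Path.comp (fun p _ _ h => p.comp_congr_right h)
    fun _ _ q h => Path.comp_congr_left h q
  inv := Quot.map Path.inv fun _ _ => Path.inv_congr
  id_eq {a Φ a'} hΦ ha := by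
    have hm := ha.isMor isRepr_empty hΦ
    have e := (homRepr_homRepr a).morEq isRepr_empty hΦ ha
    refine ⟨.refl Φ.2 hm, Quot.sound ((homotopic_iff hΦ ha ha).2 ?_)⟩
    -- The chosen representative of `a` and the given `a'` are definitionally equal, so their
    -- trivial paths are equal and hence homotopic.
    exact PathHtpy.of_eq Φ.2 hm hm ((pathRefl_congr (isCtx_toTele_nil Φ.2)
      (elemEq_toTele_iff.2 (MorEq.symm isCtx_nil Φ.2 e))).symm (isCtx_paths Φ.2 hm hm))
  comp_eq {a b c Φ a' b' c' p q} hΦ ha hb hc hp hq := by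
    have ha' := ha.isMor isRepr_empty hΦ
    have hc' := hc.isMor isRepr_empty hΦ
    refine ⟨.comp Φ.2 ha' (hb.isMor isRepr_empty hΦ) hc' hp hq,
      Quot.sound ((homotopic_iff hΦ ha hc).2 ?_)⟩
    exact PathHtpy.of_eq Φ.2 ha' hc' ((pathComp_elemEq (isCtx_toTele_nil Φ.2)
      (isElem_toTele_iff.2 ha') (elemEq_toTele_iff.2 (hb.morEq isRepr_empty hΦ (homRepr_homRepr b)))
      (elemEq_toTele_iff.2 (hc.morEq isRepr_empty hΦ (homRepr_homRepr c)))
      (ElemEq.refl isCtx_nil hp) (ElemEq.refl isCtx_nil hq)).symm (isCtx_paths Φ.2 ha' hc'))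
  inv_eq {a b Φ a' b' p} hΦ ha hb hp := by
    have ha' := ha.isMor isRepr_empty hΦ
    have hb' := hb.isMor isRepr_empty hΦ
    refine ⟨.inv Φ.2 ha' hb' hp, Quot.sound ((homotopic_iff hΦ hb ha).2 ?_)⟩
    exact PathHtpy.of_eq Φ.2 hb' ha' ((pathInv_elemEq (isCtx_toTele_nil Φ.2)
      (elemEq_toTele_iff.2 (ha.morEq isRepr_empty hΦ (homRepr_homRepr a)))
      (elemEq_toTele_iff.2 (hb.morEq isRepr_empty hΦ (homRepr_homRepr b)))
      (ElemEq.refl isCtx_nil hp)).symm (isCtx_paths Φ.2 hb' ha'))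
  id_comp {a b} P := by
    induction P using Quot.ind with
    | mk p =>
      exact Quot.sound (homotopic_repr_iff.2 (pathComp_refl_left (isCtx_toTele_nil X.repr.2)
        (isElem_toTele_iff.2 (isMor_pt a)) (isElem_toTele_iff.2 (isMor_pt b)) p.isPath_repr))
  comp_id {a b} P := by
    induction P using Quot.ind with
    | mk p =>
      exact Quot.sound (homotopic_repr_iff.2 (PathHtpy.of_eq X.repr.2 (isMor_pt a) (isMor_pt b)
        (pathComp_refl (isCtx_toTele_nil X.repr.2) (isElem_toTele_iff.2 (isMor_pt a))
          (isElem_toTele_iff.2 (isMor_pt b)) p.isPath_repr)))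
  assoc {a b c d} P Q R := by
    induction P using Quot.ind with
    | mk p =>
      induction Q using Quot.ind with
      | mk q =>
        induction R using Quot.ind with
        | mk r =>
          exact Quot.sound (homotopic_repr_iff.2 (pathComp_assoc (isCtx_toTele_nil X.repr.2)
            (isElem_toTele_iff.2 (isMor_pt a)) (isElem_toTele_iff.2 (isMor_pt b))
            (isElem_toTele_iff.2 (isMor_pt c)) (isElem_toTele_iff.2 (isMor_pt d))
            p.isPath_repr q.isPath_repr r.isPath_repr))
  inv_comp {a b} P := by
    induction P using Quot.ind with
    | mk p =>
      exact Quot.sound (homotopic_repr_iff.2 (pathComp_inv_left (isCtx_toTele_nil X.repr.2)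
        (isElem_toTele_iff.2 (isMor_pt a)) (isElem_toTele_iff.2 (isMor_pt b)) p.isPath_repr))
  comp_inv {a b} P := by
    induction P using Quot.ind with
    | mk p =>
      exact Quot.sound (homotopic_repr_iff.2 (pathComp_inv_right (isCtx_toTele_nil X.repr.2)
        (isElem_toTele_iff.2 (isMor_pt a)) (isElem_toTele_iff.2 (isMor_pt b)) p.isPath_repr))

theorem map_mk_of (f : X ⟶ Y) {a b : Pt X} {Φ : WfCtx T X.length} {Ψ : WfCtx T Y.length}
    {f' : Sub T.sig Y.length X.length} {a' b' p : Sub T.sig X.length 0}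
    (hΦ : X.IsRepr Φ) (hΨ : Y.IsRepr Ψ) (hf : HomRepr f f') (ha : HomRepr a a') (hb : HomRepr b b')
    (hp : IsPath T Φ.1 a' b' p) :
    ∃ h : IsPath T Ψ.1 (fun i => (f' i).subst a') (fun i => (f' i).subst b') (pathMap f' a' b' p),
      PathClass.mk ((Path.of hΦ ha hb hp).map f) =
        .mk (.of hΨ (ha.comp hf) (hb.comp hf) h) := by
  have h := IsPath.map Φ.2 Ψ.2 (hf.isMor hΦ hΨ) (ha.isMor isRepr_empty hΦ)
    (hb.isMor isRepr_empty hΦ) hp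
  refine ⟨h, (Quot.sound ((homotopic_iff hΨ (ha.comp hf) (hb.comp hf)).2 ?_)).symm⟩
  exact pathMap_congr Φ.2 Ψ.2 (hf.morEq hΦ hΨ (homRepr_homRepr f))
    (ha.morEq isRepr_empty hΦ (homRepr_homRepr a)) (hb.morEq isRepr_empty hΦ (homRepr_homRepr b)) hp

/-- The functor between fundamental groupoids that is induced by `f`. -/
noncomputable def fundamentalMap (f : X ⟶ Y) :
    X.fundamentalGroupoid.Map Y.fundamentalGroupoid f where
  map := Quot.map (Path.map f) fun _ _ => Path.map_congr f
  map_eq := map_mk_of f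
  map_id a := by
    have hf := homRepr_homRepr f
    have ha := homRepr_homRepr a
    obtain ⟨h, e⟩ := Y.fundamentalGroupoid.id_eq Y.isRepr_repr (ha.comp hf)
    rw [e]
    exact PathClass.mk_of_eq (pathMap_refl X.repr.2 Y.repr.2 (isMor_homRepr f) (isMor_pt a))
  map_comp {a b c} P Q := by
    induction P using Quot.ind with
    | mk p =>
      induction Q using Quot.ind with
      | mk q =>
        have hf := homRepr_homRepr f
        have ha := (homRepr_homRepr a).comp hf
        have hb := (homRepr_homRepr b).comp hf
        have hc := (homRepr_homRepr c).comp hf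
        -- Composition in `Y` uses representatives chosen for the points `a ≫ f`, `b ≫ f`, `c ≫ f`;
        -- `comp_eq` allows the substituted expressions instead.
        obtain ⟨h, e⟩ := Y.fundamentalGroupoid.comp_eq Y.isRepr_repr ha hb hc
          ((p.map f).isPath Y.isRepr_repr ha hb) ((q.map f).isPath Y.isRepr_repr hb hc)
        refine Eq.trans ?_ e.symm
        exact PathClass.mk_of_eq (hΦ := Y.isRepr_repr) (ha := ha) (hb := hc)
          (hp := ((p.comp q).map f).isPath Y.isRepr_repr ha hc)
          (pathMap_comp X.repr.2 Y.repr.2 (isMor_homRepr f)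
          (isMor_pt a) (isMor_pt b) (isMor_pt c) p.isPath_repr q.isPath_repr)

/-- The endpoints `a ≫ 𝟙 X` and `a`, or `a ≫ f ≫ g` and `(a ≫ f) ≫ g`, are equal maps but not the
same expression, so functoriality on paths is a heterogeneous equality. Once the points are
identified, it is homotopy of the representing paths. -/
theorem PathClass.heq_of_pathHtpy {Φ : WfCtx T X.length} {hΦ : X.IsRepr Φ} {a b c d : Pt X}
    (hac : a = c) (hbd : b = d) {a' b' c' d' p q : Sub T.sig X.length 0} {ha : HomRepr a a'}
    {hb : HomRepr b b'} {hc : HomRepr c c'} {hd : HomRepr d d'}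
    {hp : IsPath T Φ.1 a' b' p} {hq : IsPath T Φ.1 c' d' q} (h : PathHtpy T Φ.1 a' b' p q) :
    HEq (PathClass.mk (.of hΦ ha hb hp)) (PathClass.mk (.of hΦ hc hd hq)) := by
  subst hac hbd
  exact heq_of_eq (Quot.sound ((homotopic_iff hΦ ha hb).2 h))

theorem fundamentalMap_id (X : Cl T) {a b : Pt X} (P : PathClass X a b) :
    HEq ((fundamentalMap (𝟙 X)).map P) P := by
  have ha := homRepr_homRepr a
  have hb := homRepr_homRepr b
  have hid : HomRepr (𝟙 X) Expr.var := ⟨isHom_id X, rfl⟩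
  obtain ⟨p, hp, rfl⟩ := P.exists_of X.isRepr_repr ha hb
  obtain ⟨h, e⟩ := (fundamentalMap (𝟙 X)).map_eq X.isRepr_repr X.isRepr_repr hid ha hb hp
  rw [e]
  exact PathClass.heq_of_pathHtpy (Category.comp_id a) (Category.comp_id b)
    (pathMap_var X.repr.2 (isMor_pt a) (isMor_pt b) hp)

theorem fundamentalMap_comp (f : X ⟶ Y) (g : Y ⟶ Z) {a b : Pt X} (P : PathClass X a b) :
    HEq ((fundamentalMap (f ≫ g)).map P) ((fundamentalMap g).map ((fundamentalMap f).map P)) := by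
  have ha := homRepr_homRepr a
  have hb := homRepr_homRepr b
  have hf := homRepr_homRepr f
  have hg := homRepr_homRepr g
  obtain ⟨p, hp, rfl⟩ := P.exists_of X.isRepr_repr ha hb
  obtain ⟨h₁, e₁⟩ := (fundamentalMap f).map_eq X.isRepr_repr Y.isRepr_repr hf ha hb hp
  obtain ⟨h₂, e₂⟩ := (fundamentalMap g).map_eq Y.isRepr_repr Z.isRepr_repr hg (ha.comp hf)
    (hb.comp hf) h₁
  obtain ⟨h₃, e₃⟩ := (fundamentalMap (f ≫ g)).map_eq X.isRepr_repr Z.isRepr_repr (hf.comp hg)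
    ha hb hp
  rw [e₁, e₂, e₃]
  exact (PathClass.heq_of_pathHtpy (Category.assoc a f g) (Category.assoc b f g)
    (pathMap_pathMap X.repr.2 Y.repr.2 Z.repr.2 (isMor_homRepr f) (isMor_homRepr g) (isMor_pt a)
      (isMor_pt b) hp)).symm

/-- The fundamental groupoid functor. -/
noncomputable def fundamentalFunctor (T : TypeTheory.{u}) : Cl T ⥤ Grpd.{u, u} where
  obj X := X.fundamentalGroupoid.toGrpd
  map f := (fundamentalMap f).toHom
  map_id X := Functor.hext (fun a => Category.comp_id (X := empty T) a)
    fun _ _ P => fundamentalMap_id X P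
  map_comp f g := Functor.hext (fun a => (Category.assoc (W := empty T) a f g).symm)
    fun _ _ P => fundamentalMap_comp f g P

end Cl

end DTT

/-! ### The fundamental groupoid functor -/

theorem mainTheorem4 (T : DTT.TypeTheory.{u}) :
    ∃ (G : ∀ X : DTT.Cl T, X.FundamentalGroupoid)
      (M : ∀ {X Y : DTT.Cl T} (f : X ⟶ Y), (G X).Map (G Y) f)
      (F : DTT.Cl T ⥤ Grpd.{u, u}),
      F.toPrefunctor = ⟨fun X => (G X).toGrpd, fun f => (M f).toHom⟩ :=
  ⟨DTT.Cl.fundamentalGroupoid, DTT.Cl.fundamentalMap, DTT.Cl.fundamentalFunctor T, rfl⟩
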